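/- Let $k$ be an algebraically closed field, and let $X$ be either a complete (i.e. proper) scheme of finite type over $k$ or a complex space (in which case $k=\mathbb C$). Let $D$ be an effective Cartier divisor on $X$, let $E$ be a vector bundle (locally free sheaf of finite rank) on $X$, and let $\nabla:E\to E\otimes\Omega^1_X(D)$ be a rational (respectively meromorphic) connection on $E$ with divisor of poles $D$, i.e. a $k$-linear morphism of sheaves satisfying $\nabla(fs)=f\nabla s+s\otimes df$. A first-order deformation of $(E,\nabla)$ with fixed divisor of poles is a triple $(\tilde E,\tilde\nabla,\pi)$, where $\tilde E$ is a vector bundle on $X\times\operatorname{Spec}k[\epsilon]$ ($\epsilon^2=0$), i.e. a locally free $\mathcal O_X[\epsilon]$-module of finite rank, $\tilde\nabla:\tilde E\to\tilde E\otimes_{\mathcal O_X}\Omega^1_X(D)$ is a $k[\epsilon]$-linear connection, and $\pi$ is an isomorphism of the restriction of $(\tilde E,\tilde\nabla)$ to $X$ with $(E,\nabla)$. Isomorphisms of deformations are horizontal $\mathcal O_X[\epsilon]$-linear isomorphisms compatible with $\pi$. Let $\nabla_{\mathcal End}(\varphi)=\nabla\circ\varphi-(\varphi\otimes1)\circ\nabla$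 and let $\mathcal C^\bullet=[\mathcal End(E)\xrightarrow{\nabla_{\mathcal End}}\mathcal End(E)\otimes\Omega^1_X(D)]$, in degrees $0,1$. For an open covering $\mathfrak U=(U_i)$ of $X$ let $\check Z^1(\mathfrak U,\mathcal C^\bullet)$ be the group of pairs $(a,A)\in\check C^1(\mathfrak U,\mathcal End(E))\times\check C^0(\mathfrak U,\mathcal End(E)\otimes\Omega^1_X(D))$ with $\check d a=0$ and $\check d A=\nabla_{\mathcal End}(a)$, let $\check B^1(\mathfrak U,\mathcal C^\bullet)$ be the subgroup of the pairs $(\check d h,\nabla_{\mathcal End}h)$ with $h\in\check C^0(\mathfrak U,\mathcal End(E))$, let $\mathbb H^1(\mathfrak U,\mathcal C^\bullet)=\check Z^1/\check B^1$, and let $\mathbb H^1(X,\mathcal C^\bullet)$ be the colimit of these groups over all open coverings, ordered by refinement. Then there is a bijection $\Phi$ from the set of isomorphism classes of first-order deformations of $(E,\nabla)$ with fixed divisor of poles $D$ onto $\mathbb H^1(X,\mathcal C^\bullet)$ with the following property. For every open covering $\mathfrak U$, every $(a,A)\in\check Z^1(\mathfrak U,\mathcal C^\bullet)$ and every deformation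 $(\tilde E,\tilde\nabla,\pi)$, the class of the deformation is sent by $\Phi$ to the image of $[(a,A)]$ if and only if there are $\mathcal O_X$-linear splittings $\sigma_i:E|_{U_i}\to\tilde E|_{U_i}$ of $\pi$ with $$\sigma_j=\sigma_i\circ(1+\epsilon a_{ij})\ \text{ on } U_i\cap U_j,\qquad \tilde\nabla\circ\sigma_i=(\sigma_i\otimes1)\circ(\nabla+\epsilon A_i)\ \text{ on } U_i .$$ Moreover, if the covering $\mathfrak U$ is sufficiently fine (for all $i$, $E|_{U_i}$ is trivial and $H^1(U_i,\mathcal O_X)=0$; for instance $U_i$ affine, respectively Stein, with $E|_{U_i}$ trivial), then the canonical map $\mathbb H^1(\mathfrak U,\mathcal C^\bullet)\to\mathbb H^1(X,\mathcal C^\bullet)$ is bijective, so that the deformations are classified by the Čech pairs $(a,A)$ on $\mathfrak U$ modulo coboundaries. -/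

import Mathlib

open CategoryTheory TopologicalSpace Opposite AlgebraicGeometry
open scoped TensorProduct

universe w u v

noncomputable section

/-! ### Locally ringed spaces over a field -/

/-- A locally ringed space over a field `k`: a locally ringed space whose structure sheaf is a sheaf
of `k`-algebras, i.e. which comes with a ring homomorphism from `k` to the global functions. -/
structure SpaceOver (k : Type v) [Field k] where
  space : LocallyRingedSpace.{u}
  scalars : k →+* space.presheaf.obj (op ⊤)

namespace SpaceOver

variable {k : Type v} [Field k] (X : SpaceOver.{u} k)

/-- The underlying topological space. -/
abbrev Pt : TopCat.{u} := X.space.toTopCat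

/-- The ring `𝒪_X(U)`. -/
abbrev Sec (U : Opens X.Pt) : Type u := X.space.presheaf.obj (op U)

/-- The local ring `𝒪_{X,x}`. -/
abbrev Stalk (x : X.Pt) : Type u := X.space.presheaf.stalk x

/-- Restriction of functions. -/
def resFun {U V : Opens X.Pt} (h : V ≤ U) : X.Sec U →+* X.Sec V :=
  (X.space.presheaf.map (homOfLE h).op).hom

/-- The germ of a function at a point. -/
def germFun {U : Opens X.Pt} (x : U) : X.Sec U →+* X.Stalk x.1 :=
  (X.space.presheaf.germ U x.1 x.2).hom

lemma germFun_resFun {U V : Opens X.Pt} (h : V ≤ U) (f : X.Sec U) (x : V) :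
    X.germFun x (X.resFun h f) = X.germFun (⟨x.1, h x.2⟩ : U) f :=
  TopCat.Presheaf.germ_res_apply X.space.presheaf (homOfLE h) x.1 x.2 f

/-- The `k`-algebra structure of the local rings. -/
instance stalkAlgebra (x : X.Pt) : Algebra k (X.Stalk x) :=
  ((X.germFun (U := ⊤) ⟨x, trivial⟩).comp X.scalars).toAlgebra

/-- Transport of the ground field along an isomorphism of fields. -/
def changeField {k' : Type w} [Field k'] (e : k' ≃+* k) : SpaceOver.{u} k' :=
  ⟨X.space, X.scalars.comp e.toRingHom⟩

end SpaceOver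

/-- A scheme over `Spec k`, seen as a locally ringed space over `k`. -/
def SpaceOver.ofScheme {k : Type u} [Field k] {Y : Scheme.{u}} (f : Y ⟶ Spec (.of k)) :
    SpaceOver.{u} k :=
  ⟨Y.toLocallyRingedSpace, ((Scheme.ΓSpecIso (.of k)).inv ≫ f.appTop).hom⟩

/-- `X` is a complete (that is, proper) scheme of finite type over `k`. -/
def SpaceOver.IsCompleteScheme {k : Type u} [Field k] (X : SpaceOver.{u} k) : Prop :=
  ∃ (Y : Scheme.{u}) (f : Y ⟶ Spec (.of k)), IsProper f ∧ X = SpaceOver.ofScheme f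

/-! ### Complex spaces -/

/-- The algebra of holomorphic functions on an open subset of `ℂⁿ`. -/
def Holo {n : ℕ} (V : Opens (Fin n → ℂ)) : Subalgebra ℂ (V → ℂ) where
  carrier := {g | ∃ G : (Fin n → ℂ) → ℂ, DifferentiableOn ℂ G V ∧ ∀ z : V, g z = G z}
  mul_mem' := by
    rintro a b ⟨G, hG, ha⟩ ⟨H, hH, hb⟩
    exact ⟨fun z => G z * H z, hG.mul hH, fun z => by simp [ha, hb]⟩
  add_mem' := by
    rintro a b ⟨G, hG, ha⟩ ⟨H, hH, hb⟩
    exact ⟨fun z => G z + H z, hG.add hH, fun z => by simp [ha, hb]⟩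
  algebraMap_mem' c := ⟨fun _ => c, differentiableOn_const c, fun _ => rfl⟩

/-- Restriction of holomorphic functions. -/
def Holo.res {n : ℕ} {V W : Opens (Fin n → ℂ)} (h : W ≤ V) (g : Holo V) : Holo W :=
  ⟨fun z => g.1 ⟨z.1, h z.2⟩, by
    obtain ⟨G, hG, hg⟩ := g.2
    exact ⟨G, hG.mono h, fun z => hg ⟨z.1, h z.2⟩⟩⟩

/-- An identification of the open subset `U` of `X` with a local model of complex spaces: the closed
subspace `(V(I), (𝒪_B / I)|_{V(I)})` of an open set `B` of `ℂⁿ` defined by an ideal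
`I = (f₁, …, f_m)` of holomorphic functions on `B`. The identification is given by the
map `emb` (a homeomorphism of `U` onto `V(I)`) and the pullback of holomorphic functions
`pull`, which induces `𝒪_{B,emb x} / I ≅ 𝒪_{X,x}` at every point `x` of `U`. -/
structure SpaceOver.LocalModel (X : SpaceOver.{u} ℂ) (U : Opens X.Pt) where
  n : ℕ
  m : ℕ
  B : Opens (Fin n → ℂ)
  f : Fin m → Holo B
  emb : X.Pt → (Fin n → ℂ)
  isEmbedding : Topology.IsEmbedding (fun x : U => emb x.1)
  image_eq : Set.range (fun x : U => emb x.1) = {z | ∃ hz : z ∈ B, ∀ j, (f j).1 ⟨z, hz⟩ = 0}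
  /-- The preimage of an open set under `emb : U → ℂⁿ`. -/
  pre : Opens (Fin n → ℂ) → Opens X.Pt
  mem_pre : ∀ V x, x ∈ pre V ↔ x ∈ U ∧ emb x ∈ V
  pull : ∀ V : Opens (Fin n → ℂ), Holo V →+* X.Sec (pre V)
  pull_const : ∀ (V : Opens (Fin n → ℂ)) (c : ℂ) (x : pre V),
    X.germFun x (pull V (algebraMap ℂ (Holo V) c)) = algebraMap ℂ (X.Stalk x.1) c
  pull_res : ∀ (V W : Opens (Fin n → ℂ)) (h : W ≤ V) (hp : pre W ≤ pre V) (g : Holo V),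
    pull W (Holo.res h g) = X.resFun hp (pull V g)
  pull_surj : ∀ x ∈ U, ∀ t : X.Stalk x, ∃ (V : Opens (Fin n → ℂ)) (_ : V ≤ B) (hx : x ∈ pre V)
    (g : Holo V), X.germFun ⟨x, hx⟩ (pull V g) = t
  pull_ker : ∀ (V : Opens (Fin n → ℂ)) (hV : V ≤ B) (x : pre V) (g : Holo V),
    X.germFun x (pull V g) = 0 ↔
      ∃ (W : Opens (Fin n → ℂ)) (hW : W ≤ V) (_ : emb x.1 ∈ W) (h : Fin m → Holo W),
        Holo.res hW g = ∑ j, h j * Holo.res (hW.trans hV) (f j)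

/-- `X` is a complex space (and `k` is the field `ℂ`): it is locally isomorphic, as a locally
ringed space over `ℂ`, to closed subspaces of open sets of `ℂⁿ`. Non-reduced complex spaces are
allowed and no separation axiom is imposed. -/
def SpaceOver.IsComplexSpace {k : Type v} [Field k] (X : SpaceOver.{u} k) : Prop :=
  ∃ e : ℂ ≃+* k, ∀ x : X.Pt, ∃ U : Opens X.Pt, x ∈ U ∧ Nonempty ((X.changeField e).LocalModel U)

/-! ### Sheaves of modules, presented through the germs of their sections -/

section Sheaves

variable {k : Type v} [Field k] (X : SpaceOver.{u} k)

/-- A sheaf of `𝒪_X`-modules whose sections over `U` are functions that send each point `x` of `U`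
to an element of an `𝒪_{X,x}`-module `fiber x` (typically the stalk at `x`). -/
structure GermSheaf where
  fiber : X.Pt → Type u
  [addCommGroup : ∀ x, AddCommGroup (fiber x)]
  [module : ∀ x, Module (X.Stalk x) (fiber x)]
  /-- The sections over `U`. -/
  sec : ∀ U : Opens X.Pt, AddSubgroup (∀ x : U, fiber x.1)
  smul_mem : ∀ (U : Opens X.Pt) (f : X.Sec U) (s : ∀ x : U, fiber x.1), s ∈ sec U →
    (fun x : U => X.germFun x f • s x) ∈ sec U
  res_mem : ∀ (U V : Opens X.Pt) (h : V ≤ U) (s : ∀ x : U, fiber x.1), s ∈ sec U →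
    (fun x : V => s ⟨x.1, h x.2⟩) ∈ sec V
  glue : ∀ (U : Opens X.Pt) (s : ∀ x : U, fiber x.1),
    (∀ x : U, ∃ (V : Opens X.Pt) (h : V ≤ U), x.1 ∈ V ∧
      (fun y : V => s ⟨y.1, h y.2⟩) ∈ sec V) → s ∈ sec U

attribute [instance] GermSheaf.addCommGroup GermSheaf.module

namespace GermSheaf

variable {X}

/-- The restriction map of a sheaf. -/
def res (F : GermSheaf X) {U V : Opens X.Pt} (h : V ≤ U) : F.sec U →+ F.sec V where
  toFun s := ⟨fun x => s.1 ⟨x.1, h x.2⟩, F.res_mem U V h s.1 s.2⟩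
  map_zero' := rfl
  map_add' _ _ := rfl

/-- The sheaf whose sections are locally finite sums of members of `P`. -/
def generate (fiber : X.Pt → Type u) [∀ x, AddCommGroup (fiber x)]
    [∀ x, Module (X.Stalk x) (fiber x)] (P : ∀ U : Opens X.Pt, Set (∀ x : U, fiber x.1))
    (hsmul : ∀ (U : Opens X.Pt) (f : X.Sec U) (s : ∀ x : U, fiber x.1), s ∈ P U →
      (fun x : U => X.germFun x f • s x) ∈ P U)
    (hres : ∀ (U V : Opens X.Pt) (h : V ≤ U) (s : ∀ x : U, fiber x.1), s ∈ P U →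
      (fun x : V => s ⟨x.1, h x.2⟩) ∈ P V) : GermSheaf X :=
  have cres : ∀ (U V : Opens X.Pt) (h : V ≤ U) (s : ∀ x : U, fiber x.1),
      s ∈ AddSubgroup.closure (P U) →
      (fun x : V => s ⟨x.1, h x.2⟩) ∈ AddSubgroup.closure (P V) := by
    intro U V h s hs
    induction hs using AddSubgroup.closure_induction with
    | mem s hs => exact AddSubgroup.subset_closure (hres U V h s hs)
    | zero => exact zero_mem _
    | add s t _ _ hs ht => exact add_mem hs ht
    | neg s _ hs => exact neg_mem hs
  have csmul : ∀ (U : Opens X.Pt) (f : X.Sec U) (s : ∀ x : U, fiber x.1),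
      s ∈ AddSubgroup.closure (P U) →
      (fun x : U => X.germFun x f • s x) ∈ AddSubgroup.closure (P U) := by
    intro U f s hs
    induction hs using AddSubgroup.closure_induction with
    | mem s hs => exact AddSubgroup.subset_closure (hsmul U f s hs)
    | zero => convert zero_mem (AddSubgroup.closure (P U)) using 1; ext x; simp
    | add s t _ _ hs ht => convert add_mem hs ht using 1; ext x; simp
    | neg s _ hs => convert neg_mem hs using 1; ext x; simp
  { fiber := fiber
    sec := fun U =>
      { carrier := {s | ∀ x : U, ∃ (V : Opens X.Pt) (h : V ≤ U), x.1 ∈ V ∧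
          (fun y : V => s ⟨y.1, h y.2⟩) ∈ AddSubgroup.closure (P V)}
        zero_mem' := fun x => ⟨U, le_rfl, x.2, zero_mem _⟩
        add_mem' := by
          intro s t hs ht x
          obtain ⟨V, hV, hxV, hs⟩ := hs x
          obtain ⟨W, hW, hxW, ht⟩ := ht x
          exact ⟨V ⊓ W, inf_le_left.trans hV, ⟨hxV, hxW⟩,
            add_mem (cres V (V ⊓ W) inf_le_left _ hs) (cres W (V ⊓ W) inf_le_right _ ht)⟩
        neg_mem' := by
          intro s hs x
          obtain ⟨V, hV, hxV, hs⟩ := hs x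
          exact ⟨V, hV, hxV, neg_mem hs⟩ }
    smul_mem := by
      intro U f s hs x
      obtain ⟨V, hV, hxV, hs⟩ := hs x
      refine ⟨V, hV, hxV, ?_⟩
      have := csmul V (X.resFun hV f) _ hs
      simpa only [X.germFun_resFun] using this
    res_mem := by
      intro U V h s hs x
      obtain ⟨W, hW, hxW, hs⟩ := hs ⟨x.1, h x.2⟩
      exact ⟨V ⊓ W, inf_le_left, ⟨x.2, hxW⟩, cres W (V ⊓ W) inf_le_right _ hs⟩
    glue := by
      intro U s hs x
      obtain ⟨V, hV, hxV, hs⟩ := hs x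
      obtain ⟨W, hW, hxW, hs⟩ := hs ⟨x.1, hxV⟩
      exact ⟨W, hW.trans hV, hxW, hs⟩ }

/-- The sheaf `ℋom(F, G)`: its sections over `U` are the families of `𝒪_{X,x}`-linear maps
`F_x → G_x`, for `x` in `U`, that send sections of `F` to sections of `G`. -/
def hom (F G : GermSheaf X) : GermSheaf X where
  fiber x := F.fiber x →ₗ[X.Stalk x] G.fiber x
  sec U :=
    { carrier := {φ | ∀ (V : Opens X.Pt) (h : V ≤ U) (s : ∀ x : V, F.fiber x.1), s ∈ F.sec V →
        (fun x : V => φ ⟨x.1, h x.2⟩ (s x)) ∈ G.sec V}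
      zero_mem' := fun V _ _ _ => zero_mem (G.sec V)
      add_mem' := fun hφ hψ V h s hs => add_mem (hφ V h s hs) (hψ V h s hs)
      neg_mem' := fun hφ V h s hs => neg_mem (hφ V h s hs) }
  smul_mem U f φ hφ V h s hs := by
    have := G.smul_mem V (X.resFun h f) _ (hφ V h s hs)
    simpa only [X.germFun_resFun, LinearMap.smul_apply] using this
  res_mem U V h φ hφ W hW s hs := hφ W (hW.trans h) s hs
  glue U φ hφ V hV s hs := by
    refine G.glue V _ fun x => ?_
    obtain ⟨W, hW, hxW, hφ⟩ := hφ ⟨x.1, hV x.2⟩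
    exact ⟨V ⊓ W, inf_le_left, ⟨x.2, hxW⟩,
      hφ (V ⊓ W) inf_le_right _ (F.res_mem V (V ⊓ W) inf_le_left s hs)⟩

/-- The sheaf `F ⊗ G`: its sections are locally finite sums of tensors of sections. -/
def tensor (F G : GermSheaf X) : GermSheaf X :=
  generate (fun x => F.fiber x ⊗[X.Stalk x] G.fiber x)
    (fun U => {t | ∃ s ∈ F.sec U, ∃ r ∈ G.sec U, t = fun x => s x ⊗ₜ r x})
    (by
      rintro U f _ ⟨s, hs, r, hr, rfl⟩
      exact ⟨_, F.smul_mem U f s hs, r, hr, rfl⟩)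
    (by
      rintro U V h _ ⟨s, hs, r, hr, rfl⟩
      exact ⟨_, F.res_mem U V h s hs, _, G.res_mem U V h r hr, rfl⟩)

end GermSheaf

/-- The category of sheaves of `𝒪_X`-modules. -/
abbrev OModule := SheafOfModules.{u}
  ((sheafCompose (Opens.grothendieckTopology X.Pt) (forget₂ CommRingCat RingCat.{u})).obj
    X.space.sheaf)

namespace OModule

variable {X}

/-- The underlying presheaf of modules. -/
abbrev pre (M : OModule X) : PresheafOfModules.{u} (X.space.presheaf ⋙ forget₂ CommRingCat RingCat) :=
  M.val

/-- The underlying sheaf of abelian groups. -/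
abbrev ab (M : OModule X) : TopCat.Presheaf Ab.{u} X.Pt := M.val.presheaf

/-- The module of sections of `M` over `U`. -/
abbrev Sec (M : OModule X) (U : Opens X.Pt) : Type u := M.ab.obj (op U)

instance (M : OModule X) (U : Opens X.Pt) : Module (X.Sec U) (M.Sec U) :=
  (M.val.obj (op U)).isModule

/-- The stalk of `M` at `x`. -/
abbrev Stalk (M : OModule X) (x : X.Pt) : Type u := M.ab.stalk x

instance (M : OModule X) (x : X.Pt) : Module (X.Stalk x) (M.Stalk x) :=
  inferInstanceAs (Module (X.space.presheaf.stalk x)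
    (TopCat.Presheaf.stalk (X := X.Pt) (C := Ab.{u}) M.pre.presheaf x))

/-- Restriction of sections. -/
def res (M : OModule X) {U V : Opens X.Pt} (h : V ≤ U) : M.Sec U →+ M.Sec V :=
  (M.ab.map (homOfLE h).op).hom

/-- The germ of a section at a point. -/
def germ (M : OModule X) {U : Opens X.Pt} (x : U) : M.Sec U →+ M.Stalk x.1 :=
  (M.ab.germ U x.1 x.2).hom

lemma germ_res (M : OModule X) {U V : Opens X.Pt} (h : V ≤ U) (s : M.Sec U) (x : V) :
    M.germ x (M.res h s) = M.germ (⟨x.1, h x.2⟩ : U) s :=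
  TopCat.Presheaf.germ_res_apply M.ab (homOfLE h) x.1 x.2 s

lemma germ_smul (M : OModule X) {U : Opens X.Pt} (x : U) (f : X.Sec U) (s : M.Sec U) :
    M.germ x (f • s) = X.germFun x f • M.germ x s :=
  PresheafOfModules.germ_smul (R := X.space.presheaf) M.pre x.1 U x.2 f s

lemma exists_germ (M : OModule X) {x : X.Pt} (t : M.Stalk x) :
    ∃ (U : Opens X.Pt) (hx : x ∈ U) (s : M.Sec U), M.germ (⟨x, hx⟩ : U) s = t :=
  TopCat.Presheaf.exists_germ_eq M.ab t

/-- The action of a morphism of sheaves of modules on sections. -/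
def app {M N : OModule X} (ψ : M ⟶ N) (U : Opens X.Pt) : M.Sec U →ₗ[X.Sec U] N.Sec U where
  toFun := (ψ.val.app (op U)).hom
  map_add' := (ψ.val.app (op U)).hom.map_add
  map_smul' := (ψ.val.app (op U)).hom.map_smul

/-- The action of a morphism of sheaves of modules on stalks, as an additive map. -/
def stalkAddHom {M N : OModule X} (ψ : M ⟶ N) (x : X.Pt) : M.Stalk x →+ N.Stalk x :=
  ((TopCat.Presheaf.stalkFunctor Ab.{u} x).map
    ((PresheafOfModules.toPresheaf _).map ψ.val : M.ab ⟶ N.ab)).hom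

lemma stalkAddHom_germ {M N : OModule X} (ψ : M ⟶ N) {U : Opens X.Pt} (x : U) (s : M.Sec U) :
    stalkAddHom ψ x.1 (M.germ x s) = N.germ x (app ψ U s) :=
  TopCat.Presheaf.stalkFunctor_map_germ_apply U x.1 x.2
    ((PresheafOfModules.toPresheaf _).map ψ.val : M.ab ⟶ N.ab) s

/-- The action of a morphism of sheaves of modules on stalks. -/
def stalkMap {M N : OModule X} (ψ : M ⟶ N) (x : X.Pt) : M.Stalk x →ₗ[X.Stalk x] N.Stalk x where
  toFun := stalkAddHom ψ x
  map_add' := map_add _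
  map_smul' := by
    intro f s
    obtain ⟨U, hU, f, rfl⟩ := TopCat.Presheaf.exists_germ_eq X.space.presheaf f
    obtain ⟨V, hV, s, rfl⟩ := M.exists_germ s
    have h1 : X.germFun (⟨x, ⟨hU, hV⟩⟩ : (U ⊓ V : Opens X.Pt)) (X.resFun inf_le_left f)
        = X.space.presheaf.germ U x hU f := X.germFun_resFun inf_le_left f _
    rw [← h1, ← M.germ_res (inf_le_right : U ⊓ V ≤ V) s ⟨x, ⟨hU, hV⟩⟩, ← germ_smul,
      stalkAddHom_germ ψ (⟨x, ⟨hU, hV⟩⟩ : (U ⊓ V : Opens X.Pt)), map_smul, germ_smul,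
      ← stalkAddHom_germ]
    rfl

lemma stalkMap_germ {M N : OModule X} (ψ : M ⟶ N) {U : Opens X.Pt} (x : U) (s : M.Sec U) :
    stalkMap ψ x.1 (M.germ x s) = N.germ x (app ψ U s) :=
  stalkAddHom_germ ψ x s

lemma stalkMap_id (M : OModule X) (x : X.Pt) : stalkMap (𝟙 M) x = LinearMap.id := by
  ext s
  obtain ⟨U, hU, s, rfl⟩ := M.exists_germ s
  exact stalkMap_germ (𝟙 M) (⟨x, hU⟩ : U) s

lemma stalkMap_comp {M N P : OModule X} (φ : M ⟶ N) (ψ : N ⟶ P) (x : X.Pt) :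
    stalkMap (φ ≫ ψ) x = stalkMap ψ x ∘ₗ stalkMap φ x := by
  ext s
  obtain ⟨U, hU, s, rfl⟩ := M.exists_germ s
  have h1 := stalkMap_germ (φ ≫ ψ) (⟨x, hU⟩ : U) s
  have h2 := stalkMap_germ φ (⟨x, hU⟩ : U) s
  have h3 := stalkMap_germ ψ (⟨x, hU⟩ : U) (app φ U s)
  simp only [LinearMap.comp_apply]
  rw [h2, h3]
  exact h1

/-- A sheaf of modules, seen through the germs of its sections. -/
def germSheaf (M : OModule X) : GermSheaf X :=
  .generate (fun x => M.Stalk x) (fun U => {t | ∃ s : M.Sec U, t = fun x => M.germ x s})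
    (by
      rintro U f _ ⟨s, rfl⟩
      exact ⟨f • s, funext fun x => (M.germ_smul x f s).symm⟩)
    (by
      rintro U V h _ ⟨s, rfl⟩
      exact ⟨M.res h s, funext fun x => (M.germ_res h s x).symm⟩)

/-- `M` is free of finite rank over the open set `U`. -/
def IsFreeOn (M : OModule X) (U : Opens X.Pt) : Prop :=
  ∃ (n : ℕ) (e : Fin n → M.Sec U), ∀ (V : Opens X.Pt) (h : V ≤ U) (s : M.Sec V),
    ∃! c : Fin n → X.Sec V, s = ∑ i, c i • M.res h (e i)

/-- `M` is a vector bundle: a locally free sheaf of finite rank. -/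
def IsVectorBundle (M : OModule X) : Prop :=
  ∀ x : X.Pt, ∃ U : Opens X.Pt, x ∈ U ∧ M.IsFreeOn U

end OModule

/-! ### Differential forms and poles -/

/-- The stalk at `x` of the sheaf `Ω¹_X` of differentials relative to `k`: the module of Kähler
differentials of the local ring `𝒪_{X,x}`, made separated for the adic topology of the maximal ideal
`𝔪_x`. On a complex space this is the stalk of the usual sheaf of holomorphic differentials
(the universal finite differential module of the analytic algebra `𝒪_{X,x}`); on a
scheme locally of finite type the submodule that is divided out is zero, see
`iInf_pow_smul_kaehler_eq_bot`. -/
abbrev OmegaStalk (x : X.Pt) : Type u :=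
  Ω[X.Stalk x⁄k] ⧸ (⨅ n : ℕ, IsLocalRing.maximalIdeal (X.Stalk x) ^ n •
    (⊤ : Submodule (X.Stalk x) Ω[X.Stalk x⁄k]))

lemma iInf_pow_smul_kaehler_eq_bot (A : Type u) [CommRing A] [IsLocalRing A] [IsNoetherianRing A]
    [Algebra k A] [Algebra.EssFiniteType k A] :
    (⨅ n : ℕ, IsLocalRing.maximalIdeal A ^ n • (⊤ : Submodule A Ω[A⁄k])) = ⊥ :=
  Ideal.iInf_pow_smul_eq_bot_of_isLocalRing _ (IsLocalRing.maximalIdeal.isMaximal A).ne_top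

/-- The germ at `x` of the differential `df`. -/
def dGerm (x : X.Pt) (f : X.Stalk x) : OmegaStalk X x :=
  Submodule.Quotient.mk (KaehlerDifferential.D k (X.Stalk x) f)

/-- The sheaf `Ω¹_X`: its sections are locally finite sums of forms `f dg`. -/
def Omega : GermSheaf X :=
  .generate (fun x => OmegaStalk X x)
    (fun U => {t | ∃ f g : X.Sec U, t = fun x => X.germFun x f • dGerm X x.1 (X.germFun x g)})
    (by
      rintro U f _ ⟨g, h, rfl⟩
      exact ⟨f * g, h, funext fun x => by rw [map_mul, mul_smul]⟩)
    (by
      rintro U V h _ ⟨f, g, rfl⟩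
      exact ⟨X.resFun h f, X.resFun h g, funext fun x => by simp only [X.germFun_resFun]⟩)

/-- An effective Cartier divisor, given by the stalks of its ideal sheaf `𝒪_X(-D)`: locally the ideal
is generated by one function that is nowhere a zero divisor. -/
structure CartierDivisor where
  ideal : ∀ x : X.Pt, Ideal (X.Stalk x)
  local_equation : ∀ x : X.Pt, ∃ (U : Opens X.Pt) (_ : x ∈ U) (f : X.Sec U), ∀ y : U,
    X.germFun y f ∈ nonZeroDivisors (X.Stalk y.1) ∧ ideal y.1 = Ideal.span {X.germFun y f}

variable {X}

/-- The ideal sheaf `𝒪_X(-D)`. -/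
def CartierDivisor.idealSheaf (D : CartierDivisor X) : GermSheaf X :=
  .generate (fun x => D.ideal x)
    (fun U => {t | ∃ f : X.Sec U, ∀ x, (t x : X.Stalk x.1) = X.germFun x f})
    (by
      rintro U f s ⟨g, hg⟩
      exact ⟨f * g, fun x => by rw [map_mul, ← hg x]; rfl⟩)
    (by
      rintro U V h s ⟨g, hg⟩
      exact ⟨X.resFun h g, fun x => by rw [X.germFun_resFun, ← hg ⟨x.1, h x.2⟩]⟩)

/-- The sheaf `Ω¹_X(D) = Ω¹_X ⊗ 𝒪_X(D)` of differentials with poles bounded by `D`, in the form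
`ℋom(𝒪_X(-D), Ω¹_X)`. -/
def OmegaPoles (D : CartierDivisor X) : GermSheaf X :=
  D.idealSheaf.hom (Omega X)

/-- The canonical map `Ω¹_X → Ω¹_X(D)` on stalks; `ω` is sent to `f ↦ f ω`. -/
def toPoles (D : CartierDivisor X) (x : X.Pt) (ω : OmegaStalk X x) : (OmegaPoles D).fiber x :=
  ((LinearMap.toSpanSingleton (X.Stalk x) (OmegaStalk X x) ω).comp (D.ideal x).subtype :
    D.ideal x →ₗ[X.Stalk x] OmegaStalk X x)

/-- The sheaf `M ⊗ Ω¹_X(D)`. -/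
def OModule.formsIn (M : OModule X) (D : CartierDivisor X) : GermSheaf X :=
  M.germSheaf.tensor (OmegaPoles D)

/-- The germ `s ⊗ ω` of `M ⊗ Ω¹_X(D)`. -/
def OModule.tmulForm (M : OModule X) (D : CartierDivisor X) (x : X.Pt) (s : M.Stalk x)
    (ω : (OmegaPoles D).fiber x) : (M.formsIn D).fiber x :=
  TensorProduct.tmul (X.Stalk x) s ω

/-- The map `φ ⊗ 1 : M_x ⊗ Ω¹(D)_x → N_x ⊗ Ω¹(D)_x`. -/
def formsMap (D : CartierDivisor X) {M N : OModule X} {x : X.Pt}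
    (φ : M.Stalk x →ₗ[X.Stalk x] N.Stalk x) :
    (M.formsIn D).fiber x →ₗ[X.Stalk x] (N.formsIn D).fiber x :=
  LinearMap.rTensor ((OmegaPoles D).fiber x) φ

/-- A meromorphic connection `∇ : M → M ⊗ Ω¹(D)` with divisor of poles `D`: a `k`-linear morphism
of sheaves, given by its action on germs, that satisfies the Leibniz rule. -/
structure MeromorphicConnection (D : CartierDivisor X) (M : OModule X) where
  nabla : ∀ x : X.Pt, M.Stalk x →+ (M.formsIn D).fiber x
  map_sec : ∀ (U : Opens X.Pt) (s : ∀ x : U, M.Stalk x.1), s ∈ M.germSheaf.sec U →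
    (fun x : U => nabla x.1 (s x)) ∈ (M.formsIn D).sec U
  map_scalar : ∀ (x : X.Pt) (c : k) (s : M.Stalk x),
    nabla x (algebraMap k (X.Stalk x) c • s) = algebraMap k (X.Stalk x) c • nabla x s
  leibniz : ∀ (x : X.Pt) (f : X.Stalk x) (s : M.Stalk x),
    nabla x (f • s) = f • nabla x s + M.tmulForm D x s (toPoles D x (dGerm X x f))

/-! ### First-order deformations -/

/-- A first-order deformation of `(E, ∇)` with fixed divisor of poles `D`: a vector bundle with
connection on `X × Spec k[ε]`, relative to `Spec k[ε]`, with poles in `D × Spec k[ε]`, together with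
an identification of its restriction to `X` with `(E, ∇)`.

The space `X × Spec k[ε]` is the topological space `X` with the structure sheaf `𝒪_X[ε]`, and an
`𝒪_X[ε]`-module is an `𝒪_X`-module with an endomorphism `ε` of square zero. The relative
differentials are `𝒪_X[ε] ⊗ Ω¹_X`, so that the connection is a `k[ε]`-linear map
with values in `bundle ⊗ Ω¹_X(D)`, where the tensor product is taken over `𝒪_X`. -/
structure FirstOrderDeformation {D : CartierDivisor X} {E : OModule X}
    (nab : MeromorphicConnection D E) where
  bundle : OModule X
  eps : bundle ⟶ bundle
  eps_sq : eps ≫ eps = 0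
  /-- `bundle` is locally free of finite rank over `𝒪_X[ε]`. -/
  locallyFree : ∀ x : X.Pt, ∃ (U : Opens X.Pt) (_ : x ∈ U) (n : ℕ) (e : Fin n → bundle.Sec U),
    ∀ (V : Opens X.Pt) (h : V ≤ U) (s : bundle.Sec V),
      ∃! c : (Fin n → X.Sec V) × (Fin n → X.Sec V),
        s = ∑ i, (c.1 i • bundle.res h (e i) +
          c.2 i • OModule.app eps V (bundle.res h (e i)))
  conn : MeromorphicConnection D bundle
  conn_eps : ∀ (x : X.Pt) (s : bundle.Stalk x),
    conn.nabla x (OModule.stalkMap eps x s) =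
      formsMap D (OModule.stalkMap eps x) (conn.nabla x s)
  /-- The projection to `E`, which identifies `bundle / ε bundle` with `E`. -/
  proj : bundle ⟶ E
  proj_surjective : ∀ x : X.Pt, Function.Surjective (OModule.stalkMap proj x)
  proj_ker : ∀ x : X.Pt,
    LinearMap.ker (OModule.stalkMap proj x) = LinearMap.range (OModule.stalkMap eps x)
  proj_conn : ∀ (x : X.Pt) (s : bundle.Stalk x),
    nab.nabla x (OModule.stalkMap proj x s) =
      formsMap D (OModule.stalkMap proj x) (conn.nabla x s)

namespace FirstOrderDeformation

variable {D : CartierDivisor X} {E : OModule X} {nab : MeromorphicConnection D E}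

/-- Isomorphisms of first-order deformations: `𝒪_X[ε]`-linear isomorphisms of the bundles that are
horizontal for the connections and induce the identity on `(E, ∇)`. -/
structure Iso (F G : FirstOrderDeformation nab) where
  iso : F.bundle ≅ G.bundle
  eps_comm : F.eps ≫ iso.hom = iso.hom ≫ G.eps
  proj_comm : iso.hom ≫ G.proj = F.proj
  horizontal : ∀ (x : X.Pt) (s : F.bundle.Stalk x),
    G.conn.nabla x (OModule.stalkMap iso.hom x s) =
      formsMap D (OModule.stalkMap iso.hom x) (F.conn.nabla x s)

lemma formsMap_id (M : OModule X) (x : X.Pt) (t : (M.formsIn D).fiber x) :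
    formsMap D (LinearMap.id : M.Stalk x →ₗ[X.Stalk x] M.Stalk x) t = t :=
  LinearMap.congr_fun (LinearMap.rTensor_id _ _) t

lemma formsMap_comp {M N P : OModule X} (x : X.Pt) (φ : M.Stalk x →ₗ[X.Stalk x] N.Stalk x)
    (ψ : N.Stalk x →ₗ[X.Stalk x] P.Stalk x) (t : (M.formsIn D).fiber x) :
    formsMap D (ψ ∘ₗ φ) t = formsMap D ψ (formsMap D φ t) :=
  LinearMap.congr_fun (LinearMap.rTensor_comp _ _ _) t

/-- Being isomorphic, as an equivalence relation on first-order deformations. -/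
instance isoSetoid (nab : MeromorphicConnection D E) : Setoid (FirstOrderDeformation nab) where
  r F G := Nonempty (Iso F G)
  iseqv :=
    { refl := fun F => ⟨⟨CategoryTheory.Iso.refl _, by simp, by simp, fun x s => by
        simp [OModule.stalkMap_id, formsMap_id]⟩⟩
      symm := by
        rintro F G ⟨φ⟩
        refine ⟨⟨φ.iso.symm, ?_, ?_, fun x s => ?_⟩⟩
        · rw [Iso.symm_hom, Iso.comp_inv_eq, Category.assoc, φ.eps_comm, Iso.inv_hom_id_assoc]
        · rw [Iso.symm_hom, Iso.inv_comp_eq, φ.proj_comm]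
        · have h1 : ∀ t, OModule.stalkMap φ.iso.hom x (OModule.stalkMap φ.iso.inv x t) = t := by
            intro t
            rw [← LinearMap.comp_apply, ← OModule.stalkMap_comp, Iso.inv_hom_id,
              OModule.stalkMap_id, LinearMap.id_apply]
          have h2 := φ.horizontal x (OModule.stalkMap φ.iso.inv x s)
          rw [h1] at h2
          rw [Iso.symm_hom, h2, ← formsMap_comp, ← OModule.stalkMap_comp, Iso.hom_inv_id,
            OModule.stalkMap_id, formsMap_id]
      trans := by
        rintro F G H ⟨φ⟩ ⟨ψ⟩
        refine ⟨⟨φ.iso ≪≫ ψ.iso, ?_, ?_, fun x s => ?_⟩⟩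
        · rw [Iso.trans_hom, ← Category.assoc, φ.eps_comm, Category.assoc, ψ.eps_comm,
            Category.assoc]
        · rw [Iso.trans_hom, Category.assoc, ψ.proj_comm, φ.proj_comm]
        · rw [Iso.trans_hom, OModule.stalkMap_comp, LinearMap.comp_apply, ψ.horizontal,
            φ.horizontal, formsMap_comp] }

end FirstOrderDeformation

/-! ### Čech hypercohomology of a two-term complex -/

variable (X) in
/-- A two-term complex `K⁰ → K¹` of sheaves of abelian groups. -/
structure TwoTermComplex where
  K0 : GermSheaf X
  K1 : GermSheaf X
  d : ∀ x : X.Pt, K0.fiber x →+ K1.fiber x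
  map_sec : ∀ (U : Opens X.Pt) (s : ∀ x : U, K0.fiber x.1), s ∈ K0.sec U →
    (fun x : U => d x.1 (s x)) ∈ K1.sec U

namespace TwoTermComplex

variable (K : TwoTermComplex X)

/-- The differential on sections. -/
def dSec (U : Opens X.Pt) : K.K0.sec U →+ K.K1.sec U where
  toFun s := ⟨fun x => K.d x.1 (s.1 x), K.map_sec U s.1 s.2⟩
  map_zero' := Subtype.ext (funext fun x => map_zero (K.d x.1))
  map_add' s t := Subtype.ext (funext fun x => map_add (K.d x.1) (s.1 x) (t.1 x))

variable {ι : Type u} (𝔘 : ι → Opens X.Pt)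

/-- Cochains of total degree `0`: `L⁰ = C⁰(𝔘, K⁰)`. -/
abbrev L0 : Type u := ∀ i, K.K0.sec (𝔘 i)

/-- Cochains of total degree `1`: `L¹ = C¹(𝔘, K⁰) ⊕ C⁰(𝔘, K¹)`. -/
abbrev L1 : Type u := (∀ i j, K.K0.sec (𝔘 i ⊓ 𝔘 j)) × (∀ i, K.K1.sec (𝔘 i))

/-- Cochains of total degree `2`: `L² = C²(𝔘, K⁰) ⊕ C¹(𝔘, K¹)`. -/
abbrev L2 : Type u :=
  (∀ i j l, K.K0.sec (𝔘 i ⊓ 𝔘 j ⊓ 𝔘 l)) × (∀ i j, K.K1.sec (𝔘 i ⊓ 𝔘 j))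

/-- The total differential `h ↦ (ďh, d h)`. -/
def D0 : K.L0 𝔘 →+ K.L1 𝔘 where
  toFun h := (fun i j => K.K0.res inf_le_right (h j) - K.K0.res inf_le_left (h i),
    fun i => K.dSec _ (h i))
  map_zero' := by ext <;> simp
  map_add' a b := by
    refine Prod.ext (funext fun i => funext fun j => ?_) (funext fun i => ?_)
    · simp only [Pi.add_apply, Prod.fst_add, map_add]; abel
    · simp only [Pi.add_apply, Prod.snd_add, map_add]

/-- The total differential `(a, A) ↦ (ďa, ďA - d a)`. -/
def D1 : K.L1 𝔘 →+ K.L2 𝔘 where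
  toFun z :=
    (fun i j l =>
      K.K0.res (le_inf (inf_le_left.trans inf_le_right) inf_le_right) (z.1 j l)
        - K.K0.res (le_inf (inf_le_left.trans inf_le_left) inf_le_right) (z.1 i l)
        + K.K0.res inf_le_left (z.1 i j),
    fun i j => K.K1.res inf_le_right (z.2 j) - K.K1.res inf_le_left (z.2 i) - K.dSec _ (z.1 i j))
  map_zero' := by
    refine Prod.ext (funext fun i => funext fun j => funext fun l => ?_)
      (funext fun i => funext fun j => ?_) <;> simp
  map_add' a b := by
    refine Prod.ext (funext fun i => funext fun j => funext fun l => ?_)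
      (funext fun i => funext fun j => ?_)
    · simp only [Pi.add_apply, Prod.fst_add, map_add]; abel
    · simp only [Pi.add_apply, Prod.fst_add, Prod.snd_add, map_add]; abel

/-- The group of `1`-cocycles. -/
abbrev Z1 : AddSubgroup (K.L1 𝔘) := (K.D1 𝔘).ker

/-- The group of `1`-coboundaries, inside the group of `1`-cocycles. -/
abbrev B1 : AddSubgroup (K.Z1 𝔘) := (K.D0 𝔘).range.addSubgroupOf (K.Z1 𝔘)

/-- The Čech hypercohomology group `ℍ¹(𝔘, K) = Z¹ / B¹`. -/
abbrev cechH1 : Type u := K.Z1 𝔘 ⧸ K.B1 𝔘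

lemma D1_D0 (h : K.L0 𝔘) : K.D1 𝔘 (K.D0 𝔘 h) = 0 := by
  refine Prod.ext (funext fun i => funext fun j => funext fun l => ?_)
    (funext fun i => funext fun j => ?_)
  · refine Subtype.ext (funext fun x => ?_)
    change ((h l).1 ⟨x.1, x.2.2⟩ - (h j).1 ⟨x.1, x.2.1.2⟩)
      - ((h l).1 ⟨x.1, x.2.2⟩ - (h i).1 ⟨x.1, x.2.1.1⟩)
      + ((h j).1 ⟨x.1, x.2.1.2⟩ - (h i).1 ⟨x.1, x.2.1.1⟩) = 0
    abel
  · refine Subtype.ext (funext fun x => ?_)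
    change K.d x.1 ((h j).1 ⟨x.1, x.2.2⟩) - K.d x.1 ((h i).1 ⟨x.1, x.2.1⟩)
      - K.d x.1 ((h j).1 ⟨x.1, x.2.2⟩ - (h i).1 ⟨x.1, x.2.1⟩) = 0
    rw [map_sub, sub_self]

section Refinement

variable {κ : Type u} {𝔘} {𝔙 : κ → Opens X.Pt} (τ : κ → ι) (hτ : ∀ i, 𝔙 i ≤ 𝔘 (τ i))

/-- Restriction of `1`-cochains to a refinement. -/
def refineL1 : K.L1 𝔘 →+ K.L1 𝔙 where
  toFun z := (fun i j => K.K0.res (inf_le_inf (hτ i) (hτ j)) (z.1 (τ i) (τ j)),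
    fun i => K.K1.res (hτ i) (z.2 (τ i)))
  map_zero' := by
    refine Prod.ext (funext fun i => funext fun j => ?_) (funext fun i => ?_) <;> simp
  map_add' _ _ := by
    refine Prod.ext (funext fun i => funext fun j => ?_) (funext fun i => ?_) <;> simp

lemma refineL1_mem (z : K.Z1 𝔘) : K.refineL1 τ hτ z.1 ∈ K.Z1 𝔙 := by
  have hz : K.D1 𝔘 z.1 = 0 := z.2
  refine (AddMonoidHom.mem_ker).2 (Prod.ext (funext fun i => funext fun j => funext fun l => ?_)
    (funext fun i => funext fun j => ?_))
  · have h := congrFun (congrFun (congrFun (congrArg Prod.fst hz) (τ i)) (τ j)) (τ l)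
    refine Subtype.ext (funext fun x => ?_)
    exact congrFun (congrArg Subtype.val h) ⟨x.1, ⟨hτ i x.2.1.1, hτ j x.2.1.2⟩, hτ l x.2.2⟩
  · have h := congrFun (congrFun (congrArg Prod.snd hz) (τ i)) (τ j)
    refine Subtype.ext (funext fun x => ?_)
    exact congrFun (congrArg Subtype.val h) ⟨x.1, hτ i x.2.1, hτ j x.2.2⟩

/-- Restriction of `1`-cocycles to a refinement. -/
def refineZ1 : K.Z1 𝔘 →+ K.Z1 𝔙 where
  toFun z := ⟨K.refineL1 τ hτ z.1, K.refineL1_mem τ hτ z⟩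
  map_zero' := Subtype.ext (map_zero _)
  map_add' _ _ := Subtype.ext (map_add _ _ _)

/-- The map `ℍ¹(𝔘, K) → ℍ¹(𝔙, K)` for a refinement `𝔙` of `𝔘`. -/
def refine : K.cechH1 𝔘 →+ K.cechH1 𝔙 :=
  QuotientAddGroup.map (K.B1 𝔘) (K.B1 𝔙) (K.refineZ1 τ hτ) (by
    rintro z ⟨h, hh⟩
    refine ⟨fun i => K.K0.res (hτ i) (h (τ i)), ?_⟩
    change _ = K.refineL1 τ hτ z.1
    have hh' : K.D0 𝔘 h = z.1 := hh
    rw [← hh']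
    rfl)

end Refinement

end TwoTermComplex

variable (X) in
/-- An open covering of `X` indexed by the points: a neighbourhood `nhd x` of every point `x`. -/
structure PointedCover where
  nhd : X.Pt → Opens X.Pt
  mem : ∀ x, x ∈ nhd x

/-- Pointed coverings are ordered by refinement; finer coverings are larger. -/
instance : Preorder (PointedCover X) where
  le 𝔘 𝔙 := ∀ x, 𝔙.nhd x ≤ 𝔘.nhd x
  le_refl _ _ := le_rfl
  le_trans _ _ _ h h' x := (h' x).trans (h x)

namespace TwoTermComplex

variable (K : TwoTermComplex X)

open scoped Classical in
/-- The hypercohomology group `ℍ¹(X, K)`: the colimit of the Čech groups `ℍ¹(𝔘, K)` over all open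
coverings, ordered by refinement. (Coverings indexed by the points of `X` are cofinal.) -/
abbrev H1 : Type u :=
  AddCommGroup.DirectLimit (fun 𝔘 : PointedCover X => K.cechH1 𝔘.nhd)
    (fun _ _ h => K.refine id h)

open scoped Classical in
/-- The canonical map `ℍ¹(𝔘, K) → ℍ¹(X, K)` for an open covering `𝔘`; here `τ x` is the index of a
member of `𝔘` that contains `x`. -/
def toH1 {ι : Type u} (𝔘 : ι → Opens X.Pt) (τ : X.Pt → ι) (hτ : ∀ x, x ∈ 𝔘 (τ x)) :
    K.cechH1 𝔘 →+ K.H1 :=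
  (AddCommGroup.DirectLimit.of (fun 𝔘 : PointedCover X => K.cechH1 𝔘.nhd)
    (fun _ _ h => K.refine id h) ⟨fun x => 𝔘 (τ x), hτ⟩).comp
    (K.refine (𝔙 := fun x => 𝔘 (τ x)) τ (fun _ => le_rfl))

end TwoTermComplex

/-! ### The complex of a meromorphic connection -/

section EndComplex

variable {D : CartierDivisor X} {E : OModule X} (nab : MeromorphicConnection D E)

/-- The sheaf `End E`. -/
def OModule.endSheaf (E : OModule X) : GermSheaf X := E.germSheaf.hom E.germSheaf

/-- The sheaf `End E ⊗ Ω¹_X(D)`, in the form `ℋom(E, E ⊗ Ω¹_X(D))`. -/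
def OModule.endForms (E : OModule X) (D : CartierDivisor X) : GermSheaf X :=
  E.germSheaf.hom (E.formsIn D)

/-- The tensor product with `Ω¹_X(D)` of a morphism of sheaves of modules maps sections to
sections. -/
lemma formsMap_sec (D : CartierDivisor X) {M N : OModule X} {U : Opens X.Pt}
    (φ : ∀ x : U, M.Stalk x.1 →ₗ[X.Stalk x.1] N.Stalk x.1)
    (hφ : φ ∈ (M.germSheaf.hom N.germSheaf).sec U)
    (t : ∀ x : U, (M.formsIn D).fiber x.1) (ht : t ∈ (M.formsIn D).sec U) :
    (fun x => formsMap D (φ x) (t x)) ∈ (N.formsIn D).sec U := by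
  intro x
  obtain ⟨V, hV, hxV, ht⟩ := ht x
  refine ⟨V, hV, hxV, ?_⟩
  have key : ∀ r : (∀ y : V, (M.formsIn D).fiber y.1), r ∈ AddSubgroup.closure
      {t | ∃ s ∈ M.germSheaf.sec V, ∃ ω ∈ (OmegaPoles D).sec V,
        t = fun x : V => M.tmulForm D x.1 (s x) (ω x)} →
      (fun y : V => formsMap D (φ ⟨y.1, hV y.2⟩) (r y)) ∈ AddSubgroup.closure
      {t | ∃ s ∈ N.germSheaf.sec V, ∃ ω ∈ (OmegaPoles D).sec V,
        t = fun x : V => N.tmulForm D x.1 (s x) (ω x)} := by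
    intro r hr
    induction hr using AddSubgroup.closure_induction with
    | mem r hr =>
      obtain ⟨s, hs, ω, hω, rfl⟩ := hr
      refine AddSubgroup.subset_closure ⟨_, hφ V hV s hs, ω, hω, ?_⟩
      funext y
      exact LinearMap.rTensor_tmul _ _ _ _
    | zero =>
      rw [show (fun y : V => formsMap D (φ ⟨y.1, hV y.2⟩)
        ((0 : ∀ y : V, (M.formsIn D).fiber y.1) y)) = 0 from funext fun y => map_zero _]
      exact zero_mem _
    | add r r' _ _ h h' => convert add_mem h h' using 1; ext y; simp
    | neg r _ h => convert neg_mem h using 1; ext y; simp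
  exact key _ ht

lemma formsMap_tmulForm (D : CartierDivisor X) {M N : OModule X} {x : X.Pt}
    (φ : M.Stalk x →ₗ[X.Stalk x] N.Stalk x) (s : M.Stalk x) (ω : (OmegaPoles D).fiber x) :
    formsMap D φ (M.tmulForm D x s ω) = N.tmulForm D x (φ s) ω :=
  LinearMap.rTensor_tmul _ _ _ _

lemma formsMap_zero (D : CartierDivisor X) (M N : OModule X) (x : X.Pt)
    (t : (M.formsIn D).fiber x) :
    formsMap D (0 : M.Stalk x →ₗ[X.Stalk x] N.Stalk x) t = 0 :=
  LinearMap.congr_fun (LinearMap.rTensor_zero _) t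

lemma formsMap_add (D : CartierDivisor X) {M N : OModule X} {x : X.Pt}
    (φ ψ : M.Stalk x →ₗ[X.Stalk x] N.Stalk x) (t : (M.formsIn D).fiber x) :
    formsMap D (φ + ψ) t = formsMap D φ t + formsMap D ψ t :=
  LinearMap.congr_fun (LinearMap.rTensor_add _ φ ψ) t

/-- The map `∇ ∘ φ - (φ ⊗ 1) ∘ ∇` for an endomorphism `φ` of the stalk of `E`. -/
def nablaEndMap (x : X.Pt) (φ : E.Stalk x →ₗ[X.Stalk x] E.Stalk x) :
    E.Stalk x →ₗ[X.Stalk x] (E.formsIn D).fiber x where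
  toFun s := nab.nabla x (φ s) - formsMap D φ (nab.nabla x s)
  map_add' s t := by simp only [map_add]; abel
  map_smul' f s := by
    simp only [map_smul, nab.leibniz, map_add, formsMap_tmulForm, RingHom.id_apply, smul_sub]
    abel

lemma nablaEndMap_zero (x : X.Pt) : nablaEndMap nab x 0 = 0 :=
  LinearMap.ext fun s => by
    change nab.nabla x 0 - formsMap D (0 : E.Stalk x →ₗ[X.Stalk x] E.Stalk x) _ = 0
    rw [map_zero, formsMap_zero, sub_zero]

lemma nablaEndMap_add (x : X.Pt) (φ ψ : E.Stalk x →ₗ[X.Stalk x] E.Stalk x) :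
    nablaEndMap nab x (φ + ψ) = nablaEndMap nab x φ + nablaEndMap nab x ψ :=
  LinearMap.ext fun s => by
    change nab.nabla x (φ s + ψ s) - formsMap D (φ + ψ) _ =
      (nab.nabla x (φ s) - formsMap D φ _) + (nab.nabla x (ψ s) - formsMap D ψ _)
    rw [map_add, formsMap_add, add_sub_add_comm]

/-- The induced connection `∇_End(φ) = ∇ ∘ φ - (φ ⊗ 1) ∘ ∇` on germs. -/
def nablaEnd (x : X.Pt) : E.endSheaf.fiber x →+ (E.endForms D).fiber x where
  toFun φ := nablaEndMap nab x φ
  map_zero' := nablaEndMap_zero nab x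
  map_add' φ ψ := nablaEndMap_add nab x φ ψ

/-- The complex `C = [End E → End E ⊗ Ω¹_X(D)]` with differential `∇_End`. -/
def endComplex : TwoTermComplex X where
  K0 := E.endSheaf
  K1 := E.endForms D
  d := nablaEnd nab
  map_sec U φ hφ V hV s hs := by
    have h1 := nab.map_sec V _ (hφ V hV s hs)
    have h2 := formsMap_sec D (fun x : V => φ ⟨x.1, hV x.2⟩)
      ((E.germSheaf.hom E.germSheaf).res_mem U V hV φ hφ) _ (nab.map_sec V s hs)
    exact sub_mem h1 h2

/-- The deformation `F` is given by the `1`-cocycle `z = (a, A)` of the complex `C` on the open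
covering `𝔘`: there are `𝒪_X`-linear splittings `σ i` of `F.bundle → E` over the open sets `𝔘 i`
(equivalently, isomorphisms of `F.bundle` with `E ⊗ 𝒪_X[ε]` over `𝔘 i` that induce the identity
modulo `ε`), such that the transition functions are `1 + ε a i j`, i.e.
`σ j = σ i ∘ (1 + ε a i j)`, and the connection is `∇ + ε A i` in terms of `σ i`. -/
def FirstOrderDeformation.IsGivenBy {nab : MeromorphicConnection D E}
    (F : FirstOrderDeformation nab) {ι : Type u} (𝔘 : ι → Opens X.Pt)
    (z : (endComplex nab).Z1 𝔘) : Prop :=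
  ∃ σ : ∀ i, ∀ x : 𝔘 i, E.Stalk x.1 →ₗ[X.Stalk x.1] F.bundle.Stalk x.1,
    (∀ i, σ i ∈ (E.germSheaf.hom F.bundle.germSheaf).sec (𝔘 i)) ∧
    (∀ i (x : 𝔘 i) (s : E.Stalk x.1), OModule.stalkMap F.proj x.1 (σ i x s) = s) ∧
    (∀ i j (x : X.Pt) (hi : x ∈ 𝔘 i) (hj : x ∈ 𝔘 j) (s : E.Stalk x),
      let a : E.Stalk x →ₗ[X.Stalk x] E.Stalk x := (z.1.1 i j).1 ⟨x, hi, hj⟩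
      σ j ⟨x, hj⟩ s = σ i ⟨x, hi⟩ s + OModule.stalkMap F.eps x (σ i ⟨x, hi⟩ (a s))) ∧
    (∀ i (x : 𝔘 i) (s : E.Stalk x.1),
      let A : E.Stalk x.1 →ₗ[X.Stalk x.1] (E.formsIn D).fiber x.1 := (z.1.2 i).1 x
      F.conn.nabla x.1 (σ i x s) = formsMap D (σ i x) (nab.nabla x.1 s)
        + formsMap D (OModule.stalkMap F.eps x.1 ∘ₗ σ i x) (A s))

/-- An open set on which every Čech `1`-cocycle of the structure sheaf is a coboundary, i.e.
`H¹(U, 𝒪_X) = 0`. -/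
def IsAcyclicOpen (U : Opens X.Pt) : Prop :=
  ∀ (κ : Type u) (V : κ → Opens X.Pt), (⨆ i, V i) = U →
    ∀ c : ∀ i j, X.Sec (V i ⊓ V j),
      (∀ i j l, X.resFun (le_inf (inf_le_left.trans inf_le_right) inf_le_right) (c j l)
        - X.resFun (le_inf (inf_le_left.trans inf_le_left) inf_le_right) (c i l)
        + X.resFun (inf_le_left : V i ⊓ V j ⊓ V l ≤ V i ⊓ V j) (c i j) = 0) →
      ∃ b : ∀ i, X.Sec (V i), ∀ i j,
        c i j = X.resFun inf_le_right (b j) - X.resFun inf_le_left (b i)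

/-- A family of open sets that is sufficiently fine for `E`: over each member `U` the bundle `E` is
trivial and `H¹(U, 𝒪_X) = 0`. This holds when the members are affine (on a scheme) or Stein
(on a complex space) and trivialize `E`. -/
def IsSufficientlyFine (E : OModule X) {ι : Type u} (𝔘 : ι → Opens X.Pt) : Prop :=
  ∀ i, E.IsFreeOn (𝔘 i) ∧ IsAcyclicOpen (𝔘 i)

end EndComplex

end Sheaves
end

/-!
A deformation `F` of `(E, ∇)` is locally split: over a small open set `U` there is an `𝒪_X`-linear
section `σ` of the projection `F → E`, and then `F = σ E ⊕ ε σ E` over `U`. Here it is used that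
`F` is locally free over `𝒪_X[ε]`: the kernel and the image of `ε` are both equal to the kernel of
the projection (`FirstOrderDeformation.pr_eq_zero_of_ep_eq_zero`), so that `F` has a second
coordinate `ρ : F → E` besides the projection (`IsSplitting.exists_retraction`). Comparing the
splittings over the members of a covering gives the `a i j`, and the second coordinate of the
connection on `σ i` gives the `A i`; together they form a cocycle
(`exists_givenBySplittings`). Changing the splittings by `h` changes the cocycle exactly by the
coboundary of `h` (`mk_eq_mk_of_isGivenBy`, `IsGivenBy.of_mk_eq_mk`), and two deformations given by
the same cocycle are isomorphic through the map that matches the splittings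
(`nonempty_iso_of_isGivenBy`). Conversely a cocycle `(a, A)` glues the sheaves `E ⊕ E` along the
unipotent automorphisms `1 + ε a i j`, and the connections `∇ + ε A i` agree on the overlaps
(`exists_isGivenBy`).

So the class of a deformation in the colimit `ℍ¹(X, C)` is well defined, is a complete invariant,
and takes every value; this is the bijection `Φ` (`exists_equiv_hasClass`). If the class of `F`
is the image of `[(a, A)]`, then `F` is isomorphic to the deformation constructed from `(a, A)`, hence
given by `(a, A)` itself (`isGivenBy_iff_hasClass`). This also shows that
`ℍ¹(𝔘, C) → ℍ¹(X, C)` is injective for every covering. It is surjective as soon as every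
deformation splits over each member of `𝔘`. Over an open set `U` where `E` has a basis, a splitting
amounts to lifts of the members of the basis, and the differences of local lifts are cocycles with
values in a power of `𝒪_X`; they are coboundaries when `H¹(U, 𝒪_X) = 0`
(`exists_isSplitting_of_isAcyclicOpen`).

Sheaves of modules are handled through the germs of their sections: a morphism is the same as a
family of linear maps of stalks that preserves sections (`OModule.exists_hom_stalkMap_eq`), and a
sheaf of functions with values in given modules is the sheaf of germs of a sheaf of modules if its
sections have enough values and the zero set of each of them is open (`GermSheaf.exists_oModule`).
-/

noncomputable section

section Deformations

variable {k : Type v} [Field k] {X : SpaceOver.{u} k}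

/-! ### Sheaves of modules through germs -/

namespace OModule

lemma germ_injective (M : OModule X) {U : Opens X.Pt} {s t : M.Sec U}
    (h : ∀ x : U, M.germ x s = M.germ x t) : s = t :=
  TopCat.Presheaf.section_ext (C := Ab.{u}) (X := X.Pt) ⟨M.ab, M.isSheaf⟩ U s t
    fun x hx => h ⟨x, hx⟩

lemma exists_res_eq_of_germ_eq (M : OModule X) {U V : Opens X.Pt} {s : M.Sec U} {t : M.Sec V}
    {x : X.Pt} (hU : x ∈ U) (hV : x ∈ V)
    (h : M.germ (⟨x, hU⟩ : U) s = M.germ (⟨x, hV⟩ : V) t) :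
    ∃ (W : Opens X.Pt) (_ : x ∈ W) (h₁ : W ≤ U) (h₂ : W ≤ V), M.res h₁ s = M.res h₂ t := by
  obtain ⟨W, hW, i, j, e⟩ := TopCat.Presheaf.germ_eq M.ab x hU hV s t h
  exact ⟨W, hW, i.le, j.le, e⟩

/-- Two sections with the same germ at a point have the same germs in a neighbourhood. -/
lemma exists_germ_eq_of_germ_eq (M : OModule X) {U V : Opens X.Pt} {s : M.Sec U} {t : M.Sec V}
    {x : X.Pt} (hU : x ∈ U) (hV : x ∈ V)
    (h : M.germ (⟨x, hU⟩ : U) s = M.germ (⟨x, hV⟩ : V) t) :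
    ∃ (W : Opens X.Pt) (_ : x ∈ W) (h₁ : W ≤ U) (h₂ : W ≤ V),
      ∀ y : W, M.germ (⟨y, h₁ y.2⟩ : U) s = M.germ (⟨y, h₂ y.2⟩ : V) t := by
  obtain ⟨W, hW, h₁, h₂, e⟩ := M.exists_res_eq_of_germ_eq hU hV h
  exact ⟨W, hW, h₁, h₂, fun y => by rw [← M.germ_res h₁ s y, ← M.germ_res h₂ t y, e]⟩

lemma germ_mem_sec (M : OModule X) {U : Opens X.Pt} (s : M.Sec U) :
    (fun x : U => M.germ x s) ∈ M.germSheaf.sec U :=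
  fun x => ⟨U, le_rfl, x.2, AddSubgroup.subset_closure ⟨s, rfl⟩⟩

/-- The sections of `M.germSheaf` are the families of germs of sections of `M`. -/
lemma mem_sec_iff (M : OModule X) {U : Opens X.Pt} {t : ∀ x : U, M.Stalk x.1} :
    t ∈ M.germSheaf.sec U ↔ ∃ s : M.Sec U, ∀ x : U, t x = M.germ x s := by
  refine ⟨fun ht => ?_, ?_⟩
  · have loc : ∀ x : U, ∃ (V : Opens X.Pt) (h : V ≤ U) (s : M.Sec V), x.1 ∈ V ∧
        ∀ y : V, t ⟨y.1, h y.2⟩ = M.germ y s := by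
      intro x
      obtain ⟨V, hV, hx, hc⟩ := ht x
      suffices H : ∀ r : (∀ y : V, M.Stalk y.1), r ∈ AddSubgroup.closure
          {t | ∃ s : M.Sec V, t = fun x => M.germ x s} →
          ∃ s : M.Sec V, ∀ y : V, r y = M.germ y s by
        obtain ⟨s, hs⟩ := H _ hc
        exact ⟨V, hV, s, hx, hs⟩
      intro r hr
      induction hr using AddSubgroup.closure_induction with
      | mem r hr => obtain ⟨s, rfl⟩ := hr; exact ⟨s, fun _ => rfl⟩
      | zero => exact ⟨0, fun y => (map_zero (M.germ y)).symm⟩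
      | add r r' _ _ h h' =>
        obtain ⟨s, hs⟩ := h
        obtain ⟨s', hs'⟩ := h'
        exact ⟨s + s', fun y => by rw [map_add, ← hs, ← hs']; rfl⟩
      | neg r _ h =>
        obtain ⟨s, hs⟩ := h
        exact ⟨-s, fun y => by rw [map_neg, ← hs]; rfl⟩
    choose V hV s hx hs using loc
    obtain ⟨g, hg, -⟩ := TopCat.Sheaf.existsUnique_gluing' (C := Ab.{u}) (X := X.Pt)
      ⟨M.ab, M.isSheaf⟩ V U (fun x => homOfLE (hV x))
      (fun x hxU => Opens.mem_iSup.2 ⟨⟨x, hxU⟩, hx _⟩) s (by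
        intro i j
        refine M.germ_injective (U := V i ⊓ V j) fun y => ?_
        refine (M.germ_res (inf_le_left : V i ⊓ V j ≤ V i) (s i) y).trans ?_
        refine Eq.trans ?_ (M.germ_res (inf_le_right : V i ⊓ V j ≤ V j) (s j) y).symm
        rw [← hs i ⟨y.1, y.2.1⟩, ← hs j ⟨y.1, y.2.2⟩])
    refine ⟨g, fun x => ?_⟩
    have h1 : M.res (hV x) g = s x := hg x
    rw [hs x ⟨x.1, hx x⟩, ← h1, M.germ_res]
  · rintro ⟨s, hs⟩
    rw [show t = fun x => M.germ x s from funext hs]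
    exact M.germ_mem_sec s

lemma exists_sec_through (M : OModule X) {x : X.Pt} (t : M.Stalk x) :
    ∃ (U : Opens X.Pt) (hx : x ∈ U) (s : ∀ y : U, M.Stalk y.1),
      s ∈ M.germSheaf.sec U ∧ s ⟨x, hx⟩ = t := by
  obtain ⟨U, hx, s, rfl⟩ := M.exists_germ t
  exact ⟨U, hx, _, M.germ_mem_sec s, rfl⟩

/-- Families of linear maps of stalks that preserve sections come from morphisms. -/
lemma exists_hom_stalkMap_eq {M N : OModule X} (φ : ∀ x, M.Stalk x →ₗ[X.Stalk x] N.Stalk x)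
    (hφ : ∀ (U : Opens X.Pt) (s : ∀ x : U, M.Stalk x.1), s ∈ M.germSheaf.sec U →
      (fun x : U => φ x.1 (s x)) ∈ N.germSheaf.sec U) :
    ∃ ψ : M ⟶ N, ∀ x, stalkMap ψ x = φ x := by
  have H : ∀ (U : Opens X.Pt) (s : M.Sec U), ∃ t : N.Sec U, ∀ x : U,
      φ x.1 (M.germ x s) = N.germ x t := fun U s =>
    N.mem_sec_iff.1 (hφ U _ (M.germ_mem_sec s))
  choose f hf using H
  have f_add : ∀ (U : Opens X.Pt) (s t : M.Sec U), f U (s + t) = f U s + f U t := fun U s t =>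
    N.germ_injective fun x => by
      rw [map_add, ← hf, ← hf, ← hf, map_add, map_add]
  have f_smul : ∀ (U : Opens X.Pt) (r : X.Sec U) (s : M.Sec U), f U (r • s) = r • f U s :=
    fun U r s => N.germ_injective fun x => by
      rw [N.germ_smul, ← hf, ← hf, M.germ_smul, map_smul]
  have f_res : ∀ (U V : Opens X.Pt) (h : V ≤ U) (s : M.Sec U),
      f V (M.res h s) = N.res h (f U s) := fun U V h s =>
    N.germ_injective fun x => by
      rw [← hf, N.germ_res, ← hf, M.germ_res]
  let ψ : M.ab ⟶ N.ab :=
    { app := fun U => AddCommGrpCat.ofHom (AddMonoidHom.mk' (f U.unop) (f_add U.unop))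
      naturality := fun U V i => by
        ext s
        exact f_res U.unop V.unop i.unop.le s }
  let Ψ : M ⟶ N := ⟨PresheafOfModules.homMk ψ fun U r s => f_smul U.unop r s⟩
  refine ⟨Ψ, fun x => LinearMap.ext fun t => ?_⟩
  obtain ⟨U, hx, s, rfl⟩ := M.exists_germ t
  rw [stalkMap_germ Ψ (⟨x, hx⟩ : U), hf U s ⟨x, hx⟩]
  rfl

lemma stalkMap_sec {M N : OModule X} (ψ : M ⟶ N) {U : Opens X.Pt} {s : ∀ x : U, M.Stalk x.1}
    (hs : s ∈ M.germSheaf.sec U) : (fun x : U => stalkMap ψ x.1 (s x)) ∈ N.germSheaf.sec U := by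
  obtain ⟨t, ht⟩ := M.mem_sec_iff.1 hs
  exact N.mem_sec_iff.2 ⟨app ψ U t, fun x => by rw [ht, stalkMap_germ]⟩

lemma hom_ext_stalk {M N : OModule X} {φ ψ : M ⟶ N} (h : ∀ x, stalkMap φ x = stalkMap ψ x) :
    φ = ψ := by
  refine SheafOfModules.hom_ext (PresheafOfModules.hom_ext fun U => ModuleCat.hom_ext
    (LinearMap.ext fun s => ?_))
  refine N.germ_injective (U := U.unop) fun x => ?_
  have h1 := stalkMap_germ φ x s
  have h2 := stalkMap_germ ψ x s
  rw [h] at h1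
  exact h1.symm.trans h2

lemma stalkMap_zero (M N : OModule X) (x : X.Pt) : stalkMap (0 : M ⟶ N) x = 0 := by
  ext s
  obtain ⟨U, hx, s, rfl⟩ := M.exists_germ s
  rw [stalkMap_germ (0 : M ⟶ N) (⟨x, hx⟩ : U)]
  exact map_zero _

end OModule

/-! ### The sheaf of modules of sections of a sheaf of germs -/

namespace GermSheaf

variable (G : GermSheaf X)

/-- The presheaf of abelian groups of sections of `G`. -/
def presheafAb : TopCat.Presheaf Ab.{u} X.Pt where
  obj U := AddCommGrpCat.of (G.sec U.unop)
  map i := AddCommGrpCat.ofHom (G.res i.unop.le)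

lemma presheafAb_isSheaf : G.presheafAb.IsSheaf := by
  rw [TopCat.Presheaf.isSheaf_iff_isSheafUniqueGluing]
  intro ι U sf hsf
  have hcpt : ∀ i j (x : X.Pt) (hi : x ∈ U i) (hj : x ∈ U j),
      (sf i : G.sec (U i)).1 ⟨x, hi⟩ = (sf j : G.sec (U j)).1 ⟨x, hj⟩ := fun i j x hi hj =>
    congrFun (congrArg Subtype.val (hsf i j)) (⟨x, hi, hj⟩ : (U i ⊓ U j : Opens X.Pt))
  choose idx hidx using fun x : (iSup U : Opens X.Pt) => Opens.mem_iSup.1 x.2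
  let t : ∀ x : (iSup U : Opens X.Pt), G.fiber x.1 := fun x => (sf (idx x)).1 ⟨x.1, hidx x⟩
  have ht : t ∈ G.sec (iSup U) := G.glue _ t fun x =>
    ⟨U (idx x), le_iSup U _, hidx x, by
      convert (sf (idx x)).2 using 2 with y
      exact hcpt _ _ y.1 _ y.2⟩
  refine ⟨(⟨t, ht⟩ : G.sec (iSup U)), fun i => Subtype.ext (funext fun x => ?_), ?_⟩
  · exact hcpt _ _ x.1 _ x.2
  · intro s hs
    refine Subtype.ext (funext fun x => ?_)
    exact congrFun (congrArg Subtype.val (hs (idx x))) ⟨x.1, hidx x⟩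

instance (U : Opens X.Pt) : Module (X.Sec U) (G.sec U) where
  smul f s := ⟨fun x => X.germFun x f • s.1 x, G.smul_mem U f s.1 s.2⟩
  one_smul s := Subtype.ext (funext fun x => by
    change X.germFun x 1 • s.1 x = s.1 x
    rw [map_one, one_smul])
  mul_smul f g s := Subtype.ext (funext fun x => by
    change X.germFun x (f * g) • s.1 x = X.germFun x f • X.germFun x g • s.1 x
    rw [map_mul, mul_smul])
  smul_zero f := Subtype.ext (funext fun x => smul_zero (X.germFun x f))
  smul_add f s t := Subtype.ext (funext fun x => smul_add (X.germFun x f) (s.1 x) (t.1 x))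
  add_smul f g s := Subtype.ext (funext fun x => by
    change X.germFun x (f + g) • s.1 x = X.germFun x f • s.1 x + X.germFun x g • s.1 x
    rw [map_add, add_smul])
  zero_smul s := Subtype.ext (funext fun x => by
    change X.germFun x 0 • s.1 x = 0
    rw [map_zero, zero_smul])

instance (U : (Opens X.Pt)ᵒᵖ) :
    Module ((X.space.presheaf ⋙ forget₂ CommRingCat RingCat).obj U) (G.presheafAb.obj U) :=
  inferInstanceAs (Module (X.Sec U.unop) (G.sec U.unop))

lemma presheafAb_map_smul ⦃U V : (Opens X.Pt)ᵒᵖ⦄ (i : U ⟶ V)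
    (f : (X.space.presheaf ⋙ forget₂ CommRingCat RingCat).obj U) (s : G.presheafAb.obj U) :
    G.presheafAb.map i (f • s) =
      (X.space.presheaf ⋙ forget₂ CommRingCat RingCat).map i f • G.presheafAb.map i s :=
  Subtype.ext (funext fun x => by
    change X.germFun (⟨x.1, i.unop.le x.2⟩ : U.unop) f • (G.res i.unop.le s).1 x =
      X.germFun x (X.resFun i.unop.le f) • (G.res i.unop.le s).1 x
    rw [X.germFun_resFun])

/-- The presheaf of `𝒪_X`-modules of sections of `G`. -/
def presheafOfModules : PresheafOfModules.{u} (X.space.presheaf ⋙ forget₂ CommRingCat RingCat) :=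
  PresheafOfModules.ofPresheaf G.presheafAb G.presheafAb_map_smul

/-- The sheaf of `𝒪_X`-modules of sections of `G`. -/
def toOModule : OModule X where
  val := G.presheafOfModules
  isSheaf := G.presheafAb_isSheaf

variable {G}

/-- A section of `G`, as a section of the sheaf of modules of sections of `G`. -/
def toOSec {U : Opens X.Pt} (s : G.sec U) : G.toOModule.Sec U := s

/-- A section of the sheaf of modules of sections of `G`, as a section of `G`. -/
def ofOSec {U : Opens X.Pt} (s : G.toOModule.Sec U) : G.sec U := s

variable (G) in
/-- The value at `x` of a germ of sections of `G` is well defined and linear. -/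
lemma exists_eval (x : X.Pt) : ∃ e : G.toOModule.Stalk x →ₗ[X.Stalk x] G.fiber x,
    ∀ (U : Opens X.Pt) (hx : x ∈ U) (s : G.toOModule.Sec U),
      e (G.toOModule.germ (⟨x, hx⟩ : U) s) = (ofOSec s).1 ⟨x, hx⟩ := by
  choose U hx s hs using fun t : G.toOModule.Stalk x => G.toOModule.exists_germ t
  let e : G.toOModule.Stalk x → G.fiber x := fun t => (ofOSec (s t)).1 ⟨x, hx t⟩
  have he : ∀ (V : Opens X.Pt) (hV : x ∈ V) (r : G.toOModule.Sec V),
      e (G.toOModule.germ (⟨x, hV⟩ : V) r) = (ofOSec r).1 ⟨x, hV⟩ := by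
    intro V hV r
    obtain ⟨W, hW, h₁, h₂, h⟩ := G.toOModule.exists_res_eq_of_germ_eq (hx _) hV
      (hs (G.toOModule.germ (⟨x, hV⟩ : V) r))
    exact congrFun (congrArg Subtype.val h) ⟨x, hW⟩
  refine ⟨⟨⟨e, fun a b => ?_⟩, fun f a => ?_⟩, he⟩
  · obtain ⟨V, hV, a, rfl⟩ := G.toOModule.exists_germ a
    obtain ⟨W, hW, b, rfl⟩ := G.toOModule.exists_germ b
    have h1 := G.toOModule.germ_res (inf_le_left : V ⊓ W ≤ V) a ⟨x, ⟨hV, hW⟩⟩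
    have h2 := G.toOModule.germ_res (inf_le_right : V ⊓ W ≤ W) b ⟨x, ⟨hV, hW⟩⟩
    rw [← h1, ← h2, ← map_add, he (V ⊓ W) ⟨hV, hW⟩, he (V ⊓ W) ⟨hV, hW⟩, he (V ⊓ W) ⟨hV, hW⟩]
    rfl
  · obtain ⟨V, hV, f, rfl⟩ := TopCat.Presheaf.exists_germ_eq X.space.presheaf f
    obtain ⟨W, hW, a, rfl⟩ := G.toOModule.exists_germ a
    have h1 : X.germFun (⟨x, ⟨hV, hW⟩⟩ : (V ⊓ W : Opens X.Pt)) (X.resFun inf_le_left f)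
        = X.space.presheaf.germ V x hV f := X.germFun_resFun inf_le_left f _
    have h2 := G.toOModule.germ_res (inf_le_right : V ⊓ W ≤ W) a ⟨x, ⟨hV, hW⟩⟩
    change e _ = X.space.presheaf.germ V x hV f • e _
    rw [← h1, ← h2, ← OModule.germ_smul, he (V ⊓ W) ⟨hV, hW⟩, he (V ⊓ W) ⟨hV, hW⟩]
    rfl

/-- A sheaf whose fibers are generated by sections, and in which a section that vanishes at a
point vanishes near it, is the sheaf of germs of a sheaf of modules. -/
theorem exists_oModule (G : GermSheaf X)
    (hsurj : ∀ (x : X.Pt) (v : G.fiber x), ∃ (U : Opens X.Pt) (hx : x ∈ U)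
      (s : ∀ y : U, G.fiber y.1), s ∈ G.sec U ∧ s ⟨x, hx⟩ = v)
    (hinj : ∀ (U : Opens X.Pt) (s : ∀ y : U, G.fiber y.1), s ∈ G.sec U → ∀ x : U, s x = 0 →
      ∃ (V : Opens X.Pt) (h : V ≤ U), x.1 ∈ V ∧ ∀ y : V, s ⟨y.1, h y.2⟩ = 0) :
    ∃ (M : OModule X) (e : ∀ x, M.Stalk x ≃ₗ[X.Stalk x] G.fiber x),
      ∀ (U : Opens X.Pt) (t : ∀ x : U, M.Stalk x.1),
        t ∈ M.germSheaf.sec U ↔ (fun x : U => e x.1 (t x)) ∈ G.sec U := by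
  choose e he using G.exists_eval
  have bij : ∀ x, Function.Bijective (e x) := by
    intro x
    refine ⟨(injective_iff_map_eq_zero (e x)).2 fun t ht => ?_, fun v => ?_⟩
    · obtain ⟨U, hU, s, rfl⟩ := G.toOModule.exists_germ t
      rw [he] at ht
      obtain ⟨V, hV, hx, h0⟩ := hinj U (ofOSec s).1 (ofOSec s).2 ⟨x, hU⟩ ht
      have h1 : G.toOModule.res hV s = 0 := Subtype.ext (funext h0)
      have h2 := G.toOModule.germ_res hV s ⟨x, hx⟩
      rw [h1, map_zero] at h2
      exact h2.symm
    · obtain ⟨U, hx, s, hs, rfl⟩ := hsurj x v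
      exact ⟨G.toOModule.germ (⟨x, hx⟩ : U) (toOSec ⟨s, hs⟩), he _ _ _ _⟩
  refine ⟨G.toOModule, fun x => LinearEquiv.ofBijective (e x) (bij x), fun U t => ?_⟩
  rw [OModule.mem_sec_iff]
  constructor
  · rintro ⟨s, hs⟩
    convert (ofOSec s).2 using 2 with x
    rw [LinearEquiv.ofBijective_apply, hs]
    exact he _ _ _ _
  · intro h
    refine ⟨toOSec ⟨_, h⟩, fun x => (bij x.1).1 ?_⟩
    exact (he _ _ x.2 (toOSec ⟨_, h⟩)).symm

end GermSheaf

/-! ### Tensoring with forms -/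

section FormsMap

variable (D : CartierDivisor X) {M N P : OModule X} {x : X.Pt}

lemma formsMap_comp_apply (φ : M.Stalk x →ₗ[X.Stalk x] N.Stalk x)
    (ψ : N.Stalk x →ₗ[X.Stalk x] P.Stalk x) (t : (M.formsIn D).fiber x) :
    formsMap D ψ (formsMap D φ t) = formsMap D (ψ ∘ₗ φ) t :=
  (FirstOrderDeformation.formsMap_comp x φ ψ t).symm

lemma formsMap_injective_of_leftInverse {φ : M.Stalk x →ₗ[X.Stalk x] N.Stalk x}
    {ψ : N.Stalk x →ₗ[X.Stalk x] M.Stalk x} (h : ψ ∘ₗ φ = LinearMap.id) :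
    Function.Injective (formsMap D φ) := fun a b hab => by
  have := congrArg (formsMap D ψ) hab
  rwa [formsMap_comp_apply, formsMap_comp_apply, h, FirstOrderDeformation.formsMap_id,
    FirstOrderDeformation.formsMap_id] at this

lemma tmulForm_zero (ω : (OmegaPoles D).fiber x) : M.tmulForm D x 0 ω = 0 :=
  TensorProduct.zero_tmul _ ω

lemma tmulForm_add (s t : M.Stalk x) (ω : (OmegaPoles D).fiber x) :
    M.tmulForm D x (s + t) ω = M.tmulForm D x s ω + M.tmulForm D x t ω :=
  TensorProduct.add_tmul s t ω

end FormsMap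

/-! ### Sections through germs -/

lemma exists_opens_le_of_finite {T : TopCat.{u}} {α : Type*} [Finite α] {x : T}
    (V : α → Opens T) (h : ∀ i, x ∈ V i) : ∃ W : Opens T, x ∈ W ∧ ∀ i, W ≤ V i :=
  ⟨⟨⋂ i, (V i : Set T), isOpen_iInter_of_finite fun i => (V i).2⟩, Set.mem_iInter.2 h,
    fun i => Set.iInter_subset (fun i => (V i : Set T)) i⟩

namespace OModule

lemma eq_near_of_eq (M : OModule X) {U : Opens X.Pt} {s t : ∀ x : U, M.Stalk x.1}
    (hs : s ∈ M.germSheaf.sec U) (ht : t ∈ M.germSheaf.sec U) {x : U} (h : s x = t x) :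
    ∃ (V : Opens X.Pt) (hV : V ≤ U), x.1 ∈ V ∧ ∀ y : V, s ⟨y.1, hV y.2⟩ = t ⟨y.1, hV y.2⟩ := by
  obtain ⟨s', hs'⟩ := M.mem_sec_iff.1 hs
  obtain ⟨t', ht'⟩ := M.mem_sec_iff.1 ht
  rw [hs', ht'] at h
  obtain ⟨W, hW, h₁, h₂, e⟩ := M.exists_germ_eq_of_germ_eq x.2 x.2 h
  exact ⟨W, h₁, hW, fun y => by rw [hs', ht']; exact e y⟩

lemma sec_congr (M : OModule X) {U : Opens X.Pt} {s t : ∀ x : U, M.Stalk x.1}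
    (h : ∀ x, s x = t x) (ht : t ∈ M.germSheaf.sec U) : s ∈ M.germSheaf.sec U :=
  (funext h : s = t) ▸ ht

lemma sec_zero (M : OModule X) (U : Opens X.Pt) :
    (fun _ => 0 : ∀ x : U, M.Stalk x.1) ∈ M.germSheaf.sec U :=
  zero_mem (M.germSheaf.sec U)

lemma sec_neg (M : OModule X) {U : Opens X.Pt} {s : ∀ x : U, M.Stalk x.1}
    (hs : s ∈ M.germSheaf.sec U) : (fun x => -s x) ∈ M.germSheaf.sec U :=
  (M.germSheaf.sec U).neg_mem hs

lemma sec_add (M : OModule X) {U : Opens X.Pt} {s t : ∀ x : U, M.Stalk x.1}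
    (hs : s ∈ M.germSheaf.sec U) (ht : t ∈ M.germSheaf.sec U) :
    (fun x => s x + t x) ∈ M.germSheaf.sec U :=
  (M.germSheaf.sec U).add_mem hs ht

lemma sec_sub (M : OModule X) {U : Opens X.Pt} {s t : ∀ x : U, M.Stalk x.1}
    (hs : s ∈ M.germSheaf.sec U) (ht : t ∈ M.germSheaf.sec U) :
    (fun x => s x - t x) ∈ M.germSheaf.sec U :=
  (M.germSheaf.sec U).sub_mem hs ht

lemma sec_res (M : OModule X) {U V : Opens X.Pt} (h : V ≤ U) {s : ∀ x : U, M.Stalk x.1}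
    (hs : s ∈ M.germSheaf.sec U) :
    (fun x : V => s ⟨x.1, h x.2⟩) ∈ M.germSheaf.sec V :=
  M.germSheaf.res_mem U V h s hs

lemma sec_hom {M N : OModule X} {U V : Opens X.Pt} (h : V ≤ U)
    {φ : ∀ x : U, M.Stalk x.1 →ₗ[X.Stalk x.1] N.Stalk x.1}
    (hφ : φ ∈ (M.germSheaf.hom N.germSheaf).sec U) {s : ∀ x : V, M.Stalk x.1}
    (hs : s ∈ M.germSheaf.sec V) :
    (fun x : V => φ ⟨x.1, h x.2⟩ (s x)) ∈ N.germSheaf.sec V :=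
  hφ V h s hs

lemma sec_of_locally (M : OModule X) {U : Opens X.Pt} {s : ∀ x : U, M.Stalk x.1}
    (hs : ∀ x : U, ∃ (V : Opens X.Pt) (h : V ≤ U), x.1 ∈ V ∧
      (fun y : V => s ⟨y.1, h y.2⟩) ∈ M.germSheaf.sec V) : s ∈ M.germSheaf.sec U :=
  M.germSheaf.glue U s hs

lemma germ_sum_smul (M : OModule X) {n : ℕ} {V : Opens X.Pt} (c : Fin n → X.Sec V)
    (s : Fin n → M.Sec V) (y : V) :
    M.germ y (∑ i, c i • s i) = ∑ i, X.germFun y (c i) • M.germ y (s i) := by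
  rw [map_sum]
  exact Finset.sum_congr rfl fun i _ => M.germ_smul y (c i) (s i)

lemma sec_sum_smul (M : OModule X) {n : ℕ} {V : Opens X.Pt} (c : Fin n → X.Sec V)
    (s : Fin n → ∀ x : V, M.Stalk x.1) (hs : ∀ i, s i ∈ M.germSheaf.sec V) :
    (fun x : V => ∑ i, X.germFun x (c i) • s i x) ∈ M.germSheaf.sec V := by
  have := (M.germSheaf.sec V).sum_mem (t := Finset.univ)
    fun i _ => M.germSheaf.smul_mem V (c i) (s i) (hs i)
  have e : (fun x : V => ∑ i, X.germFun x (c i) • s i x) =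
      ∑ i, fun x : V => X.germFun x (c i) • s i x :=
    funext fun x => (Finset.sum_apply (M := fun x : V => M.Stalk x.1) x Finset.univ
      fun i (x : V) => X.germFun x (c i) • s i x).symm
  rw [e]
  exact this

/-- Two functions with the same germs are equal. -/
lemma _root_.SpaceOver.germFun_injective {U : Opens X.Pt} {f g : X.Sec U}
    (h : ∀ x : U, X.germFun x f = X.germFun x g) : f = g :=
  TopCat.Presheaf.section_ext X.space.sheaf U f g fun x hx => h ⟨x, hx⟩

/-- The coordinate functions on the stalks of a sheaf of modules that is free over an open set. -/
lemma exists_coord (M : OModule X) {U : Opens X.Pt} {n : ℕ} {b : Fin n → M.Sec U}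
    (hb : ∀ (V : Opens X.Pt) (h : V ≤ U) (s : M.Sec V),
      ∃! c : Fin n → X.Sec V, s = ∑ i, c i • M.res h (b i)) :
    ∃ κ : ∀ x : U, Fin n → M.Stalk x.1 →ₗ[X.Stalk x.1] X.Stalk x.1,
      (∀ (x : U) (s : M.Stalk x.1), s = ∑ i, κ x i s • M.germ x (b i)) ∧
      (∀ (x : U) (c : Fin n → X.Stalk x.1) (i : Fin n),
        κ x i (∑ j, c j • M.germ x (b j)) = c i) ∧
      ∀ (V : Opens X.Pt) (h : V ≤ U) (s : ∀ x : V, M.Stalk x.1), s ∈ M.germSheaf.sec V →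
        ∃ c : Fin n → X.Sec V, ∀ (y : V) (i : Fin n),
          X.germFun y (c i) = κ ⟨y.1, h y.2⟩ i (s y) := by
  have expand : ∀ (V : Opens X.Pt) (h : V ≤ U) (c : Fin n → X.Sec V) (y : V),
      M.germ y (∑ i, c i • M.res h (b i)) =
        ∑ i, X.germFun y (c i) • M.germ (⟨y.1, h y.2⟩ : U) (b i) := by
    intro V h c y
    rw [germ_sum_smul]
    simp only [M.germ_res]
  have span : ∀ (x : U) (s : M.Stalk x.1), ∃ c : Fin n → X.Stalk x.1,
      s = ∑ i, c i • M.germ x (b i) := by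
    intro x s
    obtain ⟨V, hx, s, rfl⟩ := M.exists_germ s
    obtain ⟨c, hc, -⟩ := hb (U ⊓ V) inf_le_left (M.res inf_le_right s)
    refine ⟨fun i => X.germFun (⟨x.1, ⟨x.2, hx⟩⟩ : (U ⊓ V : Opens X.Pt)) (c i), ?_⟩
    rw [← expand (U ⊓ V) inf_le_left c ⟨x.1, ⟨x.2, hx⟩⟩, ← hc, M.germ_res]
  have indep : ∀ (x : U) (c d : Fin n → X.Stalk x.1),
      ∑ i, c i • M.germ x (b i) = ∑ i, d i • M.germ x (b i) → c = d := by
    intro x c d hcd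
    choose V hV c' hc' using fun i => TopCat.Presheaf.exists_germ_eq X.space.presheaf (c i)
    choose W hW d' hd' using fun i => TopCat.Presheaf.exists_germ_eq X.space.presheaf (d i)
    obtain ⟨A, hA, hAV⟩ := exists_opens_le_of_finite V hV
    obtain ⟨B, hB, hBW⟩ := exists_opens_le_of_finite W hW
    let O : Opens X.Pt := A ⊓ B ⊓ U
    have hO : x.1 ∈ O := ⟨⟨hA, hB⟩, x.2⟩
    let cO : Fin n → X.Sec O := fun i =>
      X.resFun ((inf_le_left.trans inf_le_left).trans (hAV i) : O ≤ V i) (c' i)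
    let dO : Fin n → X.Sec O := fun i =>
      X.resFun ((inf_le_left.trans inf_le_right).trans (hBW i) : O ≤ W i) (d' i)
    have hc : ∀ i, X.germFun (⟨x.1, hO⟩ : O) (cO i) = c i := fun i => by
      rw [X.germFun_resFun]; exact hc' i
    have hd : ∀ i, X.germFun (⟨x.1, hO⟩ : O) (dO i) = d i := fun i => by
      rw [X.germFun_resFun]; exact hd' i
    have key : M.germ (⟨x.1, hO⟩ : O) (∑ i, cO i • M.res inf_le_right (b i)) =
        M.germ (⟨x.1, hO⟩ : O) (∑ i, dO i • M.res inf_le_right (b i)) := by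
      rw [expand, expand]
      simpa only [hc, hd] using hcd
    obtain ⟨Q, hQ, h₁, h₂, e⟩ := M.exists_germ_eq_of_germ_eq hO hO key
    have h2 : (∑ i, X.resFun h₁ (cO i) • M.res (h₁.trans inf_le_right) (b i)) =
        ∑ i, X.resFun h₁ (dO i) • M.res (h₁.trans inf_le_right) (b i) := by
      refine M.germ_injective fun y => ?_
      have := e y
      rw [expand, expand] at this
      rw [expand, expand]
      simpa only [X.germFun_resFun] using this
    have h3 := (hb Q (h₁.trans inf_le_right) _).unique rfl h2
    ext i
    have h4 := congrArg (X.germFun (⟨x.1, hQ⟩ : Q)) (congrFun h3 i)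
    rw [X.germFun_resFun h₁ (cO i), X.germFun_resFun h₁ (dO i)] at h4
    exact (hc i).symm.trans (h4.trans (hd i))
  choose co hco using span
  have co_eq : ∀ (x : U) (c : Fin n → X.Stalk x.1), co x (∑ i, c i • M.germ x (b i)) = c :=
    fun x c => (indep x _ _ (hco x _)).symm
  refine ⟨fun x i => ⟨⟨fun s => co x s i, fun s t => ?_⟩, fun f s => ?_⟩, hco,
    fun x c i => congrFun (co_eq x c) i, ?_⟩
  · have : co x (s + t) = co x s + co x t := by
      refine indep x _ _ ?_
      rw [← hco]
      simp only [Pi.add_apply, add_smul, Finset.sum_add_distrib]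
      rw [← hco, ← hco]
    exact congrFun this i
  · have : co x (f • s) = f • co x s := by
      refine indep x _ _ ?_
      rw [← hco]
      simp only [Pi.smul_apply, smul_assoc]
      rw [← Finset.smul_sum, ← hco]
    exact congrFun this i
  · intro V h s hs
    obtain ⟨s', hs'⟩ := M.mem_sec_iff.1 hs
    obtain ⟨c, hc, -⟩ := hb V h s'
    refine ⟨c, fun y i => ?_⟩
    rw [hs', hc, expand]
    exact (congrFun (co_eq ⟨y.1, h y.2⟩ fun i => X.germFun y (c i)) i).symm

end OModule

variable {D : CartierDivisor X} {E : OModule X} {nab : MeromorphicConnection D E}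

/-! ### Cocycles of the complex of a connection -/

section Cocycles

variable {ι : Type u} {𝔘 : ι → Opens X.Pt}

/-- The endomorphism `a i j` of the stalk `E_x` given by a cocycle `(a, A)`. -/
def transEnd (z : (endComplex nab).Z1 𝔘) {x : X.Pt} {i j : ι} (hi : x ∈ 𝔘 i) (hj : x ∈ 𝔘 j) :
    E.Stalk x →ₗ[X.Stalk x] E.Stalk x :=
  (z.1.1 i j).1 ⟨x, ⟨hi, hj⟩⟩

/-- The germ `A i` at `x`, as a linear map on `E_x`, given by a cocycle `(a, A)`. -/
def conForm (z : (endComplex nab).Z1 𝔘) (i : ι) (x : 𝔘 i) :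
    E.Stalk x.1 →ₗ[X.Stalk x.1] (E.formsIn D).fiber x.1 :=
  (z.1.2 i).1 x

variable (z : (endComplex nab).Z1 𝔘)

lemma transEnd_sec (i j : ι) :
    (fun x : (𝔘 i ⊓ 𝔘 j : Opens X.Pt) => transEnd z x.2.1 x.2.2) ∈ E.endSheaf.sec (𝔘 i ⊓ 𝔘 j) :=
  (z.1.1 i j).2

lemma conForm_sec (i : ι) : conForm z i ∈ (E.endForms D).sec (𝔘 i) :=
  (z.1.2 i).2

lemma transEnd_add {x : X.Pt} {i j l : ι} (hi : x ∈ 𝔘 i) (hj : x ∈ 𝔘 j) (hl : x ∈ 𝔘 l) :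
    transEnd z hi hl = transEnd z hi hj + transEnd z hj hl := by
  have hz : (endComplex nab).D1 𝔘 z.1 = 0 := z.2
  have h : transEnd z hj hl - transEnd z hi hl + transEnd z hi hj = 0 := congrFun (congrArg Subtype.val
    (congrFun (congrFun (congrFun (congrArg Prod.fst hz) i) j) l)) ⟨x, ⟨⟨hi, hj⟩, hl⟩⟩
  rw [sub_add_eq_add_sub, sub_eq_zero] at h
  rw [← h, add_comm]

lemma transEnd_self {x : X.Pt} {i : ι} (hi : x ∈ 𝔘 i) : transEnd z hi hi = 0 := by
  have h := transEnd_add z hi hi hi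
  rwa [left_eq_add] at h

lemma conForm_sub {x : X.Pt} {i j : ι} (hi : x ∈ 𝔘 i) (hj : x ∈ 𝔘 j) :
    conForm z j ⟨x, hj⟩ = conForm z i ⟨x, hi⟩ + nablaEndMap nab x (transEnd z hi hj) := by
  have hz : (endComplex nab).D1 𝔘 z.1 = 0 := z.2
  have h : conForm z j ⟨x, hj⟩ - conForm z i ⟨x, hi⟩ - nablaEndMap nab x (transEnd z hi hj) = 0 :=
    congrFun (congrArg Subtype.val (congrFun (congrFun (congrArg Prod.snd hz) i) j)) ⟨x, ⟨hi, hj⟩⟩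
  rw [sub_sub, sub_eq_zero] at h
  exact h

lemma nablaEndMap_apply (x : X.Pt) (φ : E.Stalk x →ₗ[X.Stalk x] E.Stalk x) (s : E.Stalk x) :
    nablaEndMap nab x φ s = nab.nabla x (φ s) - formsMap D φ (nab.nabla x s) := rfl

/-- Families of endomorphisms and forms that satisfy the cocycle relations form a cocycle. -/
lemma exists_endComplex_cocycle
    (a : ∀ i j, ∀ x : (𝔘 i ⊓ 𝔘 j : Opens X.Pt), E.Stalk x.1 →ₗ[X.Stalk x.1] E.Stalk x.1)
    (A : ∀ i, ∀ x : 𝔘 i, E.Stalk x.1 →ₗ[X.Stalk x.1] (E.formsIn D).fiber x.1)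
    (ha : ∀ i j, a i j ∈ E.endSheaf.sec (𝔘 i ⊓ 𝔘 j))
    (hA : ∀ i, A i ∈ (E.endForms D).sec (𝔘 i))
    (haa : ∀ i j l (x : X.Pt) (hi : x ∈ 𝔘 i) (hj : x ∈ 𝔘 j) (hl : x ∈ 𝔘 l),
      a i l ⟨x, ⟨hi, hl⟩⟩ = a i j ⟨x, ⟨hi, hj⟩⟩ + a j l ⟨x, ⟨hj, hl⟩⟩)
    (haA : ∀ i j (x : X.Pt) (hi : x ∈ 𝔘 i) (hj : x ∈ 𝔘 j),
      A j ⟨x, hj⟩ = A i ⟨x, hi⟩ + nablaEndMap nab x (a i j ⟨x, ⟨hi, hj⟩⟩)) :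
    ∃ z : (endComplex nab).Z1 𝔘,
      (∀ i j (x : X.Pt) (hi : x ∈ 𝔘 i) (hj : x ∈ 𝔘 j), transEnd z hi hj = a i j ⟨x, ⟨hi, hj⟩⟩) ∧
      ∀ i x, conForm z i x = A i x := by
  refine ⟨⟨(fun i j => ⟨a i j, ha i j⟩, fun i => ⟨A i, hA i⟩), ?_⟩, fun _ _ _ _ _ => rfl,
    fun _ _ => rfl⟩
  refine AddMonoidHom.mem_ker.2 (Prod.ext (funext fun i => funext fun j => funext fun l =>
    Subtype.ext (funext fun x => ?_)) (funext fun i => funext fun j =>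
    Subtype.ext (funext fun x => ?_)))
  · change a j l ⟨x.1, ⟨x.2.1.2, x.2.2⟩⟩ - a i l ⟨x.1, ⟨x.2.1.1, x.2.2⟩⟩ +
      a i j ⟨x.1, ⟨x.2.1.1, x.2.1.2⟩⟩ = 0
    rw [haa i j l x.1 x.2.1.1 x.2.1.2 x.2.2]
    abel
  · change A j ⟨x.1, x.2.2⟩ - A i ⟨x.1, x.2.1⟩ - nablaEndMap nab x.1 (a i j ⟨x.1, x.2⟩) = 0
    rw [haA i j x.1 x.2.1 x.2.2]
    abel

/-- Two cocycles are cohomologous if and only if they differ by `(ďh, ∇_End h)`. -/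
lemma cechH1_mk_eq_mk_iff (z z' : (endComplex nab).Z1 𝔘) :
    (QuotientAddGroup.mk z : (endComplex nab).cechH1 𝔘) = QuotientAddGroup.mk z' ↔
    ∃ h : ∀ i, ∀ x : 𝔘 i, E.Stalk x.1 →ₗ[X.Stalk x.1] E.Stalk x.1,
      (∀ i, h i ∈ E.endSheaf.sec (𝔘 i)) ∧
      (∀ i j (x : X.Pt) (hi : x ∈ 𝔘 i) (hj : x ∈ 𝔘 j),
        h i ⟨x, hi⟩ + transEnd z' hi hj = transEnd z hi hj + h j ⟨x, hj⟩) ∧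
      ∀ i x, conForm z' i x = conForm z i x + nablaEndMap nab x.1 (h i x) := by
  rw [QuotientAddGroup.eq, AddSubgroup.mem_addSubgroupOf]
  constructor
  · rintro ⟨h, hh⟩
    refine ⟨fun i => (h i).1, fun i => (h i).2, fun i j x hi hj => ?_, fun i x => ?_⟩
    · let hi' : E.Stalk x →ₗ[X.Stalk x] E.Stalk x := (h i).1 ⟨x, hi⟩
      let hj' : E.Stalk x →ₗ[X.Stalk x] E.Stalk x := (h j).1 ⟨x, hj⟩
      have h1 : hj' - hi' = -transEnd z hi hj + transEnd z' hi hj :=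
        congrFun (congrArg Subtype.val (congrFun (congrFun (congrArg Prod.fst hh) i) j))
          ⟨x, ⟨hi, hj⟩⟩
      change hi' + transEnd z' hi hj = transEnd z hi hj + hj'
      rw [sub_eq_iff_eq_add.1 h1]
      abel
    · have h1 : nablaEndMap nab x.1 ((h i).1 x) = -conForm z i x + conForm z' i x :=
        congrFun (congrArg Subtype.val (congrFun (congrArg Prod.snd hh) i)) x
      rw [h1]; abel
  · rintro ⟨h, hs, h1, h2⟩
    refine ⟨fun i => ⟨h i, hs i⟩, Prod.ext (funext fun i => funext fun j =>
      Subtype.ext (funext fun x => ?_)) (funext fun i => Subtype.ext (funext fun x => ?_))⟩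
    · change h j ⟨x.1, x.2.2⟩ - h i ⟨x.1, x.2.1⟩ = -transEnd z x.2.1 x.2.2 + transEnd z' x.2.1 x.2.2
      have := h1 i j x.1 x.2.1 x.2.2
      rw [← sub_eq_zero] at this ⊢
      rw [← neg_eq_zero, ← this]
      abel
    · change nablaEndMap nab x.1 (h i x) = -conForm z i x + conForm z' i x
      rw [h2]; abel

end Cocycles

/-! ### Splittings of deformations -/

namespace FirstOrderDeformation

variable (F : FirstOrderDeformation nab)

/-- The projection `F_x → E_x` on stalks. -/
abbrev pr (x : X.Pt) : F.bundle.Stalk x →ₗ[X.Stalk x] E.Stalk x := OModule.stalkMap F.proj x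

/-- The action of `ε` on stalks. -/
abbrev ep (x : X.Pt) : F.bundle.Stalk x →ₗ[X.Stalk x] F.bundle.Stalk x :=
  OModule.stalkMap F.eps x

lemma ep_ep (x : X.Pt) (t : F.bundle.Stalk x) : F.ep x (F.ep x t) = 0 := by
  rw [← LinearMap.comp_apply, ← OModule.stalkMap_comp, F.eps_sq, OModule.stalkMap_zero]
  rfl

lemma pr_ep (x : X.Pt) (t : F.bundle.Stalk x) : F.pr x (F.ep x t) = 0 := by
  have : F.ep x t ∈ LinearMap.ker (F.pr x) := by rw [F.proj_ker]; exact ⟨t, rfl⟩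
  exact this

lemma exists_ep_of_pr_eq_zero {x : X.Pt} {t : F.bundle.Stalk x} (h : F.pr x t = 0) :
    ∃ r, F.ep x r = t := by
  have : t ∈ LinearMap.ker (F.pr x) := h
  rw [F.proj_ker] at this
  exact this

lemma ep_eq_of_pr_eq {x : X.Pt} {t t' : F.bundle.Stalk x} (h : F.pr x t = F.pr x t') :
    F.ep x t = F.ep x t' := by
  obtain ⟨r, hr⟩ := F.exists_ep_of_pr_eq_zero (t := t - t') (by rw [map_sub, h, sub_self])
  rw [← sub_eq_zero, ← map_sub, ← hr, F.ep_ep]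

/-- Since the bundle is locally free over `𝒪_X[ε]`, the kernel of `ε` is the image of `ε`, that is
the kernel of the projection. -/
lemma pr_eq_zero_of_ep_eq_zero {x : X.Pt} {t : F.bundle.Stalk x} (h : F.ep x t = 0) :
    F.pr x t = 0 := by
  obtain ⟨U, hU, n, e, he⟩ := F.locallyFree x
  obtain ⟨V, hV, s, rfl⟩ := F.bundle.exists_germ t
  have h1 : F.bundle.germ (⟨x, hV⟩ : V) (OModule.app F.eps V s) =
      F.bundle.germ (⟨x, hV⟩ : V) 0 := by
    rw [map_zero, ← h]
    exact (OModule.stalkMap_germ F.eps (⟨x, hV⟩ : V) s).symm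
  obtain ⟨W, hW, h₁, h₂, h2⟩ := F.bundle.exists_germ_eq_of_germ_eq hV hV h1
  let Q : Opens X.Pt := W ⊓ U
  have hQ : x ∈ Q := ⟨hW, hU⟩
  have hQV : Q ≤ V := inf_le_left.trans h₁
  obtain ⟨c, hc, -⟩ := he Q inf_le_right (F.bundle.res hQV s)
  have app_app : ∀ r : F.bundle.Sec Q, OModule.app F.eps Q (OModule.app F.eps Q r) = 0 := fun r =>
    F.bundle.germ_injective fun y => by
      rw [← OModule.stalkMap_germ, ← OModule.stalkMap_germ, map_zero]
      exact F.ep_ep _ _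
  have h3 : OModule.app F.eps Q (F.bundle.res hQV s) = 0 := F.bundle.germ_injective fun y => by
    have h4 := h2 ⟨y.1, y.2.1⟩
    rw [map_zero, ← OModule.stalkMap_germ] at h4
    rw [map_zero, ← OModule.stalkMap_germ, F.bundle.germ_res]
    exact h4
  have zero_smul' : ∀ r : F.bundle.Sec Q, (0 : X.Sec Q) • r = 0 := fun r => zero_smul _ r
  rw [hc, map_sum] at h3
  simp only [map_add, map_smul, app_app, smul_zero, add_zero] at h3
  have h5 := (he Q inf_le_right 0).unique
    (y₁ := (0, c.1)) (y₂ := (0, 0)) (by simp only [Pi.zero_apply, zero_smul', zero_add, h3])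
    (by simp only [Pi.zero_apply, zero_smul', zero_add, Finset.sum_const_zero])
  have h6 : c.1 = 0 := congrArg Prod.snd h5
  rw [h6] at hc
  have h7 : F.bundle.res hQV s = OModule.app F.eps Q
      (∑ i, c.2 i • F.bundle.res inf_le_right (e i)) := by
    rw [hc, map_sum]
    simp only [Pi.zero_apply, zero_smul', zero_add, map_smul]
  rw [← F.bundle.germ_res hQV s ⟨x, hQ⟩, h7, ← OModule.stalkMap_germ F.eps (⟨x, hQ⟩ : Q)]
  exact F.pr_ep x _

/-- An `𝒪_X`-linear splitting over `U` of the projection of a deformation to `E`. -/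
def IsSplitting {U : Opens X.Pt} (σ : ∀ x : U, E.Stalk x.1 →ₗ[X.Stalk x.1] F.bundle.Stalk x.1) :
    Prop :=
  σ ∈ (E.germSheaf.hom F.bundle.germSheaf).sec U ∧ ∀ x s, F.pr x.1 (σ x s) = s

variable {F}

/-- A splitting `σ` identifies `F.bundle` with `E ⊕ εE`; the map `ρ` is the second coordinate. -/
lemma IsSplitting.exists_retraction {U : Opens X.Pt}
    {σ : ∀ x : U, E.Stalk x.1 →ₗ[X.Stalk x.1] F.bundle.Stalk x.1} (hσ : F.IsSplitting σ) :
    ∃ ρ : ∀ x : U, F.bundle.Stalk x.1 →ₗ[X.Stalk x.1] E.Stalk x.1,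
      ρ ∈ (F.bundle.germSheaf.hom E.germSheaf).sec U ∧
      (∀ x t, t = σ x (F.pr x.1 t) + F.ep x.1 (σ x (ρ x t))) ∧
      (∀ x t r r', t = σ x r + F.ep x.1 (σ x r') → ρ x t = r') := by
  have ex : ∀ (x : U) (t : F.bundle.Stalk x.1), ∃ r : E.Stalk x.1,
      t = σ x (F.pr x.1 t) + F.ep x.1 (σ x r) := by
    intro x t
    obtain ⟨u, hu⟩ := F.exists_ep_of_pr_eq_zero (t := t - σ x (F.pr x.1 t))
      (by rw [map_sub, hσ.2, sub_self])
    refine ⟨F.pr x.1 u, ?_⟩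
    rw [F.ep_eq_of_pr_eq (t' := u) (hσ.2 x _), hu, add_sub_cancel]
  have uniq : ∀ (x : U) (t : F.bundle.Stalk x.1) (r₁ r₂ r₁' r₂' : E.Stalk x.1),
      t = σ x r₁ + F.ep x.1 (σ x r₁') → t = σ x r₂ + F.ep x.1 (σ x r₂') → r₁' = r₂' := by
    intro x t r₁ r₂ r₁' r₂' h₁ h₂
    have h3 : r₁ = r₂ := by
      have := congrArg (F.pr x.1) (h₁.symm.trans h₂)
      simpa only [map_add, hσ.2, F.pr_ep, add_zero] using this
    rw [h₂, h3, add_right_inj, ← sub_eq_zero, ← map_sub, ← map_sub] at h₁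
    have h4 := F.pr_eq_zero_of_ep_eq_zero h₁
    rw [hσ.2, sub_eq_zero] at h4
    exact h4.symm
  choose ρ hρ using ex
  refine ⟨fun x => ⟨⟨ρ x, fun s t => ?_⟩, fun f t => ?_⟩, ?_, hρ,
    fun x t r r' h => uniq x t _ _ _ _ (hρ x t) h⟩
  · refine uniq x (s + t) _ (F.pr x.1 s + F.pr x.1 t) _ _ (hρ x _) ?_
    conv_lhs => rw [hρ x s, hρ x t]
    simp only [map_add]
    abel
  · refine uniq x (f • t) _ (f • F.pr x.1 t) _ _ (hρ x _) ?_
    conv_lhs => rw [hρ x t]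
    simp only [map_smul, RingHom.id_apply, smul_add]
  · intro V hV (t : ∀ y : V, F.bundle.Stalk y.1) ht
    refine E.sec_of_locally fun y => ?_
    -- near `y`, the section `t - σ (pr t)` is of the form `ε u` for a section `u`
    obtain ⟨u, hu⟩ := F.exists_ep_of_pr_eq_zero
      (t := t y - σ ⟨y.1, hV y.2⟩ (F.pr y.1 (t y))) (by rw [map_sub, hσ.2 ⟨y.1, hV y.2⟩, sub_self])
    obtain ⟨W, hyW, s, hs, rfl⟩ := F.bundle.exists_sec_through u
    have hW : W ⊓ V ≤ W := inf_le_left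
    have h1 := OModule.stalkMap_sec F.eps (F.bundle.sec_res hW hs)
    have h2 := F.bundle.sec_res (inf_le_right : W ⊓ V ≤ V) ht
    have h3 := OModule.sec_hom (inf_le_right.trans hV) hσ.1 (OModule.stalkMap_sec F.proj h2)
    let O : Opens X.Pt := W ⊓ V
    let f₁ : ∀ q : O, F.bundle.Stalk q.1 := fun q => F.ep q.1 (s ⟨q.1, q.2.1⟩)
    let f₂ : ∀ q : O, F.bundle.Stalk q.1 := fun q => t ⟨q.1, q.2.2⟩ -
      σ ⟨q.1, hV q.2.2⟩ (F.pr q.1 (t ⟨q.1, q.2.2⟩))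
    have h4 : f₂ ∈ F.bundle.germSheaf.sec O := F.bundle.sec_sub h2 h3
    have h5 : f₁ ⟨y.1, ⟨hyW, y.2⟩⟩ = f₂ ⟨y.1, ⟨hyW, y.2⟩⟩ := hu
    have h6 := F.bundle.eq_near_of_eq (s := f₁) h1 h4 h5
    have hf₁ : ∀ q, f₁ q = F.ep q.1 (s ⟨q.1, q.2.1⟩) := fun _ => rfl
    have hf₂ : ∀ q, f₂ q = t ⟨q.1, q.2.2⟩ - σ ⟨q.1, hV q.2.2⟩ (F.pr q.1 (t ⟨q.1, q.2.2⟩)) :=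
      fun _ => rfl
    clear_value f₁ f₂
    obtain ⟨Q, hQ, hyQ, h7⟩ := h6
    refine ⟨Q, hQ.trans inf_le_right, hyQ, ?_⟩
    refine E.sec_congr (fun q => ?_)
      (OModule.stalkMap_sec F.proj (F.bundle.sec_res (hQ.trans hW) hs))
    refine uniq ⟨q.1, hV (hQ q.2).2⟩ (t ⟨q.1, (hQ q.2).2⟩) (F.pr q.1 (t ⟨q.1, (hQ q.2).2⟩))
      (F.pr q.1 (t ⟨q.1, (hQ q.2).2⟩)) _ _ (hρ ⟨q.1, hV (hQ q.2).2⟩ (t ⟨q.1, (hQ q.2).2⟩)) ?_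
    have h8 := h7 q
    rw [hf₁, hf₂] at h8
    rw [F.ep_eq_of_pr_eq (hσ.2 ⟨q.1, hV (hQ q.2).2⟩ _), h8, add_sub_cancel]

/-! ### The connection in terms of a splitting -/

section Pointwise

variable {F : FirstOrderDeformation nab} {x : X.Pt}
  {σ σ' : E.Stalk x →ₗ[X.Stalk x] F.bundle.Stalk x}

lemma ep_comp_eq (h : ∀ s, F.pr x (σ s) = s) (h' : ∀ s, F.pr x (σ' s) = s) :
    F.ep x ∘ₗ σ = F.ep x ∘ₗ σ' :=
  LinearMap.ext fun s => F.ep_eq_of_pr_eq ((h s).trans (h' s).symm)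

lemma ep_comp_comp_pr (h : ∀ s, F.pr x (σ s) = s) : (F.ep x ∘ₗ σ) ∘ₗ F.pr x = F.ep x :=
  LinearMap.ext fun _ => F.ep_eq_of_pr_eq (h _)

/-- On `ε F` the connection is determined by `∇`, since `ε` factors through the projection. -/
lemma nabla_ep (h : ∀ s, F.pr x (σ s) = s) (t : F.bundle.Stalk x) :
    F.conn.nabla x (F.ep x t) = formsMap D (F.ep x ∘ₗ σ) (nab.nabla x (F.pr x t)) := by
  rw [F.conn_eps, F.proj_conn, formsMap_comp_apply, ep_comp_comp_pr h]

/-- Changing a splitting by `h` changes the connection form by `∇_End h`. -/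
lemma nabla_splitting_change (hσ : ∀ s, F.pr x (σ s) = s)
    {A : E.Stalk x →ₗ[X.Stalk x] (E.formsIn D).fiber x}
    (hA : ∀ s, F.conn.nabla x (σ s) =
      formsMap D σ (nab.nabla x s) + formsMap D (F.ep x ∘ₗ σ) (A s))
    {h : E.Stalk x →ₗ[X.Stalk x] E.Stalk x} (hσ' : σ' = σ + F.ep x ∘ₗ σ ∘ₗ h) (s : E.Stalk x) :
    F.conn.nabla x (σ' s) = formsMap D σ' (nab.nabla x s) +
      formsMap D (F.ep x ∘ₗ σ') ((A + nablaEndMap nab x h) s) := by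
  have h1 : ∀ s, F.pr x (σ' s) = s := fun s => by
    rw [hσ']
    change F.pr x (σ s + F.ep x (σ (h s))) = s
    rw [map_add, F.pr_ep, hσ, add_zero]
  have h2 : F.conn.nabla x (σ' s) = F.conn.nabla x (σ s) + F.conn.nabla x (F.ep x (σ (h s))) := by
    rw [hσ', ← map_add]
    rfl
  rw [h2, hA, nabla_ep hσ, hσ, ep_comp_eq h1 hσ, hσ', ← LinearMap.comp_assoc, formsMap_add,
    ← formsMap_comp_apply D h (F.ep x ∘ₗ σ), LinearMap.add_apply, map_add, nablaEndMap_apply,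
    map_sub]
  abel

lemma formsMap_ep_comp_injective
    {ρ : F.bundle.Stalk x →ₗ[X.Stalk x] E.Stalk x}
    (hρ : ∀ t r r', t = σ r + F.ep x (σ r') → ρ t = r') :
    Function.Injective (formsMap D (F.ep x ∘ₗ σ)) :=
  formsMap_injective_of_leftInverse D (ψ := ρ) <| LinearMap.ext fun s =>
    hρ _ 0 s (by rw [map_zero, zero_add]; rfl)

/-- The connection form relative to a splitting is unique. -/
lemma form_unique {ρ : F.bundle.Stalk x →ₗ[X.Stalk x] E.Stalk x}
    (hρ : ∀ t r r', t = σ r + F.ep x (σ r') → ρ t = r')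
    {A A' : E.Stalk x →ₗ[X.Stalk x] (E.formsIn D).fiber x}
    (hA : ∀ s, F.conn.nabla x (σ s) =
      formsMap D σ (nab.nabla x s) + formsMap D (F.ep x ∘ₗ σ) (A s))
    (hA' : ∀ s, F.conn.nabla x (σ s) =
      formsMap D σ (nab.nabla x s) + formsMap D (F.ep x ∘ₗ σ) (A' s)) : A = A' :=
  LinearMap.ext fun s => formsMap_ep_comp_injective hρ <|
    add_left_cancel ((hA s).symm.trans (hA' s))

/-- The connection form relative to a splitting. -/
lemma exists_form (hσ : ∀ s, F.pr x (σ s) = s) {ρ : F.bundle.Stalk x →ₗ[X.Stalk x] E.Stalk x}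
    (hρ : ∀ t, t = σ (F.pr x t) + F.ep x (σ (ρ t))) (hρσ : ∀ s, ρ (σ s) = 0) :
    ∃ A : E.Stalk x →ₗ[X.Stalk x] (E.formsIn D).fiber x,
      (∀ s, A s = formsMap D ρ (F.conn.nabla x (σ s))) ∧
      ∀ s, F.conn.nabla x (σ s) =
        formsMap D σ (nab.nabla x s) + formsMap D (F.ep x ∘ₗ σ) (A s) := by
  refine ⟨⟨⟨fun s => formsMap D ρ (F.conn.nabla x (σ s)), fun s t => ?_⟩, fun f s => ?_⟩,
    fun _ => rfl, fun s => ?_⟩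
  · rw [map_add, map_add, map_add]
  · change formsMap D ρ (F.conn.nabla x (σ (f • s))) = f • formsMap D ρ (F.conn.nabla x (σ s))
    rw [map_smul, F.conn.leibniz, map_add, formsMap_tmulForm, hρσ, map_smul,
      tmulForm_zero, add_zero]
  · have h1 : LinearMap.id = σ ∘ₗ F.pr x + (F.ep x ∘ₗ σ) ∘ₗ ρ := LinearMap.ext hρ
    have h2 := formsMap_id (D := D) F.bundle x (F.conn.nabla x (σ s))
    rw [h1, formsMap_add, ← formsMap_comp_apply, ← formsMap_comp_apply, ← F.proj_conn, hσ] at h2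
    exact h2.symm

end Pointwise

section Cech

variable {ι : Type u} {𝔘 : ι → Opens X.Pt}

/-- The splittings `σ` exhibit the deformation `F` as given by the cocycle `z`. -/
structure GivenBySplittings (F : FirstOrderDeformation nab) (z : (endComplex nab).Z1 𝔘)
    (σ : ∀ i, ∀ x : 𝔘 i, E.Stalk x.1 →ₗ[X.Stalk x.1] F.bundle.Stalk x.1) : Prop where
  splitting : ∀ i, F.IsSplitting (σ i)
  transition : ∀ i j (x : X.Pt) (hi : x ∈ 𝔘 i) (hj : x ∈ 𝔘 j),
    σ j ⟨x, hj⟩ = σ i ⟨x, hi⟩ + F.ep x ∘ₗ σ i ⟨x, hi⟩ ∘ₗ transEnd z hi hj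
  nabla : ∀ i (x : 𝔘 i) (s : E.Stalk x.1), F.conn.nabla x.1 (σ i x s) =
    formsMap D (σ i x) (nab.nabla x.1 s) + formsMap D (F.ep x.1 ∘ₗ σ i x) (conForm z i x s)

lemma isGivenBy_iff {F : FirstOrderDeformation nab} {z : (endComplex nab).Z1 𝔘} :
    F.IsGivenBy 𝔘 z ↔ ∃ σ, F.GivenBySplittings z σ := by
  constructor
  · rintro ⟨σ, h1, h2, h3, h4⟩
    exact ⟨σ, fun i => ⟨h1 i, h2 i⟩, fun i j x hi hj => LinearMap.ext (h3 i j x hi hj), h4⟩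
  · rintro ⟨σ, h1, h3, h4⟩
    exact ⟨σ, fun i => (h1 i).1, fun i => (h1 i).2,
      fun i j x hi hj s => LinearMap.congr_fun (h3 i j x hi hj) s, h4⟩

/-- Splittings over the members of a covering determine a cocycle. -/
lemma exists_givenBySplittings {F : FirstOrderDeformation nab}
    {σ : ∀ i, ∀ x : 𝔘 i, E.Stalk x.1 →ₗ[X.Stalk x.1] F.bundle.Stalk x.1}
    (hσ : ∀ i, F.IsSplitting (σ i)) : ∃ z : (endComplex nab).Z1 𝔘, F.GivenBySplittings z σ := by
  choose ρ hρs hρ hρu using fun i => (hσ i).exists_retraction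
  choose A hA hAn using fun i (x : 𝔘 i) => exists_form ((hσ i).2 x) (hρ i x) fun s =>
    hρu i x _ s 0 (by rw [map_zero, map_zero, add_zero])
  have trans : ∀ i j (x : X.Pt) (hi : x ∈ 𝔘 i) (hj : x ∈ 𝔘 j),
      σ j ⟨x, hj⟩ = σ i ⟨x, hi⟩ +
        F.ep x ∘ₗ σ i ⟨x, hi⟩ ∘ₗ (ρ i ⟨x, hi⟩ ∘ₗ σ j ⟨x, hj⟩) := by
    intro i j x hi hj
    refine LinearMap.ext fun s => ?_
    have := hρ i ⟨x, hi⟩ (σ j ⟨x, hj⟩ s)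
    rw [(hσ j).2 ⟨x, hj⟩] at this
    exact this
  obtain ⟨z, hz, hz'⟩ := exists_endComplex_cocycle (nab := nab) (𝔘 := 𝔘)
    (fun i j x => ρ i ⟨x.1, x.2.1⟩ ∘ₗ σ j ⟨x.1, x.2.2⟩) A
    (fun i j V hV s hs => hρs i V (hV.trans inf_le_left) _
      ((hσ j).1 V (hV.trans inf_le_right) s hs))
    (fun i V hV s hs => by
      have h1 := F.conn.map_sec V _ ((hσ i).1 V hV s hs)
      have h2 := formsMap_sec D (fun x : V => ρ i ⟨x.1, hV x.2⟩)
        ((F.bundle.germSheaf.hom E.germSheaf).res_mem _ V hV _ (hρs i)) _ h1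
      exact (congrArg (· ∈ (E.formsIn D).sec V) (funext fun x => hA i ⟨x.1, hV x.2⟩ (s x))).mpr h2)
    (fun i j l x hi hj hl => LinearMap.ext fun s => by
      change ρ i ⟨x, hi⟩ (σ l ⟨x, hl⟩ s) =
        ρ i ⟨x, hi⟩ (σ j ⟨x, hj⟩ s) + ρ j ⟨x, hj⟩ (σ l ⟨x, hl⟩ s)
      refine hρu i ⟨x, hi⟩ _ s _ ?_
      have h1 := LinearMap.congr_fun (trans j l x hj hl) s
      have h2 := LinearMap.congr_fun (trans i j x hi hj) s
      simp only [LinearMap.add_apply, LinearMap.comp_apply] at h1 h2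
      refine h1.trans ?_
      rw [map_add, map_add, ← add_assoc, ← h2]
      congr 1
      exact F.ep_eq_of_pr_eq (((hσ j).2 ⟨x, hj⟩ _).trans ((hσ i).2 ⟨x, hi⟩ _).symm))
    (fun i j x hi hj => form_unique (hρu j ⟨x, hj⟩) (hAn j ⟨x, hj⟩)
      (nabla_splitting_change ((hσ i).2 ⟨x, hi⟩) (hAn i ⟨x, hi⟩) (trans i j x hi hj)))
  refine ⟨z, hσ, fun i j x hi hj => ?_, fun i x s => ?_⟩
  · rw [hz]
    exact trans i j x hi hj
  · rw [hz']
    exact hAn i x s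

/-- Cocycles that give the same deformation are cohomologous. -/
lemma mk_eq_mk_of_isGivenBy {F : FirstOrderDeformation nab} {z z' : (endComplex nab).Z1 𝔘}
    (hz : F.IsGivenBy 𝔘 z) (hz' : F.IsGivenBy 𝔘 z') :
    (QuotientAddGroup.mk z : (endComplex nab).cechH1 𝔘) = QuotientAddGroup.mk z' := by
  obtain ⟨σ, hσ⟩ := isGivenBy_iff.1 hz
  obtain ⟨σ', hσ'⟩ := isGivenBy_iff.1 hz'
  choose ρ hρs hρ hρu using fun i => (hσ.splitting i).exists_retraction
  choose ρ' hρs' hρ' hρu' using fun i => (hσ'.splitting i).exists_retraction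
  have change_eq : ∀ i x, σ' i x = σ i x + F.ep x.1 ∘ₗ σ i x ∘ₗ (ρ i x ∘ₗ σ' i x) := by
    intro i x
    refine LinearMap.ext fun s => ?_
    have := hρ i x (σ' i x s)
    rw [(hσ'.splitting i).2 x] at this
    exact this
  refine (cechH1_mk_eq_mk_iff z z').2 ⟨fun i x => ρ i x ∘ₗ σ' i x,
    fun i V hV s hs => hρs i V hV _ ((hσ'.splitting i).1 V hV s hs),
    fun i j x hi hj => LinearMap.ext fun s => ?_,
    fun i x => form_unique (hρu' i x) (hσ'.nabla i x)
      (nabla_splitting_change ((hσ.splitting i).2 x) (hσ.nabla i x) (change_eq i x))⟩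
  have h1 := LinearMap.congr_fun (hσ'.transition i j x hi hj) s
  have h2 := LinearMap.congr_fun (hσ.transition i j x hi hj) s
  have h3 := LinearMap.congr_fun (change_eq j ⟨x, hj⟩) s
  have h4 := LinearMap.congr_fun (change_eq i ⟨x, hi⟩) s
  have h5 : ∀ r, F.ep x (σ' i ⟨x, hi⟩ r) = F.ep x (σ i ⟨x, hi⟩ r) := fun r =>
    F.ep_eq_of_pr_eq (((hσ'.splitting i).2 ⟨x, hi⟩ _).trans ((hσ.splitting i).2 ⟨x, hi⟩ _).symm)
  have h6 : ∀ r, F.ep x (σ j ⟨x, hj⟩ r) = F.ep x (σ i ⟨x, hi⟩ r) := fun r =>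
    F.ep_eq_of_pr_eq (((hσ.splitting j).2 ⟨x, hj⟩ _).trans ((hσ.splitting i).2 ⟨x, hi⟩ _).symm)
  simp only [LinearMap.add_apply, LinearMap.comp_apply] at h1 h2 h3 h4 ⊢
  refine (hρu i ⟨x, hi⟩ (σ' j ⟨x, hj⟩ s) s _ ?_).symm.trans
    (hρu i ⟨x, hi⟩ (σ' j ⟨x, hj⟩ s) s _ ?_)
  · rw [h1, h5, map_add, map_add, ← add_assoc, ← h4]
  · rw [map_add, map_add, ← add_assoc, ← h2, ← h6]
    exact h3

/-- A deformation given by a cocycle is given by every cohomologous cocycle. -/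
lemma IsGivenBy.of_mk_eq_mk {F : FirstOrderDeformation nab} {z z' : (endComplex nab).Z1 𝔘}
    (hz : F.IsGivenBy 𝔘 z)
    (h : (QuotientAddGroup.mk z : (endComplex nab).cechH1 𝔘) = QuotientAddGroup.mk z') :
    F.IsGivenBy 𝔘 z' := by
  obtain ⟨σ, hσ⟩ := isGivenBy_iff.1 hz
  obtain ⟨h, hs, h1, h2⟩ := (cechH1_mk_eq_mk_iff z z').1 h
  refine isGivenBy_iff.2 ⟨fun i x => σ i x + F.ep x.1 ∘ₗ σ i x ∘ₗ h i x,
    fun i => ⟨fun V hV s hsec => ?_, fun x s => ?_⟩, fun i j x hi hj => LinearMap.ext fun s => ?_,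
    fun i x s => ?_⟩
  · exact F.bundle.sec_add ((hσ.splitting i).1 V hV s hsec) (OModule.stalkMap_sec F.eps
      ((hσ.splitting i).1 V hV _ (hs i V hV s hsec)))
  · change F.pr x.1 (σ i x s + F.ep x.1 (σ i x (h i x s))) = s
    rw [map_add, F.pr_ep, (hσ.splitting i).2, add_zero]
  · have h3 := LinearMap.congr_fun (hσ.transition i j x hi hj) s
    have h4 := congrArg (fun r => F.ep x (σ i ⟨x, hi⟩ r)) (LinearMap.congr_fun (h1 i j x hi hj) s)
    have h6 : ∀ r, F.ep x (σ j ⟨x, hj⟩ r) = F.ep x (σ i ⟨x, hi⟩ r) := fun r =>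
      F.ep_eq_of_pr_eq (((hσ.splitting j).2 ⟨x, hj⟩ _).trans ((hσ.splitting i).2 ⟨x, hi⟩ _).symm)
    simp only [LinearMap.add_apply, LinearMap.comp_apply, map_add, F.ep_ep, add_zero] at h3 h4 ⊢
    rw [h3, h6, add_assoc, ← h4, add_assoc]
  · rw [h2]
    exact nabla_splitting_change ((hσ.splitting i).2 x) (hσ.nabla i x) rfl s

/-- A deformation given by a cocycle is given by its restriction to a refinement. -/
lemma IsGivenBy.refine {F : FirstOrderDeformation nab} {z : (endComplex nab).Z1 𝔘}
    (hz : F.IsGivenBy 𝔘 z) {κ : Type u} {𝔙 : κ → Opens X.Pt} (τ : κ → ι)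
    (hτ : ∀ i, 𝔙 i ≤ 𝔘 (τ i)) : F.IsGivenBy 𝔙 ((endComplex nab).refineZ1 τ hτ z) := by
  obtain ⟨σ, hs, hp, ht, hn⟩ := hz
  exact ⟨fun i x => σ (τ i) ⟨x.1, hτ i x.2⟩,
    fun i => (E.germSheaf.hom F.bundle.germSheaf).res_mem _ _ (hτ i) _ (hs (τ i)),
    fun i x => hp (τ i) ⟨x.1, hτ i x.2⟩,
    fun i j x hi hj => ht (τ i) (τ j) x (hτ i hi) (hτ j hj),
    fun i x => hn (τ i) ⟨x.1, hτ i x.2⟩⟩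

/-- Isomorphic deformations are given by the same cocycles. -/
lemma IsGivenBy.of_iso {F G : FirstOrderDeformation nab} (φ : Iso F G)
    {z : (endComplex nab).Z1 𝔘} (hz : F.IsGivenBy 𝔘 z) : G.IsGivenBy 𝔘 z := by
  obtain ⟨σ, hσ⟩ := isGivenBy_iff.1 hz
  have hpr : ∀ x, G.pr x ∘ₗ OModule.stalkMap φ.iso.hom x = F.pr x := fun x => by
    rw [← OModule.stalkMap_comp, φ.proj_comm]
  have hep : ∀ x, OModule.stalkMap φ.iso.hom x ∘ₗ F.ep x =
      G.ep x ∘ₗ OModule.stalkMap φ.iso.hom x := fun x => by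
    rw [← OModule.stalkMap_comp, φ.eps_comm, OModule.stalkMap_comp]
  refine isGivenBy_iff.2 ⟨fun i x => OModule.stalkMap φ.iso.hom x.1 ∘ₗ σ i x,
    fun i => ⟨fun V hV s hs => ?_, fun x s => ?_⟩, fun i j x hi hj => ?_, fun i x s => ?_⟩
  · exact OModule.stalkMap_sec φ.iso.hom ((hσ.splitting i).1 V hV s hs)
  · exact (LinearMap.congr_fun (hpr x.1) (σ i x s)).trans ((hσ.splitting i).2 x s)
  · rw [hσ.transition i j x hi hj, LinearMap.comp_add, ← LinearMap.comp_assoc, hep]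
    rfl
  · rw [LinearMap.comp_apply, φ.horizontal, hσ.nabla, map_add, formsMap_comp_apply,
      formsMap_comp_apply, ← LinearMap.comp_assoc, hep]
    rfl

end Cech
/-! ### Deformations given by the same cocycle -/

section Comparison

variable {ι : Type u} {𝔘 : ι → Opens X.Pt}

/-- Linear maps on the bundle of a deformation are determined by their values on `σ` and `εσ`. -/
lemma IsSplitting.hom_ext {F : FirstOrderDeformation nab} {U : Opens X.Pt}
    {σ : ∀ x : U, E.Stalk x.1 →ₗ[X.Stalk x.1] F.bundle.Stalk x.1} (hσ : F.IsSplitting σ) {x : U}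
    {P : Type*} [AddCommGroup P] [Module (X.Stalk x.1) P]
    {φ ψ : F.bundle.Stalk x.1 →ₗ[X.Stalk x.1] P} (h1 : ∀ s, φ (σ x s) = ψ (σ x s))
    (h2 : ∀ s, φ (F.ep x.1 (σ x s)) = ψ (F.ep x.1 (σ x s))) : φ = ψ := by
  obtain ⟨ρ, -, hρ, -⟩ := hσ.exists_retraction
  refine LinearMap.ext fun t => ?_
  rw [hρ x t, map_add, map_add, h1, h2]

/-- The morphism between deformations given by the same cocycle that matches the splittings. -/
lemma exists_comparison (τ : X.Pt → ι) (hτ : ∀ x, x ∈ 𝔘 (τ x)) {F G : FirstOrderDeformation nab}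
    {z : (endComplex nab).Z1 𝔘}
    {σ : ∀ i, ∀ x : 𝔘 i, E.Stalk x.1 →ₗ[X.Stalk x.1] F.bundle.Stalk x.1}
    {σ' : ∀ i, ∀ x : 𝔘 i, E.Stalk x.1 →ₗ[X.Stalk x.1] G.bundle.Stalk x.1}
    (hσ : F.GivenBySplittings z σ) (hσ' : G.GivenBySplittings z σ') :
    ∃ ψ : F.bundle ⟶ G.bundle, ∀ i (x : 𝔘 i) (s : E.Stalk x.1),
      OModule.stalkMap ψ x.1 (σ i x s) = σ' i x s ∧
      OModule.stalkMap ψ x.1 (F.ep x.1 (σ i x s)) = G.ep x.1 (σ' i x s) := by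
  choose ρ hρs hρ hρu using fun i => (hσ.splitting i).exists_retraction
  let φ : ∀ i, ∀ x : 𝔘 i, F.bundle.Stalk x.1 →ₗ[X.Stalk x.1] G.bundle.Stalk x.1 := fun i x =>
    σ' i x ∘ₗ F.pr x.1 + G.ep x.1 ∘ₗ σ' i x ∘ₗ ρ i x
  have hφ : ∀ i x t, φ i x t = σ' i x (F.pr x.1 t) + G.ep x.1 (σ' i x (ρ i x t)) :=
    fun _ _ _ => rfl
  have φ_eq : ∀ i j (x : X.Pt) (hi : x ∈ 𝔘 i) (hj : x ∈ 𝔘 j) t,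
      φ i ⟨x, hi⟩ t = φ j ⟨x, hj⟩ t := by
    intro i j x hi hj t
    have h1 := hσ.transition i j x hi hj
    have h2 := hσ'.transition i j x hi hj
    have h3 : F.ep x (σ j ⟨x, hj⟩ (ρ j ⟨x, hj⟩ t)) = F.ep x (σ i ⟨x, hi⟩ (ρ j ⟨x, hj⟩ t)) :=
      F.ep_eq_of_pr_eq
        (((hσ.splitting j).2 ⟨x, hj⟩ _).trans ((hσ.splitting i).2 ⟨x, hi⟩ _).symm)
    have h4 : G.ep x (σ' j ⟨x, hj⟩ (ρ j ⟨x, hj⟩ t)) = G.ep x (σ' i ⟨x, hi⟩ (ρ j ⟨x, hj⟩ t)) :=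
      G.ep_eq_of_pr_eq
        (((hσ'.splitting j).2 ⟨x, hj⟩ _).trans ((hσ'.splitting i).2 ⟨x, hi⟩ _).symm)
    have h5 : ρ i ⟨x, hi⟩ t = transEnd z hi hj (F.pr x t) + ρ j ⟨x, hj⟩ t := by
      refine hρu i ⟨x, hi⟩ t (F.pr x t) _ ?_
      have h6 := hρ j ⟨x, hj⟩ t
      rw [h3, h1] at h6
      rw [map_add, map_add, ← add_assoc]
      exact h6
    rw [hφ, hφ, h5, h4, h2, map_add, map_add, ← add_assoc]
    rfl
  have hφσ : ∀ i x s, φ i x (σ i x s) = σ' i x s := fun i x s => by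
    rw [hφ, (hσ.splitting i).2, hρu i x (σ i x s) s 0 (by rw [map_zero, map_zero, add_zero]),
      map_zero, map_zero, add_zero]
  have hφε : ∀ i x s, φ i x (F.ep x.1 (σ i x s)) = G.ep x.1 (σ' i x s) := fun i x s => by
    rw [hφ, F.pr_ep, hρu i x _ 0 s (by rw [map_zero, zero_add]), map_zero, zero_add]
  obtain ⟨ψ, hψ⟩ := OModule.exists_hom_stalkMap_eq (fun x => φ (τ x) ⟨x, hτ x⟩) (by
    intro U t ht
    refine G.bundle.sec_of_locally fun x => ?_
    let V : Opens X.Pt := U ⊓ 𝔘 (τ x.1)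
    have hV : V ≤ 𝔘 (τ x.1) := inf_le_right
    refine ⟨V, inf_le_left, ⟨x.2, hτ x.1⟩, ?_⟩
    have h1 := F.bundle.sec_res (inf_le_left : V ≤ U) ht
    have h2 := OModule.sec_hom hV (hσ'.splitting (τ x.1)).1 (OModule.stalkMap_sec F.proj h1)
    have h3 := OModule.stalkMap_sec G.eps (OModule.sec_hom hV (hσ'.splitting (τ x.1)).1
      (OModule.sec_hom hV (hρs (τ x.1)) h1))
    exact G.bundle.sec_congr (fun y =>
      φ_eq (τ y.1) (τ x.1) y.1 (hτ y.1) y.2.2 (t ⟨y.1, y.2.1⟩)) (G.bundle.sec_add h2 h3))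
  refine ⟨ψ, fun i x s => ?_⟩
  rw [hψ, φ_eq (τ x.1) i x.1 (hτ x.1) x.2, φ_eq (τ x.1) i x.1 (hτ x.1) x.2]
  exact ⟨hφσ i x s, hφε i x s⟩

/-- Deformations given by the same cocycle are isomorphic. -/
theorem nonempty_iso_of_isGivenBy (τ : X.Pt → ι) (hτ : ∀ x, x ∈ 𝔘 (τ x))
    {F G : FirstOrderDeformation nab} {z : (endComplex nab).Z1 𝔘}
    (hF : F.IsGivenBy 𝔘 z) (hG : G.IsGivenBy 𝔘 z) : Nonempty (Iso F G) := by
  obtain ⟨σ, hσ⟩ := isGivenBy_iff.1 hF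
  obtain ⟨σ', hσ'⟩ := isGivenBy_iff.1 hG
  obtain ⟨ψ, hψ⟩ := exists_comparison τ hτ hσ hσ'
  obtain ⟨ψ', hψ'⟩ := exists_comparison τ hτ hσ' hσ
  have ψσ : ∀ x s, OModule.stalkMap ψ x (σ (τ x) ⟨x, hτ x⟩ s) = σ' (τ x) ⟨x, hτ x⟩ s :=
    fun x s => (hψ (τ x) ⟨x, hτ x⟩ s).1
  have ψε : ∀ x s, OModule.stalkMap ψ x (F.ep x (σ (τ x) ⟨x, hτ x⟩ s)) =
      G.ep x (σ' (τ x) ⟨x, hτ x⟩ s) := fun x s => (hψ (τ x) ⟨x, hτ x⟩ s).2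
  have ψσ' : ∀ x s, OModule.stalkMap ψ' x (σ' (τ x) ⟨x, hτ x⟩ s) = σ (τ x) ⟨x, hτ x⟩ s :=
    fun x s => (hψ' (τ x) ⟨x, hτ x⟩ s).1
  have ψε' : ∀ x s, OModule.stalkMap ψ' x (G.ep x (σ' (τ x) ⟨x, hτ x⟩ s)) =
      F.ep x (σ (τ x) ⟨x, hτ x⟩ s) := fun x s => (hψ' (τ x) ⟨x, hτ x⟩ s).2
  have pσ : ∀ x s, F.pr x (σ (τ x) ⟨x, hτ x⟩ s) = s := fun x => (hσ.splitting _).2 ⟨x, hτ x⟩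
  have pσ' : ∀ x s, G.pr x (σ' (τ x) ⟨x, hτ x⟩ s) = s := fun x => (hσ'.splitting _).2 ⟨x, hτ x⟩
  refine ⟨⟨⟨ψ, ψ', OModule.hom_ext_stalk fun x => ?_, OModule.hom_ext_stalk fun x => ?_⟩,
    OModule.hom_ext_stalk fun x => ?_, OModule.hom_ext_stalk fun x => ?_, fun x t => ?_⟩⟩
  · rw [OModule.stalkMap_comp, OModule.stalkMap_id]
    refine (hσ.splitting (τ x)).hom_ext (x := ⟨x, hτ x⟩) (fun s => ?_) fun s => ?_
    · rw [LinearMap.comp_apply, ψσ, ψσ', LinearMap.id_apply]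
    · rw [LinearMap.comp_apply, ψε, ψε', LinearMap.id_apply]
  · rw [OModule.stalkMap_comp, OModule.stalkMap_id]
    refine (hσ'.splitting (τ x)).hom_ext (x := ⟨x, hτ x⟩) (fun s => ?_) fun s => ?_
    · rw [LinearMap.comp_apply, ψσ', ψσ, LinearMap.id_apply]
    · rw [LinearMap.comp_apply, ψε', ψε, LinearMap.id_apply]
  · rw [OModule.stalkMap_comp, OModule.stalkMap_comp]
    refine (hσ.splitting (τ x)).hom_ext (x := ⟨x, hτ x⟩) (fun s => ?_) fun s => ?_
    · rw [LinearMap.comp_apply, LinearMap.comp_apply, ψε, ψσ]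
    · rw [LinearMap.comp_apply, LinearMap.comp_apply, ψε, F.ep_ep, map_zero, G.ep_ep]
  · rw [OModule.stalkMap_comp]
    refine (hσ.splitting (τ x)).hom_ext (x := ⟨x, hτ x⟩) (fun s => ?_) fun s => ?_
    · rw [LinearMap.comp_apply, ψσ, pσ, pσ']
    · rw [LinearMap.comp_apply, ψε, F.pr_ep, G.pr_ep]
  · obtain ⟨ρ, -, hρ, -⟩ := (hσ.splitting (τ x)).exists_retraction
    change G.conn.nabla x (OModule.stalkMap ψ x t) =
      formsMap D (OModule.stalkMap ψ x) (F.conn.nabla x t)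
    have h1 : OModule.stalkMap ψ x ∘ₗ σ (τ x) ⟨x, hτ x⟩ = σ' (τ x) ⟨x, hτ x⟩ :=
      LinearMap.ext (ψσ x)
    have h2 : OModule.stalkMap ψ x ∘ₗ F.ep x ∘ₗ σ (τ x) ⟨x, hτ x⟩ =
        G.ep x ∘ₗ σ' (τ x) ⟨x, hτ x⟩ := LinearMap.ext (ψε x)
    have h3 := hσ.nabla (τ x) ⟨x, hτ x⟩
    have h4 := hσ'.nabla (τ x) ⟨x, hτ x⟩
    have ht : t = σ (τ x) ⟨x, hτ x⟩ (F.pr x t) + F.ep x (σ (τ x) ⟨x, hτ x⟩ (ρ ⟨x, hτ x⟩ t)) :=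
      hρ ⟨x, hτ x⟩ t
    rw [ht, map_add, map_add, map_add, map_add, ψσ, ψε, h3, h4, nabla_ep (pσ x), nabla_ep (pσ' x),
      pσ, pσ', map_add, formsMap_comp_apply, formsMap_comp_apply, formsMap_comp_apply, h1, h2]

end Comparison

/-! ### Existence of splittings -/

section Existence

lemma _root_.OModule.res_res (M : OModule X) {U V W : Opens X.Pt} (h : V ≤ U) (h' : W ≤ V)
    (s : M.Sec U) : M.res h' (M.res h s) = M.res (h'.trans h) s :=
  M.germ_injective fun x => by rw [M.germ_res, M.germ_res, M.germ_res]

/-- Over an open set where `E` is free, lifts of a basis define a splitting. -/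
lemma exists_isSplitting_of_lifts {F : FirstOrderDeformation nab} {U : Opens X.Pt} {n : ℕ}
    {b : Fin n → E.Sec U}
    (hb : ∀ (V : Opens X.Pt) (h : V ≤ U) (s : E.Sec V),
      ∃! c : Fin n → X.Sec V, s = ∑ i, c i • E.res h (b i))
    (f : Fin n → ∀ x : U, F.bundle.Stalk x.1) (hf : ∀ i, f i ∈ F.bundle.germSheaf.sec U)
    (hfb : ∀ i x, F.pr x.1 (f i x) = E.germ x (b i)) :
    ∃ σ : ∀ x : U, E.Stalk x.1 →ₗ[X.Stalk x.1] F.bundle.Stalk x.1, F.IsSplitting σ := by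
  obtain ⟨κ, hκ, -, hκs⟩ := E.exists_coord hb
  let σ : ∀ x : U, E.Stalk x.1 →ₗ[X.Stalk x.1] F.bundle.Stalk x.1 := fun x =>
    ∑ i, (κ x i).smulRight (f i x)
  have σ_apply : ∀ x s, σ x s = ∑ i, κ x i s • f i x := fun x s => by
    rw [LinearMap.sum_apply]
    rfl
  refine ⟨σ, fun V hV s hs => ?_, fun x s => ?_⟩
  · obtain ⟨c, hc⟩ := hκs V hV s hs
    refine F.bundle.sec_congr (fun x => ?_)
      (F.bundle.sec_sum_smul c (fun i x => f i ⟨x.1, hV x.2⟩) fun i => F.bundle.sec_res hV (hf i))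
    refine (σ_apply ⟨x.1, hV x.2⟩ (s x)).trans (Finset.sum_congr rfl fun i _ => ?_)
    rw [hc]
  · rw [σ_apply, map_sum]
    conv_rhs => rw [hκ x s]
    refine Finset.sum_congr rfl fun i _ => ?_
    rw [map_smul, hfb]

/-- Deformations of a vector bundle are locally split: the members of a basis of `E` near `x` lift to
sections of the deformation. -/
lemma exists_isSplitting_near (hE : E.IsVectorBundle) (F : FirstOrderDeformation nab) (x : X.Pt) :
    ∃ (U : Opens X.Pt) (_ : x ∈ U)
      (σ : ∀ x : U, E.Stalk x.1 →ₗ[X.Stalk x.1] F.bundle.Stalk x.1), F.IsSplitting σ := by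
  obtain ⟨U, hU, n, b, hb⟩ := hE x
  choose t ht using fun i => F.proj_surjective x (E.germ (⟨x, hU⟩ : U) (b i))
  choose W hW f hf using fun i => F.bundle.exists_germ (t i)
  have near : ∀ i, ∃ (V : Opens X.Pt) (_ : x ∈ V) (h₁ : V ≤ W i) (h₂ : V ≤ U),
      ∀ y : V, E.germ (⟨y.1, h₁ y.2⟩ : W i) (OModule.app F.proj (W i) (f i)) =
        E.germ (⟨y.1, h₂ y.2⟩ : U) (b i) := fun i => by
    refine E.exists_germ_eq_of_germ_eq (hW i) hU ?_
    rw [← OModule.stalkMap_germ F.proj (⟨x, hW i⟩ : W i), hf i]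
    exact ht i
  choose V hV h₁ h₂ h using near
  obtain ⟨Q, hQ, hQV⟩ := exists_opens_le_of_finite V hV
  let O : Opens X.Pt := Q ⊓ U
  have hO : ∀ i, O ≤ V i := fun i => inf_le_left.trans (hQV i)
  refine ⟨O, ⟨hQ, hU⟩, exists_isSplitting_of_lifts (b := fun i => E.res inf_le_right (b i))
    (fun P hP s => ?_) (fun i y => F.bundle.germ (⟨y.1, h₁ i (hO i y.2)⟩ : W i) (f i))
    (fun i => F.bundle.sec_res ((hO i).trans (h₁ i)) (F.bundle.germ_mem_sec (f i)))
    fun i y => ?_⟩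
  · simp only [E.res_res]
    exact hb P _ s
  · rw [E.germ_res, ← h i ⟨y.1, hO i y.2⟩]
    exact OModule.stalkMap_germ F.proj (⟨y.1, h₁ i (hO i y.2)⟩ : W i) (f i)

/-- Over an open set with `H¹(U, 𝒪_X) = 0` where `E` is free, every deformation has a splitting:
the obstruction to gluing local lifts of the members of a basis of `E` vanishes. -/
lemma exists_isSplitting_of_isAcyclicOpen (hE : E.IsVectorBundle) (F : FirstOrderDeformation nab)
    {U : Opens X.Pt} (hU : E.IsFreeOn U) (hac : IsAcyclicOpen U) :
    ∃ σ : ∀ x : U, E.Stalk x.1 →ₗ[X.Stalk x.1] F.bundle.Stalk x.1, F.IsSplitting σ := by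
  obtain ⟨n, b, hb⟩ := hU
  obtain ⟨κ, hκ, -, hκs⟩ := E.exists_coord hb
  choose V hV σ₀ hσ₀ using fun x : U => F.exists_isSplitting_near hE x.1
  let W : U → Opens X.Pt := fun x => V x ⊓ U
  have hWU : ∀ i, W i ≤ U := fun i => inf_le_right
  have hW : ∀ i : U, i.1 ∈ W i := fun i => ⟨hV i, i.2⟩
  obtain ⟨z, hz⟩ := exists_givenBySplittings (F := F) (𝔘 := W)
    (σ := fun i x => σ₀ i ⟨x.1, x.2.1⟩) fun i =>
      ⟨(E.germSheaf.hom F.bundle.germSheaf).res_mem _ _ inf_le_left _ (hσ₀ i).1,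
        fun x => (hσ₀ i).2 ⟨x.1, x.2.1⟩⟩
  obtain ⟨σ, hσ⟩ : ∃ σ, F.GivenBySplittings z σ := ⟨_, hz⟩
  have sec_b : ∀ (O : Opens X.Pt) (h : O ≤ U) m,
      (fun x : O => E.germ (⟨x.1, h x.2⟩ : U) (b m)) ∈ E.germSheaf.sec O :=
    fun O h m => E.sec_res h (E.germ_mem_sec (b m))
  -- the matrix entries of the transition functions are cocycles of `𝒪_X`
  have coef : ∀ i j m, ∃ c : Fin n → X.Sec (W i ⊓ W j), ∀ (y : (W i ⊓ W j : Opens X.Pt)) l,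
      X.germFun y (c l) = κ ⟨y.1, y.2.1.2⟩ l
        (transEnd z y.2.1 y.2.2 (E.germ (⟨y.1, y.2.1.2⟩ : U) (b m))) := fun i j m =>
    hκs (W i ⊓ W j) (inf_le_left.trans (hWU i)) _
      (transEnd_sec z i j (W i ⊓ W j) le_rfl _
        (sec_b _ (inf_le_left.trans (hWU i)) m))
  choose c hc using coef
  have primitive : ∀ m l, ∃ β : ∀ i, X.Sec (W i), ∀ i j,
      c i j m l = X.resFun inf_le_right (β j) - X.resFun inf_le_left (β i) := by
    intro m l
    refine hac U W (le_antisymm (iSup_le hWU) fun x hx => Opens.mem_iSup.2 ⟨⟨x, hx⟩, hW _⟩)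
      (fun i j => c i j m l) fun i j p => X.germFun_injective fun y => ?_
    rw [map_add, map_sub, X.germFun_resFun, X.germFun_resFun, X.germFun_resFun, hc, hc, hc,
      map_zero, transEnd_add z y.2.1.1 y.2.1.2 y.2.2, LinearMap.add_apply, map_add]
    abel
  choose β hβ using primitive
  let f : ∀ i, Fin n → ∀ x : W i, F.bundle.Stalk x.1 := fun i m x =>
    σ i x (E.germ (⟨x.1, x.2.2⟩ : U) (b m)) -
      ∑ l, X.germFun x (β m l i) • F.ep x.1 (σ i x (E.germ (⟨x.1, x.2.2⟩ : U) (b l)))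
  have f_sec : ∀ i m, f i m ∈ F.bundle.germSheaf.sec (W i) := fun i m =>
    F.bundle.sec_sub ((hσ.splitting i).1 (W i) le_rfl _ (sec_b _ (hWU i) m))
      (F.bundle.sec_sum_smul (fun l => β m l i) _ fun l => OModule.stalkMap_sec F.eps
        ((hσ.splitting i).1 (W i) le_rfl _ (sec_b _ (hWU i) l)))
  have f_eq : ∀ i j m (x : X.Pt) (hi : x ∈ W i) (hj : x ∈ W j),
      f j m ⟨x, hj⟩ = f i m ⟨x, hi⟩ := by
    intro i j m x hi hj
    let g : Fin n → E.Stalk x := fun l => E.germ (⟨x, hi.2⟩ : U) (b l)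
    have h1 : σ j ⟨x, hj⟩ (g m) = σ i ⟨x, hi⟩ (g m) +
        F.ep x (σ i ⟨x, hi⟩ (transEnd z hi hj (g m))) :=
      LinearMap.congr_fun (hσ.transition i j x hi hj) (g m)
    have h2 : ∀ r, F.ep x (σ j ⟨x, hj⟩ r) = F.ep x (σ i ⟨x, hi⟩ r) := fun r =>
      F.ep_eq_of_pr_eq (((hσ.splitting j).2 ⟨x, hj⟩ _).trans ((hσ.splitting i).2 ⟨x, hi⟩ _).symm)
    have h3 : transEnd z hi hj (g m) = ∑ l, (X.germFun (⟨x, hj⟩ : W j) (β m l j) -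
        X.germFun (⟨x, hi⟩ : W i) (β m l i)) • g l := by
      rw [hκ ⟨x, hi.2⟩ (transEnd z hi hj (g m))]
      refine Finset.sum_congr rfl fun l _ => ?_
      have h4 := hc i j m ⟨x, ⟨hi, hj⟩⟩ l
      rw [hβ, map_sub, X.germFun_resFun, X.germFun_resFun] at h4
      rw [h4]
    change σ j ⟨x, hj⟩ (g m) - ∑ l, X.germFun (⟨x, hj⟩ : W j) (β m l j) •
        F.ep x (σ j ⟨x, hj⟩ (g l)) =
      σ i ⟨x, hi⟩ (g m) - ∑ l, X.germFun (⟨x, hi⟩ : W i) (β m l i) • F.ep x (σ i ⟨x, hi⟩ (g l))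
    rw [h1, h3]
    simp only [h2, map_sum, map_smul, map_sub, sub_smul, Finset.sum_sub_distrib]
    abel
  refine exists_isSplitting_of_lifts hb (fun m x => f x m ⟨x.1, hW x⟩) (fun m => ?_) fun m x => ?_
  · refine F.bundle.sec_of_locally fun x => ⟨W x, hWU x, hW x, ?_⟩
    exact F.bundle.sec_congr (fun y =>
      f_eq x ⟨y.1, hWU x y.2⟩ m y.1 y.2 _) (f_sec x m)
  · change F.pr x.1 (_ - ∑ l, _) = _
    rw [map_sub, map_sum, (hσ.splitting x).2 ⟨x.1, hW x⟩, sub_eq_self]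
    refine Finset.sum_eq_zero fun l _ => ?_
    rw [map_smul, F.pr_ep, smul_zero]

end Existence
/-! ### The deformation defined by a cocycle -/

section Construction

variable {ι : Type u} {𝔘 : ι → Opens X.Pt}

lemma transEnd_apply_sec (z : (endComplex nab).Z1 𝔘) {i j : ι} {V : Opens X.Pt} (hi : V ≤ 𝔘 i)
    (hj : V ≤ 𝔘 j) {s : ∀ x : V, E.Stalk x.1} (hs : s ∈ E.germSheaf.sec V) :
    (fun x : V => transEnd z (hi x.2) (hj x.2) (s x)) ∈ E.germSheaf.sec V :=
  transEnd_sec z i j V (le_inf hi hj) s hs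

/-- The sheaf obtained by gluing the sheaves `E ⊕ E` over the members of the covering `𝔘` along the
unipotent transition functions defined by the cocycle `z`. An element `(s, t)` of the fiber at `x`
stands for `s + ε t` in the trivialization over `𝔘 (τ x)`; in the trivialization over `𝔘 i` it is
`s + ε (t + a i (τ x) s)`, and this is required to be a section. -/
def twistedSheaf (z : (endComplex nab).Z1 𝔘) (τ : X.Pt → ι) (hτ : ∀ x, x ∈ 𝔘 (τ x)) :
    GermSheaf X where
  fiber x := E.Stalk x × E.Stalk x
  sec U :=
    { carrier := {p | (fun x => (p x).1) ∈ E.germSheaf.sec U ∧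
        ∀ i, (fun x : (U ⊓ 𝔘 i : Opens X.Pt) => (p ⟨x.1, x.2.1⟩).2 +
          transEnd z x.2.2 (hτ x.1) (p ⟨x.1, x.2.1⟩).1) ∈ E.germSheaf.sec (U ⊓ 𝔘 i)}
      zero_mem' := by
        refine ⟨E.sec_zero U, fun i => E.sec_congr (fun x => ?_) (E.sec_zero _)⟩
        change (0 : E.Stalk x.1) + transEnd z x.2.2 (hτ x.1) 0 = 0
        rw [map_zero, add_zero]
      add_mem' := by
        intro p q hp hq
        refine ⟨E.sec_add hp.1 hq.1, fun i =>
          E.sec_congr (fun x => ?_) (E.sec_add (hp.2 i) (hq.2 i))⟩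
        change (_ + _ : E.Stalk x.1) + transEnd z x.2.2 (hτ x.1) (_ + _) = _
        rw [map_add, add_add_add_comm]
      neg_mem' := by
        intro p hp
        refine ⟨E.sec_neg hp.1, fun i => E.sec_congr (fun x => ?_) (E.sec_neg (hp.2 i))⟩
        change (-_ : E.Stalk x.1) + transEnd z x.2.2 (hτ x.1) (-_) = -(_ + _ : E.Stalk x.1)
        rw [map_neg, neg_add] }
  smul_mem U f p hp := by
    refine ⟨E.germSheaf.smul_mem U f _ hp.1, fun i => E.sec_congr (fun x => ?_)
      (E.germSheaf.smul_mem (U ⊓ 𝔘 i) (X.resFun inf_le_left f) _ (hp.2 i))⟩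
    rw [X.germFun_resFun]
    let c : X.Stalk x.1 := X.germFun (⟨x.1, x.2.1⟩ : U) f
    let q : E.Stalk x.1 × E.Stalk x.1 := p ⟨x.1, x.2.1⟩
    change c • q.2 + transEnd z x.2.2 (hτ x.1) (c • q.1) =
      c • (q.2 + transEnd z x.2.2 (hτ x.1) q.1)
    rw [map_smul, smul_add]
  res_mem U V h p hp := ⟨E.sec_res h hp.1, fun i => E.sec_res (inf_le_inf_right _ h) (hp.2 i)⟩
  glue U p hp := by
    refine ⟨E.sec_of_locally fun x => ?_, fun i => E.sec_of_locally fun x => ?_⟩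
    · obtain ⟨V, hV, hx, h⟩ := hp x
      exact ⟨V, hV, hx, h.1⟩
    · obtain ⟨V, hV, hx, h⟩ := hp ⟨x.1, x.2.1⟩
      exact ⟨V ⊓ 𝔘 i, inf_le_inf_right _ hV, ⟨hx, x.2.2⟩, h.2 i⟩

/-- A cocycle `(a, A)` defines an extension `M` of `E` by `E`, with splittings `σ i` over the
members of the covering that differ by the `a i j`. -/
lemma exists_extension (z : (endComplex nab).Z1 𝔘) (τ : X.Pt → ι) (hτ : ∀ x, x ∈ 𝔘 (τ x)) :
    ∃ (M : OModule X) (p : M ⟶ E) (q : E ⟶ M)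
      (σ : ∀ i, ∀ x : 𝔘 i, E.Stalk x.1 →ₗ[X.Stalk x.1] M.Stalk x.1)
      (ρ : ∀ i, ∀ x : 𝔘 i, M.Stalk x.1 →ₗ[X.Stalk x.1] E.Stalk x.1),
      (∀ i, σ i ∈ (E.germSheaf.hom M.germSheaf).sec (𝔘 i)) ∧
      (∀ i, ρ i ∈ (M.germSheaf.hom E.germSheaf).sec (𝔘 i)) ∧
      (∀ x s, OModule.stalkMap p x (OModule.stalkMap q x s) = 0) ∧
      (∀ i x s, OModule.stalkMap p x.1 (σ i x s) = s) ∧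
      (∀ i x s, ρ i x (OModule.stalkMap q x.1 s) = s) ∧
      (∀ i x s, ρ i x (σ i x s) = 0) ∧
      (∀ i x t, t = σ i x (OModule.stalkMap p x.1 t) + OModule.stalkMap q x.1 (ρ i x t)) ∧
      ∀ i j (x : X.Pt) (hi : x ∈ 𝔘 i) (hj : x ∈ 𝔘 j),
        σ j ⟨x, hj⟩ = σ i ⟨x, hi⟩ + OModule.stalkMap q x ∘ₗ transEnd z hi hj := by
  obtain ⟨M, e, he⟩ := GermSheaf.exists_oModule (twistedSheaf z τ hτ) (by
    rintro x ⟨a, b⟩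
    obtain ⟨U, hU, s, hs, rfl⟩ := E.exists_sec_through a
    obtain ⟨V, hV, t, ht, rfl⟩ := E.exists_sec_through b
    let O : Opens X.Pt := U ⊓ V ⊓ 𝔘 (τ x)
    have hOU : O ≤ U := inf_le_left.trans inf_le_left
    have hOV : O ≤ V := inf_le_left.trans inf_le_right
    have hOx : O ≤ 𝔘 (τ x) := inf_le_right
    refine ⟨O, ⟨⟨hU, hV⟩, hτ x⟩, fun y => (s ⟨y.1, hOU y.2⟩,
      t ⟨y.1, hOV y.2⟩ - transEnd z (hOx y.2) (hτ y.1) (s ⟨y.1, hOU y.2⟩)),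
      ⟨E.sec_res hOU hs, fun i => ?_⟩, ?_⟩
    · have hO : O ⊓ 𝔘 i ≤ O := inf_le_left
      refine E.sec_congr (fun y => ?_)
        (E.sec_add (E.sec_res (hO.trans hOV) ht)
          (transEnd_apply_sec z (inf_le_right : O ⊓ 𝔘 i ≤ 𝔘 i) (hO.trans hOx)
            (E.sec_res (hO.trans hOU) hs)))
      change t ⟨y.1, hOV y.2.1⟩ - transEnd z (hOx y.2.1) (hτ y.1) (s ⟨y.1, hOU y.2.1⟩) +
        transEnd z y.2.2 (hτ y.1) (s ⟨y.1, hOU y.2.1⟩) = t ⟨y.1, hOV y.2.1⟩ +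
        transEnd z y.2.2 (hOx y.2.1) (s ⟨y.1, hOU y.2.1⟩)
      rw [transEnd_add z y.2.2 (hOx y.2.1) (hτ y.1), LinearMap.add_apply]
      abel
    · refine Prod.ext rfl ?_
      change t ⟨x, hV⟩ - transEnd z (hτ x) (hτ x) (s ⟨x, hU⟩) = t ⟨x, hV⟩
      rw [transEnd_self, LinearMap.zero_apply, sub_zero]) (by
    intro U p hp x hpx
    have hx1 : (p x).1 = 0 := congrArg Prod.fst hpx
    have hx2 : (p x).2 = 0 := congrArg Prod.snd hpx
    obtain ⟨V, hV, hxV, h1⟩ := E.eq_near_of_eq (x := x) hp.1 (E.sec_zero U) hx1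
    obtain ⟨W, hW, hxW, h2⟩ := E.eq_near_of_eq
      (x := (⟨x.1, ⟨x.2, hτ x.1⟩⟩ : (U ⊓ 𝔘 (τ x.1) : Opens X.Pt))) (hp.2 (τ x.1))
      (E.sec_zero _) (by
        change (p x).2 + transEnd z (hτ x.1) (hτ x.1) (p x).1 = 0
        rw [hx1, hx2, map_zero, add_zero])
    refine ⟨V ⊓ W, inf_le_left.trans hV, ⟨hxV, hxW⟩, fun y => ?_⟩
    have h3 : (p ⟨y.1, hV y.2.1⟩).1 = 0 := h1 ⟨y.1, y.2.1⟩
    have h4 : (p ⟨y.1, hV y.2.1⟩).2 +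
      transEnd z (hW y.2.2).2 (hτ y.1) (p ⟨y.1, hV y.2.1⟩).1 = 0 := h2 ⟨y.1, y.2.2⟩
    rw [h3, map_zero, add_zero] at h4
    exact Prod.ext h3 h4)
  -- the stalks of `M`, in the trivialization over `𝔘 (τ x)`
  let e' : ∀ x, M.Stalk x ≃ₗ[X.Stalk x] E.Stalk x × E.Stalk x := e
  have he' : ∀ (U : Opens X.Pt) (t : ∀ x : U, M.Stalk x.1), t ∈ M.germSheaf.sec U ↔
      (fun x : U => (e' x.1 (t x)).1) ∈ E.germSheaf.sec U ∧
        ∀ i, (fun x : (U ⊓ 𝔘 i : Opens X.Pt) => (e' x.1 (t ⟨x.1, x.2.1⟩)).2 +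
          transEnd z x.2.2 (hτ x.1) (e' x.1 (t ⟨x.1, x.2.1⟩)).1) ∈ E.germSheaf.sec (U ⊓ 𝔘 i) := he
  obtain ⟨p, hp⟩ := OModule.exists_hom_stalkMap_eq (M := M) (N := E)
    (fun x => LinearMap.fst _ _ _ ∘ₗ (e' x).toLinearMap) fun U t ht => ((he' U t).1 ht).1
  obtain ⟨q, hq⟩ := OModule.exists_hom_stalkMap_eq (M := E) (N := M)
    (fun x => (e' x).symm.toLinearMap ∘ₗ LinearMap.inr _ _ _) (by
    intro U t ht
    refine (he' U _).2 ⟨?_, fun i => ?_⟩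
    · refine E.sec_congr (fun x => ?_)
        (E.sec_zero U)
      change (e' x.1 ((e' x.1).symm (0, t x))).1 = 0
      rw [LinearEquiv.apply_symm_apply]
    · refine E.sec_congr (fun x => ?_)
        (E.sec_res inf_le_left ht)
      change (e' x.1 ((e' x.1).symm (0, t ⟨x.1, x.2.1⟩))).2 +
        transEnd z x.2.2 (hτ x.1) (e' x.1 ((e' x.1).symm (0, t ⟨x.1, x.2.1⟩))).1 = _
      rw [LinearEquiv.apply_symm_apply, map_zero, add_zero])
  have hp' : ∀ x t, OModule.stalkMap p x t = (e' x t).1 := fun x t => by rw [hp]; rfl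
  have hq' : ∀ x s, e' x (OModule.stalkMap q x s) = (0, s) := fun x s => by
    rw [hq]
    exact LinearEquiv.apply_symm_apply _ _
  let σ : ∀ i, ∀ x : 𝔘 i, E.Stalk x.1 →ₗ[X.Stalk x.1] M.Stalk x.1 := fun i x =>
    (e' x.1).symm.toLinearMap ∘ₗ LinearMap.prod LinearMap.id (transEnd z (hτ x.1) x.2)
  let ρ : ∀ i, ∀ x : 𝔘 i, M.Stalk x.1 →ₗ[X.Stalk x.1] E.Stalk x.1 := fun i x =>
    (LinearMap.snd _ _ _ + transEnd z x.2 (hτ x.1) ∘ₗ LinearMap.fst _ _ _) ∘ₗ (e' x.1).toLinearMap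
  have hσ : ∀ i x s, e' x.1 (σ i x s) = (s, transEnd z (hτ x.1) x.2 s) := fun i x s =>
    LinearEquiv.apply_symm_apply _ _
  have hρ : ∀ i x t, ρ i x t = (e' x.1 t).2 + transEnd z x.2 (hτ x.1) (e' x.1 t).1 :=
    fun _ _ _ => rfl
  have cancel : ∀ (x : X.Pt) i j (hi : x ∈ 𝔘 i) (hj : x ∈ 𝔘 j) s,
      transEnd z hi hj s + transEnd z hj hi s = 0 := fun x i j hi hj s => by
    rw [← LinearMap.add_apply, ← transEnd_add, transEnd_self, LinearMap.zero_apply]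
  refine ⟨M, p, q, σ, ρ, fun i V hV s hs => (he' V _).2 ⟨?_, fun j => ?_⟩, fun i V hV t ht => ?_,
    fun x s => ?_, fun i x s => ?_, fun i x s => ?_, fun i x s => ?_, fun i x t => ?_,
    fun i j x hi hj => LinearMap.ext fun s => ?_⟩
  · exact E.sec_congr (fun x =>
      congrArg Prod.fst (hσ i ⟨x.1, hV x.2⟩ (s x))) hs
  · refine E.sec_congr (fun x => ?_)
      (transEnd_apply_sec z (inf_le_right : V ⊓ 𝔘 j ≤ 𝔘 j) (inf_le_left.trans hV)
        (E.sec_res inf_le_left hs))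
    have h1 := hσ i ⟨x.1, hV x.2.1⟩ (s ⟨x.1, x.2.1⟩)
    have h2 := LinearMap.congr_fun (transEnd_add z x.2.2 (hτ x.1) (hV x.2.1)) (s ⟨x.1, x.2.1⟩)
    change (e' x.1 (σ i ⟨x.1, hV x.2.1⟩ (s ⟨x.1, x.2.1⟩))).2 + transEnd z x.2.2 (hτ x.1)
      (e' x.1 (σ i ⟨x.1, hV x.2.1⟩ (s ⟨x.1, x.2.1⟩))).1 = _
    rw [h1, add_comm]
    exact h2.symm
  · exact E.sec_res (le_inf le_rfl hV) (((he' V t).1 ht).2 i)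
  · rw [hp', hq']
  · rw [hp', hσ]
  · rw [hρ, hq', map_zero, add_zero]
  · rw [hρ, hσ, cancel]
  · refine (e' x.1).injective ?_
    rw [map_add, hσ, hq', hp', hρ]
    refine Prod.ext (add_zero _).symm ?_
    change (e' x.1 t).2 = transEnd z (hτ x.1) x.2 (e' x.1 t).1 +
      ((e' x.1 t).2 + transEnd z x.2 (hτ x.1) (e' x.1 t).1)
    rw [add_left_comm, cancel, add_zero]
  · refine (e' x).injective ?_
    rw [LinearMap.add_apply, map_add, hσ j ⟨x, hj⟩, hσ i ⟨x, hi⟩, LinearMap.comp_apply, hq']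
    refine Prod.ext (add_zero _).symm ?_
    exact LinearMap.congr_fun (transEnd_add z (hτ x) hi hj) s

end Construction
section Construction

variable {ι : Type u} {𝔘 : ι → Opens X.Pt}

/-- An extension of a vector bundle `E` by `E` that has a splitting over `W` is locally free over
`𝒪_X[ε]` near the points of `W`, where `ε` acts through `M → E → M`. -/
lemma exists_dualNumber_basis (hE : E.IsVectorBundle) {M : OModule X} {p : M ⟶ E} {q : E ⟶ M}
    {W : Opens X.Pt} {σ : ∀ x : W, E.Stalk x.1 →ₗ[X.Stalk x.1] M.Stalk x.1}
    {ρ : ∀ x : W, M.Stalk x.1 →ₗ[X.Stalk x.1] E.Stalk x.1}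
    (hσ : σ ∈ (E.germSheaf.hom M.germSheaf).sec W) (hρ : ρ ∈ (M.germSheaf.hom E.germSheaf).sec W)
    (hpq : ∀ x s, OModule.stalkMap p x (OModule.stalkMap q x s) = 0)
    (hpσ : ∀ x s, OModule.stalkMap p x.1 (σ x s) = s)
    (hρq : ∀ x s, ρ x (OModule.stalkMap q x.1 s) = s) (hρσ : ∀ x s, ρ x (σ x s) = 0)
    (hid : ∀ x t, t = σ x (OModule.stalkMap p x.1 t) + OModule.stalkMap q x.1 (ρ x t))
    {x : X.Pt} (hx : x ∈ W) :
    ∃ (U : Opens X.Pt) (_ : x ∈ U) (n : ℕ) (e : Fin n → M.Sec U),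
      ∀ (V : Opens X.Pt) (h : V ≤ U) (s : M.Sec V),
        ∃! c : (Fin n → X.Sec V) × (Fin n → X.Sec V),
          s = ∑ i, (c.1 i • M.res h (e i) + c.2 i • OModule.app (p ≫ q) V (M.res h (e i))) := by
  obtain ⟨U, hU, n, b, hb⟩ := hE x
  let O : Opens X.Pt := U ⊓ W
  have hOU : O ≤ U := inf_le_left
  have hOW : O ≤ W := inf_le_right
  choose e he using fun m => M.mem_sec_iff.1
    (OModule.sec_hom hOW hσ (E.sec_res hOU (E.germ_mem_sec (b m))))
  refine ⟨O, ⟨hU, hx⟩, n, e, fun V hV s => ?_⟩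
  have expand : ∀ (d₁ d₂ : Fin n → X.Sec V) (y : V),
      M.germ y (∑ i, (d₁ i • M.res hV (e i) + d₂ i • OModule.app (p ≫ q) V (M.res hV (e i)))) =
        σ ⟨y.1, hOW (hV y.2)⟩ (E.germ y (∑ i, d₁ i • E.res (hV.trans hOU) (b i))) +
        OModule.stalkMap q y.1 (E.germ y (∑ i, d₂ i • E.res (hV.trans hOU) (b i))) := by
    intro d₁ d₂ y
    rw [Finset.sum_add_distrib, map_add, M.germ_sum_smul, M.germ_sum_smul, E.germ_sum_smul,
      E.germ_sum_smul, map_sum, map_sum]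
    congr 1
    · refine Finset.sum_congr rfl fun i _ => ?_
      rw [M.germ_res, E.germ_res, ← he, map_smul]
    · refine Finset.sum_congr rfl fun i _ => ?_
      rw [← OModule.stalkMap_germ, M.germ_res, E.germ_res, ← he, map_smul, OModule.stalkMap_comp,
        LinearMap.comp_apply, hpσ ⟨y.1, hOW (hV y.2)⟩]
  obtain ⟨r, hr⟩ := E.mem_sec_iff.1 (OModule.sec_hom (hV.trans hOW) hρ (M.germ_mem_sec s))
  obtain ⟨c₁, hc₁, hu₁⟩ := hb V (hV.trans hOU) (OModule.app p V s)
  obtain ⟨c₂, hc₂, hu₂⟩ := hb V (hV.trans hOU) r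
  refine ⟨(c₁, c₂), M.germ_injective fun y => ?_, fun d hd => Prod.ext ?_ ?_⟩
  · rw [expand]
    change _ = σ ⟨y.1, hOW (hV y.2)⟩ (E.germ y (∑ i, c₁ i • E.res (hV.trans hOU) (b i))) +
      OModule.stalkMap q y.1 (E.germ y (∑ i, c₂ i • E.res (hV.trans hOU) (b i)))
    rw [← hc₁, ← hc₂, ← hr, ← OModule.stalkMap_germ]
    exact hid ⟨y.1, hOW (hV y.2)⟩ _
  · refine hu₁ _ (E.germ_injective fun y => ?_)
    have h := congrArg (fun t => OModule.stalkMap p y.1 (M.germ y t)) hd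
    simp only [expand, map_add, hpq, add_zero] at h
    rw [← OModule.stalkMap_germ, h]
    exact hpσ ⟨y.1, hOW (hV y.2)⟩ _
  · refine hu₂ _ (E.germ_injective fun y => ?_)
    have h := congrArg (fun t => ρ ⟨y.1, hOW (hV y.2)⟩ (M.germ y t)) hd
    simp only [expand, map_add, hρσ, zero_add] at h
    rw [← hr, h]
    exact hρq ⟨y.1, hOW (hV y.2)⟩ _

lemma stalkMap_hom_sec {M N : OModule X} (ψ : M ⟶ N) (U : Opens X.Pt) :
    (fun x : U => OModule.stalkMap ψ x.1) ∈ (M.germSheaf.hom N.germSheaf).sec U :=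
  fun _ _ _ hs => OModule.stalkMap_sec ψ hs

/-- The connection on an extension of `E` by `E` that is `∇ + ε A i` in the trivialization
over `𝔘 i`. -/
lemma exists_connection (z : (endComplex nab).Z1 𝔘) (τ : X.Pt → ι) (hτ : ∀ x, x ∈ 𝔘 (τ x))
    {M : OModule X} {p : M ⟶ E} {q : E ⟶ M}
    {σ : ∀ i, ∀ x : 𝔘 i, E.Stalk x.1 →ₗ[X.Stalk x.1] M.Stalk x.1}
    {ρ : ∀ i, ∀ x : 𝔘 i, M.Stalk x.1 →ₗ[X.Stalk x.1] E.Stalk x.1}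
    (hσ : ∀ i, σ i ∈ (E.germSheaf.hom M.germSheaf).sec (𝔘 i))
    (hρ : ∀ i, ρ i ∈ (M.germSheaf.hom E.germSheaf).sec (𝔘 i))
    (hρq : ∀ i x s, ρ i x (OModule.stalkMap q x.1 s) = s) (hρσ : ∀ i x s, ρ i x (σ i x s) = 0)
    (hid : ∀ i x t, t = σ i x (OModule.stalkMap p x.1 t) + OModule.stalkMap q x.1 (ρ i x t))
    (htr : ∀ i j (x : X.Pt) (hi : x ∈ 𝔘 i) (hj : x ∈ 𝔘 j),
      σ j ⟨x, hj⟩ = σ i ⟨x, hi⟩ + OModule.stalkMap q x ∘ₗ transEnd z hi hj) :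
    ∃ conn : MeromorphicConnection D M, ∀ i (x : 𝔘 i) t, conn.nabla x.1 t =
      formsMap D (σ i x) (nab.nabla x.1 (OModule.stalkMap p x.1 t)) +
        formsMap D (OModule.stalkMap q x.1)
          (conForm z i x (OModule.stalkMap p x.1 t) + nab.nabla x.1 (ρ i x t)) := by
  let N : ∀ i, ∀ x : 𝔘 i, M.Stalk x.1 → (M.formsIn D).fiber x.1 := fun i x t =>
    formsMap D (σ i x) (nab.nabla x.1 (OModule.stalkMap p x.1 t)) +
      formsMap D (OModule.stalkMap q x.1)
        (conForm z i x (OModule.stalkMap p x.1 t) + nab.nabla x.1 (ρ i x t))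
  have hN : ∀ i x t, N i x t =
      formsMap D (σ i x) (nab.nabla x.1 (OModule.stalkMap p x.1 t)) +
        formsMap D (OModule.stalkMap q x.1)
          (conForm z i x (OModule.stalkMap p x.1 t) + nab.nabla x.1 (ρ i x t)) :=
    fun _ _ _ => rfl
  clear_value N
  have N_eq : ∀ i j (x : X.Pt) (hi : x ∈ 𝔘 i) (hj : x ∈ 𝔘 j) t,
      N i ⟨x, hi⟩ t = N j ⟨x, hj⟩ t := by
    intro i j x hi hj t
    have h1 : ρ i ⟨x, hi⟩ t =
        transEnd z hi hj (OModule.stalkMap p x t) + ρ j ⟨x, hj⟩ t := by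
      have h2 := hid j ⟨x, hj⟩ t
      rw [htr i j x hi hj] at h2
      have h3 := congrArg (ρ i ⟨x, hi⟩) h2
      rw [map_add, LinearMap.add_apply, map_add, hρσ i ⟨x, hi⟩, LinearMap.comp_apply,
        hρq i ⟨x, hi⟩, hρq i ⟨x, hi⟩, zero_add] at h3
      exact h3
    rw [hN, hN, htr i j x hi hj, conForm_sub z hi hj, h1, formsMap_add, ← formsMap_comp_apply,
      LinearMap.add_apply, nablaEndMap_apply]
    simp only [map_add, map_sub]
    abel
  have N_add : ∀ i x s t, N i x (s + t) = N i x s + N i x t := fun i x s t => by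
    simp only [hN, map_add]
    abel
  have N_scalar : ∀ i x (c : k) s, N i x (algebraMap k (X.Stalk x.1) c • s) =
      algebraMap k (X.Stalk x.1) c • N i x s := fun i x c s => by
    rw [hN, hN]
    simp only [map_smul, nab.map_scalar, ← smul_add]
  have N_leibniz : ∀ i x f s, N i x (f • s) =
      f • N i x s + M.tmulForm D x.1 s (toPoles D x.1 (dGerm X x.1 f)) := fun i x f s => by
    have h1 := congrArg (fun t => M.tmulForm D x.1 t (toPoles D x.1 (dGerm X x.1 f))) (hid i x s)
    simp only [tmulForm_add] at h1
    rw [hN, hN, h1]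
    simp only [map_smul, nab.leibniz, map_add, formsMap_tmulForm, smul_add]
    abel
  have N_sec : ∀ i (V : Opens X.Pt) (hV : V ≤ 𝔘 i) (s : ∀ x : V, M.Stalk x.1),
      s ∈ M.germSheaf.sec V →
      (fun x : V => N i ⟨x.1, hV x.2⟩ (s x)) ∈ (M.formsIn D).sec V := by
    intro i V hV s hs
    have h2 := OModule.stalkMap_sec p hs
    have h3 := formsMap_sec D (fun y : V => σ i ⟨y.1, hV y.2⟩)
      ((E.germSheaf.hom M.germSheaf).res_mem _ V hV _ (hσ i)) _ (nab.map_sec V _ h2)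
    have h4 := conForm_sec z i V hV _ h2
    have h5 := nab.map_sec V _ (OModule.sec_hom hV (hρ i) hs)
    have h6 := formsMap_sec D (fun y : V => OModule.stalkMap q y.1) (stalkMap_hom_sec q V) _
      (((E.formsIn D).sec V).add_mem h4 h5)
    have h7 := ((M.formsIn D).sec V).add_mem h3 h6
    exact (congrArg (· ∈ (M.formsIn D).sec V) (funext fun y =>
      hN i ⟨y.1, hV y.2⟩ (s y))).mpr h7
  exact ⟨
    { nabla := fun x => AddMonoidHom.mk' (N (τ x) ⟨x, hτ x⟩) (N_add (τ x) ⟨x, hτ x⟩)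
      map_sec := by
        intro U s hs
        refine (M.formsIn D).glue U _ fun x => ?_
        let V : Opens X.Pt := U ⊓ 𝔘 (τ x.1)
        refine ⟨V, inf_le_left, ⟨x.2, hτ x.1⟩, ?_⟩
        exact (congrArg (· ∈ (M.formsIn D).sec V) (funext fun y =>
          N_eq (τ y.1) (τ x.1) y.1 (hτ y.1) y.2.2 (s ⟨y.1, y.2.1⟩))).mpr
            (N_sec (τ x.1) V inf_le_right _ (M.sec_res (inf_le_left : V ≤ U) hs))
      map_scalar := fun x => N_scalar (τ x) ⟨x, hτ x⟩
      leibniz := fun x => N_leibniz (τ x) ⟨x, hτ x⟩ },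
    fun i x t => (N_eq (τ x.1) i x.1 (hτ x.1) x.2 t).trans (hN i x t)⟩

/-- Every cocycle of the complex of a connection on a vector bundle comes from a deformation. -/
theorem exists_isGivenBy (hE : E.IsVectorBundle) (τ : X.Pt → ι) (hτ : ∀ x, x ∈ 𝔘 (τ x))
    (z : (endComplex nab).Z1 𝔘) : ∃ F : FirstOrderDeformation nab, F.IsGivenBy 𝔘 z := by
  obtain ⟨M, p, q, σ, ρ, hσ, hρ, hpq, hpσ, hρq, hρσ, hid, htr⟩ := exists_extension z τ hτ
  obtain ⟨conn, hconn⟩ := exists_connection z τ hτ hσ hρ hρq hρσ hid htr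
  have pσ : ∀ i (x : 𝔘 i), OModule.stalkMap p x.1 ∘ₗ σ i x = LinearMap.id := fun i x =>
    LinearMap.ext (hpσ i x)
  have pq : ∀ x, OModule.stalkMap p x ∘ₗ OModule.stalkMap q x = 0 := fun x =>
    LinearMap.ext (hpq x)
  have heps : ∀ x t, OModule.stalkMap (p ≫ q) x t =
      OModule.stalkMap q x (OModule.stalkMap p x t) := fun x t => by
    rw [OModule.stalkMap_comp]
    rfl
  have hproj : ∀ (x : X.Pt) t, nab.nabla x (OModule.stalkMap p x t) =
      formsMap D (OModule.stalkMap p x) (conn.nabla x t) := fun x t => by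
    rw [hconn (τ x) ⟨x, hτ x⟩, map_add, formsMap_comp_apply, formsMap_comp_apply, pσ (τ x) ⟨x, hτ x⟩, pq,
      formsMap_zero, FirstOrderDeformation.formsMap_id, add_zero]
  let F : FirstOrderDeformation nab :=
    { bundle := M
      eps := p ≫ q
      eps_sq := OModule.hom_ext_stalk fun x => LinearMap.ext fun t => by
        rw [OModule.stalkMap_comp, LinearMap.comp_apply, heps, heps, hpq, map_zero,
          OModule.stalkMap_zero, LinearMap.zero_apply]
      locallyFree := fun x => exists_dualNumber_basis hE (hσ (τ x)) (hρ (τ x)) hpq (hpσ (τ x))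
        (hρq (τ x)) (hρσ (τ x)) (hid (τ x)) (hτ x)
      conn := conn
      conn_eps := fun x t => by
        rw [heps, hconn (τ x) ⟨x, hτ x⟩, hpq, map_zero, map_zero, map_zero, zero_add, zero_add,
          hρq (τ x) ⟨x, hτ x⟩, hproj, formsMap_comp_apply, ← OModule.stalkMap_comp]
      proj := p
      proj_surjective := fun x s => ⟨_, hpσ (τ x) ⟨x, hτ x⟩ s⟩
      proj_ker := fun x => by
        ext t
        constructor
        · intro ht
          have h := hid (τ x) ⟨x, hτ x⟩ t
          rw [LinearMap.mem_ker.1 ht, map_zero, zero_add] at h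
          refine ⟨σ (τ x) ⟨x, hτ x⟩ (ρ (τ x) ⟨x, hτ x⟩ t), ?_⟩
          rw [heps, hpσ (τ x) ⟨x, hτ x⟩]
          exact h.symm
        · rintro ⟨t, rfl⟩
          rw [LinearMap.mem_ker, heps, hpq]
      proj_conn := hproj }
  have hep : ∀ i (x : 𝔘 i), F.ep x.1 ∘ₗ σ i x = OModule.stalkMap q x.1 := fun i x =>
    LinearMap.ext fun s => (heps x.1 _).trans (by rw [hpσ])
  refine ⟨F, isGivenBy_iff.2 ⟨σ, fun i => ⟨hσ i, hpσ i⟩, fun i j x hi hj => ?_, fun i x s => ?_⟩⟩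
  · rw [← LinearMap.comp_assoc, hep i ⟨x, hi⟩]
    exact htr i j x hi hj
  · rw [hep]
    refine (hconn i x (σ i x s)).trans ?_
    rw [hpσ, hρσ, map_zero, add_zero]

end Construction
end FirstOrderDeformation

/-! ### The hypercohomology group as a directed limit -/

namespace TwoTermComplex

variable (K : TwoTermComplex X)

instance : Nonempty (PointedCover X) := ⟨⟨fun _ => ⊤, fun _ => trivial⟩⟩

instance : IsDirectedOrder (PointedCover X) :=
  ⟨fun 𝔘 𝔙 => ⟨⟨fun x => 𝔘.nhd x ⊓ 𝔙.nhd x, fun x => ⟨𝔘.mem x, 𝔙.mem x⟩⟩,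
    fun _ => inf_le_left, fun _ => inf_le_right⟩⟩

instance directedSystem_cechH1 : DirectedSystem (fun 𝔘 : PointedCover X => K.cechH1 𝔘.nhd)
    fun _ _ h => K.refine id h where
  map_self _ c := by
    obtain ⟨z, rfl⟩ := QuotientAddGroup.mk_surjective c
    rfl
  map_map _ _ _ _ _ c := by
    obtain ⟨z, rfl⟩ := QuotientAddGroup.mk_surjective c
    rfl

open scoped Classical in
/-- The canonical map from the Čech group of a pointed covering to the hypercohomology group. -/
def ofCover (𝔘 : PointedCover X) : K.cechH1 𝔘.nhd →+ K.H1 :=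
  AddCommGroup.DirectLimit.of (fun 𝔘 : PointedCover X => K.cechH1 𝔘.nhd)
    (fun _ _ h => K.refine id h) 𝔘

lemma ofCover_refineZ1 {𝔘 𝔙 : PointedCover X} (h : 𝔘 ≤ 𝔙) (z : K.Z1 𝔘.nhd) :
    K.ofCover 𝔙 (QuotientAddGroup.mk (K.refineZ1 id h z)) =
      K.ofCover 𝔘 (QuotientAddGroup.mk z) := by
  classical
  exact AddCommGroup.DirectLimit.of_f (G := fun 𝔘 : PointedCover X => K.cechH1 𝔘.nhd)
    (f := fun _ _ h => K.refine id h) h (QuotientAddGroup.mk z)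

lemma exists_ofCover (c : K.H1) : ∃ (𝔘 : PointedCover X) (z : K.Z1 𝔘.nhd),
    K.ofCover 𝔘 (QuotientAddGroup.mk z) = c := by
  classical
  induction c using AddCommGroup.DirectLimit.induction_on with
  | ih 𝔘 x =>
    obtain ⟨z, rfl⟩ := QuotientAddGroup.mk_surjective x
    exact ⟨𝔘, z, rfl⟩

/-- Two classes that agree in the limit agree on a common refinement. -/
lemma exists_refine_eq {𝔘 𝔙 : PointedCover X} {z : K.Z1 𝔘.nhd} {z' : K.Z1 𝔙.nhd}
    (h : K.ofCover 𝔘 (QuotientAddGroup.mk z) = K.ofCover 𝔙 (QuotientAddGroup.mk z')) :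
    ∃ (𝔚 : PointedCover X) (h₁ : 𝔘 ≤ 𝔚) (h₂ : 𝔙 ≤ 𝔚),
      (QuotientAddGroup.mk (K.refineZ1 id h₁ z) : K.cechH1 𝔚.nhd) =
        QuotientAddGroup.mk (K.refineZ1 id h₂ z') := by
  classical
  obtain ⟨𝔚, h₁, h₂⟩ := exists_ge_ge 𝔘 𝔙
  rw [← K.ofCover_refineZ1 h₁, ← K.ofCover_refineZ1 h₂] at h
  have h' : K.ofCover 𝔚 (QuotientAddGroup.mk (K.refineZ1 id h₁ z) +
      -QuotientAddGroup.mk (K.refineZ1 id h₂ z')) = 0 := by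
    rw [AddMonoidHom.map_add, h, ← AddMonoidHom.map_add, add_neg_cancel, AddMonoidHom.map_zero]
  obtain ⟨𝔔, h₃, h0⟩ := AddCommGroup.DirectLimit.of.zero_exact
    (G := fun 𝔘 : PointedCover X => K.cechH1 𝔘.nhd) (f := fun _ _ h => K.refine id h) 𝔚 _ h'
  refine ⟨𝔔, h₁.trans h₃, h₂.trans h₃, ?_⟩
  rw [map_add, map_neg, add_neg_eq_zero] at h0
  exact h0

end TwoTermComplex

namespace FirstOrderDeformation

/-! ### The class of a deformation -/

/-- The element `c` of `ℍ¹(X, C)` is the class of a cocycle that gives the deformation `F`. -/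
def HasClass (F : FirstOrderDeformation nab) (c : (endComplex nab).H1) : Prop :=
  ∃ (𝔘 : PointedCover X) (z : (endComplex nab).Z1 𝔘.nhd), F.IsGivenBy 𝔘.nhd z ∧
    (endComplex nab).ofCover 𝔘 (QuotientAddGroup.mk z) = c

lemma IsGivenBy.hasClass {F : FirstOrderDeformation nab} {ι : Type u} {𝔘 : ι → Opens X.Pt}
    (τ : X.Pt → ι) (hτ : ∀ x, x ∈ 𝔘 (τ x)) {z : (endComplex nab).Z1 𝔘} (hz : F.IsGivenBy 𝔘 z) :
    F.HasClass ((endComplex nab).toH1 𝔘 τ hτ (QuotientAddGroup.mk z)) :=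
  ⟨⟨fun x => 𝔘 (τ x), hτ⟩, _, hz.refine τ fun _ => le_rfl, rfl⟩

lemma exists_hasClass (hE : E.IsVectorBundle) (F : FirstOrderDeformation nab) :
    ∃ c, F.HasClass c := by
  choose U hU σ hσ using F.exists_isSplitting_near hE
  obtain ⟨z, hz⟩ := exists_givenBySplittings hσ
  exact ⟨_, ⟨U, hU⟩, z, isGivenBy_iff.2 ⟨σ, hz⟩, rfl⟩

lemma HasClass.unique {F : FirstOrderDeformation nab} {c c' : (endComplex nab).H1}
    (hc : F.HasClass c) (hc' : F.HasClass c') : c = c' := by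
  obtain ⟨𝔘, z, hz, rfl⟩ := hc
  obtain ⟨𝔙, z', hz', rfl⟩ := hc'
  obtain ⟨𝔚, h₁, h₂⟩ := exists_ge_ge 𝔘 𝔙
  rw [← (endComplex nab).ofCover_refineZ1 h₁, ← (endComplex nab).ofCover_refineZ1 h₂,
    mk_eq_mk_of_isGivenBy (hz.refine id h₁) (hz'.refine id h₂)]

lemma HasClass.of_iso {F G : FirstOrderDeformation nab} (φ : Iso F G) {c : (endComplex nab).H1}
    (hc : F.HasClass c) : G.HasClass c := by
  obtain ⟨𝔘, z, hz, hc⟩ := hc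
  exact ⟨𝔘, z, hz.of_iso φ, hc⟩

lemma HasClass.nonempty_iso {F G : FirstOrderDeformation nab} {c : (endComplex nab).H1}
    (hF : F.HasClass c) (hG : G.HasClass c) : Nonempty (Iso F G) := by
  obtain ⟨𝔘, z, hz, rfl⟩ := hF
  obtain ⟨𝔙, z', hz', h⟩ := hG
  obtain ⟨𝔚, h₂, h₁, h⟩ := (endComplex nab).exists_refine_eq h
  exact nonempty_iso_of_isGivenBy id 𝔚.mem (hz.refine id h₁) ((hz'.refine id h₂).of_mk_eq_mk h)

lemma exists_hasClass_eq (hE : E.IsVectorBundle) (c : (endComplex nab).H1) :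
    ∃ F : FirstOrderDeformation nab, F.HasClass c := by
  obtain ⟨𝔘, z, rfl⟩ := (endComplex nab).exists_ofCover c
  obtain ⟨F, hF⟩ := exists_isGivenBy hE id 𝔘.mem z
  exact ⟨F, 𝔘, z, hF, rfl⟩

/-- A deformation with the class of the cocycle `z` is isomorphic to the deformation constructed from
`z`, and is therefore itself given by `z` on the same covering. -/
lemma isGivenBy_iff_hasClass (hE : E.IsVectorBundle) {F : FirstOrderDeformation nab} {ι : Type u}
    {𝔘 : ι → Opens X.Pt} (τ : X.Pt → ι) (hτ : ∀ x, x ∈ 𝔘 (τ x)) {z : (endComplex nab).Z1 𝔘} :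
    F.IsGivenBy 𝔘 z ↔
      F.HasClass ((endComplex nab).toH1 𝔘 τ hτ (QuotientAddGroup.mk z)) := by
  refine ⟨fun h => h.hasClass τ hτ, fun h => ?_⟩
  obtain ⟨G, hG⟩ := exists_isGivenBy hE τ hτ z
  obtain ⟨φ⟩ := (hG.hasClass τ hτ).nonempty_iso h
  exact hG.of_iso φ

/-- The class of a deformation identifies the set of isomorphism classes with `ℍ¹(X, C)`. -/
theorem exists_equiv_hasClass (hE : E.IsVectorBundle) :
    ∃ Φ : Quotient (isoSetoid nab) ≃ (endComplex nab).H1,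
      ∀ (F : FirstOrderDeformation nab) c, F.HasClass c ↔ Φ (Quotient.mk _ F) = c := by
  choose cl hcl using fun F : FirstOrderDeformation nab => F.exists_hasClass hE
  let Φ : Quotient (isoSetoid nab) → (endComplex nab).H1 :=
    Quotient.lift cl fun F G ⟨φ⟩ => ((hcl F).of_iso φ).unique (hcl G)
  refine ⟨Equiv.ofBijective Φ ⟨?_, fun c => ?_⟩, fun F c => ⟨fun h => (hcl F).unique h, ?_⟩⟩
  · rintro ⟨F⟩ ⟨G⟩ (h : cl F = cl G)
    exact Quotient.sound ((hcl F).nonempty_iso (h ▸ hcl G))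
  · obtain ⟨F, hF⟩ := exists_hasClass_eq hE c
    exact ⟨Quotient.mk _ F, (hcl F).unique hF⟩
  · rintro rfl
    exact hcl F

/-- On a sufficiently fine covering every deformation has splittings, so that every class comes
from a cocycle; the injectivity holds for every covering. -/
theorem toH1_bijective (hE : E.IsVectorBundle) {ι : Type u} {𝔘 : ι → Opens X.Pt} (τ : X.Pt → ι)
    (hτ : ∀ x, x ∈ 𝔘 (τ x)) (h𝔘 : IsSufficientlyFine E 𝔘) :
    Function.Bijective ((endComplex nab).toH1 𝔘 τ hτ) := by
  refine ⟨fun c c' h => ?_, fun c => ?_⟩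
  · obtain ⟨z, rfl⟩ := QuotientAddGroup.mk_surjective c
    obtain ⟨z', rfl⟩ := QuotientAddGroup.mk_surjective c'
    obtain ⟨F, hF⟩ := exists_isGivenBy hE τ hτ z
    have h' := (isGivenBy_iff_hasClass hE τ hτ).1 hF
    rw [h] at h'
    exact mk_eq_mk_of_isGivenBy hF ((isGivenBy_iff_hasClass hE τ hτ).2 h')
  · obtain ⟨F, hF⟩ := exists_hasClass_eq hE c
    choose σ hσ using fun i => F.exists_isSplitting_of_isAcyclicOpen hE (h𝔘 i).1 (h𝔘 i).2
    obtain ⟨z, hz⟩ := exists_givenBySplittings hσ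
    have hz' : F.IsGivenBy 𝔘 z := isGivenBy_iff.2 ⟨σ, hz⟩
    exact ⟨QuotientAddGroup.mk z, (hz'.hasClass τ hτ).unique hF⟩

end FirstOrderDeformation

end Deformations

end

theorem mainTheorem7 {k : Type u} [Field k] [IsAlgClosed k] (X : SpaceOver.{u} k)
    (hX : X.IsCompleteScheme ∨ X.IsComplexSpace) (D : CartierDivisor X) (E : OModule X)
    (hE : E.IsVectorBundle) (nab : MeromorphicConnection D E) :
    ∃ Φ : Quotient (FirstOrderDeformation.isoSetoid nab) ≃ (endComplex nab).H1,
      (∀ (ι : Type u) (𝔘 : ι → Opens X.Pt) (τ : X.Pt → ι) (hτ : ∀ x, x ∈ 𝔘 (τ x))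
        (F : FirstOrderDeformation nab) (z : (endComplex nab).Z1 𝔘),
        F.IsGivenBy 𝔘 z ↔
          Φ (Quotient.mk _ F) = (endComplex nab).toH1 𝔘 τ hτ (QuotientAddGroup.mk z)) ∧
      (∀ (ι : Type u) (𝔘 : ι → Opens X.Pt) (τ : X.Pt → ι) (hτ : ∀ x, x ∈ 𝔘 (τ x)),
        IsSufficientlyFine E 𝔘 → Function.Bijective ((endComplex nab).toH1 𝔘 τ hτ)) := by
  obtain ⟨Φ, hΦ⟩ := FirstOrderDeformation.exists_equiv_hasClass (nab := nab) hE
  exact ⟨Φ, fun ι 𝔘 τ hτ F z =>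
      (FirstOrderDeformation.isGivenBy_iff_hasClass hE τ hτ).trans (hΦ F _),
    fun ι 𝔘 τ hτ h => FirstOrderDeformation.toH1_bijective hE τ hτ h⟩
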